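/- Let $D$ be a finite set with at least two elements, and let $T_D$ be a dimension partition tree of $D$: its vertices are non-empty subsets of $D$, its root is $D$, every vertex $\alpha$ with $\#\alpha\ge 2$ is the disjoint union of its set of sons $S(\alpha)$, which has at least two elements, and the vertices with $\#\alpha=1$ have no sons (they are the leaves). Let $(V_j,\|\cdot\|_j)$, $j\in D$, be real Banach spaces, and put $\mathbf V_\alpha={}_a\bigotimes_{j\in\alpha}V_j$ (algebraic tensor product), so that $\mathbf V_\alpha={}_a\bigotimes_{\beta\in S(\alpha)}\mathbf V_\beta$ for every non-leaf $\alpha$. For each non-leaf vertex $\alpha\in T_D$ let $\|\cdot\|_\alpha$ be a norm on $\mathbf V_\alpha$ (at the leaf $\{j\}$ it is $\|\cdot\|_j$) such that (i) the tensor product map $\times_{\beta\in S(\alpha)}(\mathbf V_\beta,\|\cdot\|_\beta)\to(\mathbf V_\alpha,\|\cdot\|_\alpha)$ is continuous for each non-leaf $\alpha$; (ii) $\|\cdot\|_{\vee(S(\alpha))}\lesssim\|\cdot\|_\alpha$ for each non-leaf $\alpha$, where $\|\mathbf v\|_{\vee(S(\alpha))}=\sup\{|(\bigotimes_{\beta\in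 S(\alpha)}\varphi_\beta)(\mathbf v)| : \varphi_\beta\in(\mathbf V_\beta,\|\cdot\|_\beta)^*,\ \|\varphi_\beta\|\le 1\}$ is the injective norm. Let $\mathbf V_{D,\|\cdot\|_D}$ be the completion of $(\mathbf V_D,\|\cdot\|_D)$. For $\mathbf v\in\mathbf V_D$ and $\alpha\in T_D$ let $U_\alpha^{\min}(\mathbf v)$ be the smallest subspace $U\subset\mathbf V_\alpha$ with $\mathbf v\in U\otimes_a\mathbf V_{D\setminus\alpha}$ (so $U_D^{\min}(\mathbf v)=\mathrm{span}\{\mathbf v\}$); the tuple $(\dim U^{\min}_\alpha(\mathbf v))_{\alpha\in T_D}$ is the tree-based rank of $\mathbf v$. For $\mathfrak r\in\mathbb N^{T_D}$ let $$\mathcal{FT}_{\le\mathfrak r}(\mathbf V_D)=\{\mathbf v\in\mathbf V_D:\dim U_\alpha^{\min}(\mathbf v)\le r_\alpha\text{ for all }\alpha\in T_D\}.$$ Then $\mathcal{FT}_{\le\mathfrak r}(\mathbf V_D)$ carries an analytic Banach manifold structure (the model space may vary with the chart) with the following properties, which determine it. The point $\mathbf 0$ is isolated. Let $\mathbf 0\ne\mathbf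 v\in\mathcal{FT}_{\le\mathfrak r}(\mathbf V_D)$ have tree-based rank $\mathfrak s$, let $W_k$ be any closed complement of $U_k^{\min}(\mathbf v)$ in $V_k$ and $(u^{(k)}_i)_{1\le i\le s_k}$ any basis of $U_k^{\min}(\mathbf v)$ ($k\in D$). Then the set $\mathcal U(\mathbf v)$ of tensors $\mathbf w$ of tree-based rank $\mathfrak s$ with $V_k=U^{\min}_k(\mathbf w)\oplus W_k$ for all $k$ is open, and the map $$(\mathfrak L,\mathfrak C)\longmapsto\sum_{(i_\alpha)_{\alpha\in T_D}}\Big(\prod_{\mu\text{ non-leaf}}C^{(\mu)}_{i_\mu,(i_\beta)_{\beta\in S(\mu)}}\Big)\bigotimes_{k\in D}\big(u^{(k)}_{i_k}+L_k(u^{(k)}_{i_k})\big)\qquad(1\le i_\alpha\le s_\alpha,\ s_D=1)$$ is an analytic submersion of $\times_{k\in D}\mathcal L(U^{\min}_k(\mathbf v),W_k)\times\mathbb R^{\mathfrak s}_*$ onto $\mathcal U(\mathbf v)$. Here $\mathbb R^{\mathfrak s}_*$ is the open set of all $\mathfrak C=(C^{(\mu)})_{\mu\text{ non-leaf}}$,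 $C^{(\mu)}\in\mathbb R^{s_\mu\times(\times_{\beta\in S(\mu)}s_\beta)}$, such that the matricisation of $C^{(\mu)}$ with respect to each of the indices $i_\mu$ and $i_\beta$, $\beta\in S(\mu)$, has full row rank. Moreover, with this structure, $\mathcal{FT}_{\le\mathfrak r}(\mathbf V_D)$ is an immersed submanifold of $\mathbf V_{D,\|\cdot\|_D}$: the standard inclusion $\mathcal{FT}_{\le\mathfrak r}(\mathbf V_D)\to\mathbf V_{D,\|\cdot\|_D}$ is an injective analytic immersion, i.e. every point has an open neighbourhood that the inclusion maps isomorphically onto an analytic submanifold (locally modelled on complemented subspaces) of $\mathbf V_{D,\|\cdot\|_D}$. -/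

import Mathlib

open scoped TensorProduct Topology

noncomputable section

namespace TreeTensor

universe u v w

/-! ### Banach manifolds (with model spaces varying from chart to chart) -/

/-- An analytic atlas on a set `S`: charts are bijections of subsets of `S` onto open subsets of
Banach spaces (which may differ from chart to chart), covering `S`, with open overlaps and analytic
transition maps in both directions. -/
structure BanachAtlas {X : Type w} (S : Set X) where
  Idx : Type w
  E : Idx → Type w
  [instGroup : ∀ i, NormedAddCommGroup (E i)]
  [instSpace : ∀ i, NormedSpace ℝ (E i)]
  [instComplete : ∀ i, CompleteSpace (E i)]
  chart : ∀ i, PartialEquiv X (E i)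
  source_subset : ∀ i, (chart i).source ⊆ S
  covers : ∀ x ∈ S, ∃ i, x ∈ (chart i).source
  isOpen_target : ∀ i, IsOpen (chart i).target
  isOpen_overlap : ∀ i j, IsOpen (chart i '' ((chart i).source ∩ (chart j).source))
  analytic_transition : ∀ i j, AnalyticOnNhd ℝ (chart j ∘ (chart i).symm)
    (chart i '' ((chart i).source ∩ (chart j).source))

attribute [instance] BanachAtlas.instGroup BanachAtlas.instSpace BanachAtlas.instComplete

namespace BanachAtlas

variable {X : Type w} {S : Set X} (A : BanachAtlas S)

/-- Open subsets of `S` in the topology defined by the atlas. -/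
def IsOpenSet (O : Set X) : Prop :=
  O ⊆ S ∧ ∀ i, IsOpen (A.chart i '' (O ∩ (A.chart i).source))

/-- `f` restricts to an analytic submersion from the open subset `Ω` of a Banach space `P` into the
manifold `S`: in charts it is analytic, with surjective derivative whose kernel is complemented. -/
def IsSubmersionOn {P : Type*} [NormedAddCommGroup P] [NormedSpace ℝ P]
    (f : P → X) (Ω : Set P) : Prop :=
  ∀ p ∈ Ω, ∃ i, f p ∈ (A.chart i).source ∧ (∀ᶠ q in 𝓝 p, f q ∈ (A.chart i).source) ∧
    AnalyticAt ℝ (A.chart i ∘ f) p ∧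
    Function.Surjective (fderiv ℝ (A.chart i ∘ f) p) ∧
    (LinearMap.ker (fderiv ℝ (A.chart i ∘ f) p : P →ₗ[ℝ] A.E i)).ClosedComplemented

/-- `F : S → Y` is an (analytic) immersion at `x`: some open neighbourhood `O` of `x` is mapped
by `F` isomorphically onto a submanifold of the Banach space `Y`.

Here the submanifold is `F(O) = ψ⁻¹(E₁ ∩ ψ.target)` for a complemented subspace `E₁` of `Y` and an
analytic diffeomorphism `ψ` between open subsets of `Y` (so `ψ` restricted to `F(O)` is its chart),
the neighbourhood is `O = φ⁻¹(g.target)` for a chart `φ = A.chart i` at `x`, and the analytic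
diffeomorphism `g` from `E₁ ∩ ψ.target` onto `φ(O)` is the inverse of `F : O → F(O)` read in
the charts `φ` and `ψ`. -/
def IsImmersionAt {Y : Type*} [NormedAddCommGroup Y] [NormedSpace ℝ Y]
    (F : X → Y) (x : X) : Prop :=
  ∃ (i : A.Idx) (ψ : OpenPartialHomeomorph Y Y) (E₁ : Submodule ℝ Y)
    (g : OpenPartialHomeomorph E₁ (A.E i)),
    x ∈ (A.chart i).source ∧ A.chart i x ∈ g.target ∧ g.target ⊆ (A.chart i).target ∧
    E₁.ClosedComplemented ∧
    AnalyticOnNhd ℝ ψ ψ.source ∧ AnalyticOnNhd ℝ ψ.symm ψ.target ∧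
    AnalyticOnNhd ℝ g g.source ∧ AnalyticOnNhd ℝ g.symm g.target ∧
    g.source = {e : E₁ | (e : Y) ∈ ψ.target} ∧
    ∀ e ∈ g.source, F ((A.chart i).symm (g e)) = ψ.symm (e : Y)

/-- The image of the manifold `S` under `F` is an immersed submanifold of `Y`: `F` is an injective
immersion. -/
def IsImmersedSubmanifold {Y : Type*} [NormedAddCommGroup Y] [NormedSpace ℝ Y]
    (F : X → Y) : Prop :=
  Set.InjOn F S ∧ ∀ x ∈ S, A.IsImmersionAt F x

end BanachAtlas

/-! ### Dimension partition trees -/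

/-- A dimension partition tree of the finite index set `ι`; `sons α` is the set of sons of the
vertex `α` (its values outside `verts` are irrelevant). -/
structure PartitionTree (ι : Type*) [Fintype ι] [DecidableEq ι] where
  verts : Finset (Finset ι)
  sons : Finset ι → Finset (Finset ι)
  nonempty : ∀ α ∈ verts, α.Nonempty
  root_mem : Finset.univ ∈ verts
  sons_subset : ∀ α ∈ verts, sons α ⊆ verts
  /-- every vertex other than the root is the son of some vertex -/
  exists_father : ∀ β ∈ verts, β ≠ Finset.univ → ∃ α ∈ verts, β ∈ sons α
  two_le_card_sons : ∀ α ∈ verts, 2 ≤ α.card → 2 ≤ (sons α).card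
  union_sons : ∀ α ∈ verts, 2 ≤ α.card → (sons α).biUnion id = α
  disjoint_sons : ∀ α ∈ verts, 2 ≤ α.card → ∀ β ∈ sons α, ∀ β' ∈ sons α, β ≠ β' → Disjoint β β'
  sons_eq_empty : ∀ α ∈ verts, α.card = 1 → sons α = ∅

namespace PartitionTree

variable {ι : Type*} [Fintype ι] [DecidableEq ι] (T : PartitionTree ι)

/-- The vertices that are not leaves. -/
def inner : Finset (Finset ι) := T.verts.filter fun α => (T.sons α).Nonempty

variable {T}

lemma mem_verts_of_inner {α : Finset ι} (h : α ∈ T.inner) : α ∈ T.verts :=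
  (Finset.mem_filter.1 h).1

lemma two_le_card_of_inner {α : Finset ι} (h : α ∈ T.inner) : 2 ≤ α.card := by
  obtain ⟨hv, hs⟩ := Finset.mem_filter.1 h
  by_contra hc
  have h0 := (T.nonempty α hv).card_pos
  have h1 : α.card = 1 := by omega
  rw [T.sons_eq_empty α hv h1] at hs
  exact Finset.not_nonempty_empty hs

lemma subset_of_son {α β : Finset ι} (h : α ∈ T.inner) (hβ : β ∈ T.sons α) : β ⊆ α := by
  rw [← T.union_sons α (mem_verts_of_inner h) (two_le_card_of_inner h)]
  exact Finset.subset_biUnion_of_mem id hβ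

lemma exists_son {α : Finset ι} (h : α ∈ T.inner) {j : ι} (hj : j ∈ α) :
    ∃ β ∈ T.sons α, j ∈ β := by
  rw [← T.union_sons α (mem_verts_of_inner h) (two_le_card_of_inner h)] at hj
  simpa using hj

lemma son_unique {α : Finset ι} (h : α ∈ T.inner) {j : ι} {β β' : Finset ι}
    (hβ : β ∈ T.sons α) (hβ' : β' ∈ T.sons α) (hj : j ∈ β) (hj' : j ∈ β') : β = β' := by
  by_contra hne
  exact Finset.disjoint_left.1 (T.disjoint_sons α (mem_verts_of_inner h) (two_le_card_of_inner h)
    β hβ β' hβ' hne) hj hj'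

/-- Every singleton is a vertex (a leaf). -/
lemma singleton_mem (T : PartitionTree ι) (k : ι) : ({k} : Finset ι) ∈ T.verts := by
  have key : ∀ n : ℕ, ∀ α ∈ T.verts, k ∈ α → α.card = n → ({k} : Finset ι) ∈ T.verts := by
    intro n
    induction n using Nat.strong_induction_on with
    | _ n ih =>
      intro α hα hk hn
      by_cases hc : 2 ≤ α.card
      · have hin : α ∈ T.inner := by
          refine Finset.mem_filter.2 ⟨hα, Finset.card_pos.1 ?_⟩
          have := T.two_le_card_sons α hα hc
          omega
        obtain ⟨β, hβ, hkβ⟩ := exists_son hin hk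
        have hsub := subset_of_son hin hβ
        have hne : β ≠ α := by
          rintro rfl
          obtain ⟨γ, hγ, hγne⟩ := Finset.exists_mem_ne
            (lt_of_lt_of_le one_lt_two (T.two_le_card_sons β hα hc)) β
          obtain ⟨x, hx⟩ := T.nonempty γ (T.sons_subset β hα hγ)
          exact hγne (son_unique hin hγ hβ hx (subset_of_son hin hγ hx))
        have hlt : β.card < n := hn ▸ Finset.card_lt_card (hsub.ssubset_of_ne hne)
        exact ih _ hlt β (T.sons_subset α hα hβ) hkβ rfl
      · have hα1 : α = {k} := by
          obtain ⟨x, hx⟩ := Finset.card_eq_one.1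
            (show α.card = 1 by have := (T.nonempty α hα).card_pos; omega)
          rw [hx, Finset.mem_singleton] at hk
          rw [hx, hk]
        exact hα1 ▸ hα
  exact key _ Finset.univ T.root_mem (Finset.mem_univ k) rfl

end PartitionTree

/-! ### Algebraic tensor spaces and minimal subspaces -/

variable {ι : Type u} [Fintype ι] [DecidableEq ι]

/-- The algebraic tensor space `V_α = ⨂_{j ∈ α} V_j`. The full space is `TS V Finset.univ`. -/
abbrev TS (V : ι → Type v) [∀ j, NormedAddCommGroup (V j)] [∀ j, NormedSpace ℝ (V j)]
    (α : Finset ι) : Type (max u v) :=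
  ⨂[ℝ] j : α, V j

variable (V : ι → Type v) [∀ j, NormedAddCommGroup (V j)] [∀ j, NormedSpace ℝ (V j)]

/-- `D = α ∪ αᶜ`. -/
def splitEquiv (α : Finset ι) : (Finset.univ : Finset ι) ≃ α ⊕ (αᶜ : Finset ι) where
  toFun j := if h : (j : ι) ∈ α then Sum.inl ⟨j, h⟩ else Sum.inr ⟨j, Finset.mem_compl.2 h⟩
  invFun := Sum.elim (fun j => ⟨j, Finset.mem_univ _⟩) (fun j => ⟨j, Finset.mem_univ _⟩)
  left_inv j := by
    by_cases h : (j : ι) ∈ α <;> simp [h]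
  right_inv j := by
    rcases j with j | j
    · simp
    · simp [Finset.mem_compl.1 j.2]

/-- The canonical identification `V_D = V_α ⊗ V_{D \ α}`. -/
def split (α : Finset ι) : TS V Finset.univ ≃ₗ[ℝ] TS V α ⊗[ℝ] TS V αᶜ :=
  (PiTensorProduct.reindex ℝ (fun j : (Finset.univ : Finset ι) => V j) (splitEquiv α)).trans
    (PiTensorProduct.tmulEquivDep ℝ
      (fun j : α ⊕ (αᶜ : Finset ι) => V ((splitEquiv α).symm j))).symm

lemma split_tprod (α : Finset ι) (f : ∀ j : (Finset.univ : Finset ι), V j) :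
    split V α (PiTensorProduct.tprod ℝ f) =
      PiTensorProduct.tprod ℝ (fun j : α => f ⟨j, Finset.mem_univ _⟩) ⊗ₜ[ℝ]
        PiTensorProduct.tprod ℝ (fun j : (αᶜ : Finset ι) => f ⟨j, Finset.mem_univ _⟩) := by
  unfold split
  erw [LinearEquiv.trans_apply, PiTensorProduct.reindex_tprod,
    PiTensorProduct.tmulEquivDep_symm_apply]
  rfl

variable {V}

/-- The minimal subspace `U_α^min(v) ⊆ V_α`: the smallest subspace `U` of `V_α` such that
`v ∈ U ⊗ V_{D \ α}`. -/
def minSubspace (α : Finset ι) (v : TS V Finset.univ) : Submodule ℝ (TS V α) :=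
  sInf {U | split V α v ∈ LinearMap.range (LinearMap.rTensor (TS V αᶜ) U.subtype)}

/-- The `α`-component `dim U_α^min(v)` of the tree-based rank of `v`. -/
def tbRank (v : TS V Finset.univ) (α : Finset ι) : ℕ := Module.finrank ℝ (minSubspace α v)

/-- The canonical identification of `V_{{k}}` with `V_k`. -/
def leafEquiv (k : ι) : TS V {k} ≃ₗ[ℝ] V k :=
  PiTensorProduct.subsingletonEquiv (R := ℝ) (s := fun j : ({k} : Finset ι) => V j)
    ⟨k, Finset.mem_singleton_self k⟩

/-- The minimal subspace `U_k^min(v)` at the leaf `{k}`, as a subspace of `V_k`. -/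
def leafMinSubspace (k : ι) (v : TS V Finset.univ) : Submodule ℝ (V k) :=
  (minSubspace {k} v).map (leafEquiv k).toLinearMap

/-- The set `FT_{≤ r}(V_D)` of tensors of tree-based rank bounded by `r`. -/
def boundedRank (V : ι → Type v) [∀ j, NormedAddCommGroup (V j)] [∀ j, NormedSpace ℝ (V j)]
    (T : PartitionTree ι) (r : Finset ι → ℕ) : Set (TS V Finset.univ) :=
  {v | ∀ α ∈ T.verts, tbRank v α ≤ r α}

/-! ### Tensor products over the sons of a vertex -/

/-- Restriction of a family indexed by `α` to a son `β` of `α`. -/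
def restrictSon {T : PartitionTree ι} {α : Finset ι} (hα : α ∈ T.inner) (f : ∀ j : α, V j)
    (β : T.sons α) (j : (β : Finset ι)) : V j :=
  f ⟨j, T.subset_of_son hα β.2 j.2⟩

lemma restrictSon_update {T : PartitionTree ι} {α : Finset ι} (hα : α ∈ T.inner)
    [DecidableEq α] (f : ∀ j : α, V j) (j : α) (β : T.sons α) (hj : (j : ι) ∈ (β : Finset ι))
    (x : V j) :
    (fun γ => PiTensorProduct.tprod ℝ (restrictSon hα (Function.update f j x) γ)) =
      Function.update (fun γ => PiTensorProduct.tprod ℝ (restrictSon hα f γ)) β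
        (PiTensorProduct.tprod ℝ (Function.update (restrictSon hα f β) ⟨j, hj⟩ x)) := by
  funext γ
  by_cases hγ : γ = β
  · subst hγ
    rw [Function.update_self]
    congr 1
    funext i
    by_cases hi : i = ⟨j, hj⟩
    · subst hi
      rw [Function.update_self]
      exact Function.update_self (β := fun j : α => V j) j x f
    · rw [Function.update_of_ne hi]
      exact Function.update_of_ne (β := fun j : α => V j)
        (fun h => hi (Subtype.ext (show (i : ι) = j from congrArg Subtype.val h))) x f
  · rw [Function.update_of_ne hγ]
    congr 1
    funext i
    refine Function.update_of_ne (β := fun j : α => V j) (fun h => hγ (Subtype.ext ?_)) x f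
    have hij : (i : ι) = j := congrArg Subtype.val h
    exact T.son_unique hα γ.2 β.2 (hij ▸ i.2) hj

/-- The canonical map `V_α → ⨂_{β ∈ S(α)} V_β`, `⨂_{j ∈ α} v_j ↦ ⨂_β (⨂_{j ∈ β} v_j)`. -/
def sonsMap {T : PartitionTree ι} {α : Finset ι} (hα : α ∈ T.inner) :
    TS V α →ₗ[ℝ] ⨂[ℝ] β : T.sons α, TS V β :=
  PiTensorProduct.lift
    { toFun := fun f => PiTensorProduct.tprod ℝ
        (fun β : T.sons α => PiTensorProduct.tprod ℝ (restrictSon hα f β))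
      map_update_add' := by
        intro _ f j x y
        obtain ⟨β, hβ, hj⟩ := T.exists_son hα j.2
        simp only [restrictSon_update hα f j ⟨β, hβ⟩ hj, MultilinearMap.map_update_add]
      map_update_smul' := by
        intro _ f j c x
        obtain ⟨β, hβ, hj⟩ := T.exists_son hα j.2
        simp only [restrictSon_update hα f j ⟨β, hβ⟩ hj, MultilinearMap.map_update_smul] }

lemma sonsMap_tprod {T : PartitionTree ι} {α : Finset ι} (hα : α ∈ T.inner) (f : ∀ j : α, V j) :
    sonsMap hα (PiTensorProduct.tprod ℝ f) = PiTensorProduct.tprod ℝ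
      (fun β : T.sons α => PiTensorProduct.tprod ℝ (restrictSon hα f β)) :=
  PiTensorProduct.lift.tprod f

lemma sonsMap_bijective {T : PartitionTree ι} {α : Finset ι} (hα : α ∈ T.inner) :
    Function.Bijective (sonsMap (V := V) hα) := by
  choose son hson hmem using fun j : α => T.exists_son hα j.2
  let b : ∀ j : ι, Module.Basis (Module.Basis.ofVectorSpaceIndex ℝ (V j)) ℝ (V j) :=
    fun j => Module.Basis.ofVectorSpace ℝ (V j)
  let B := Basis.piTensorProduct (fun j : α => b j)
  let B' := Basis.piTensorProduct
    (fun β : T.sons α => Basis.piTensorProduct (fun j : (β : Finset ι) => b j))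
  let e : (∀ j : α, Module.Basis.ofVectorSpaceIndex ℝ (V j)) ≃
      (∀ β : T.sons α, ∀ j : (β : Finset ι), Module.Basis.ofVectorSpaceIndex ℝ (V j)) :=
    { toFun := fun p β j => p ⟨j, T.subset_of_son hα β.2 j.2⟩
      invFun := fun q j => q ⟨son j, hson j⟩ ⟨j, hmem j⟩
      left_inv := fun p => rfl
      right_inv := fun q => by
        funext β j
        have h : (⟨son ⟨j, T.subset_of_son hα β.2 j.2⟩, hson _⟩ : T.sons α) = β :=
          Subtype.ext (T.son_unique hα (hson _) β.2 (hmem _) j.2)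
        have key : ∀ (γ : T.sons α) (hγ : γ = β) (hj : (j : ι) ∈ (γ : Finset ι)),
            q γ ⟨j, hj⟩ = q β j := by
          rintro γ rfl hj
          rfl
        exact key _ h _ }
  have heq : sonsMap (V := V) hα = (B.equiv B' e).toLinearMap := by
    refine B.ext fun p => ?_
    rw [LinearEquiv.coe_coe, Module.Basis.equiv_apply, Basis.piTensorProduct_apply,
      Basis.piTensorProduct_apply, sonsMap_tprod]
    congr 1
    funext β
    rw [Basis.piTensorProduct_apply]
    rfl
  rw [heq]
  exact (B.equiv B' e).bijective

/-- The canonical identification `V_α = ⨂_{β ∈ S(α)} V_β`. -/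
def sonsEquiv {T : PartitionTree ι} {α : Finset ι} (hα : α ∈ T.inner) :
    TS V α ≃ₗ[ℝ] ⨂[ℝ] β : T.sons α, TS V β :=
  LinearEquiv.ofBijective (sonsMap hα) (sonsMap_bijective hα)

/-- A family of norms `‖·‖_α` on the spaces `V_α`, `α ∈ T`, which at the leaf `{k}` is the given
norm of `V_k` (the values for `α ∉ T` are irrelevant). -/
structure TreeNorms (T : PartitionTree ι) (V : ι → Type v) [∀ j, NormedAddCommGroup (V j)]
    [∀ j, NormedSpace ℝ (V j)] where
  nrm : ∀ α : Finset ι, Seminorm ℝ (TS V α)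
  definite : ∀ α ∈ T.verts, ∀ x, nrm α x = 0 → x = 0
  leaf : ∀ k x, nrm {k} x = ‖leafEquiv k x‖

namespace TreeNorms

variable {T : PartitionTree ι} (N : TreeNorms T V)

/-- The tensor product map `×_{β ∈ S(α)} V_β → V_α` is continuous for every non-leaf `α`. -/
def TensorMapContinuous : Prop :=
  ∀ α, ∀ hα : α ∈ T.inner, ∃ C : ℝ, ∀ x : ∀ β : T.sons α, TS V β,
    N.nrm α ((sonsEquiv hα).symm (PiTensorProduct.tprod ℝ x)) ≤ C * ∏ β : T.sons α, N.nrm β (x β)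

/-- The injective norm on `V_α = ⨂_{β ∈ S(α)} V_β` built from the norms `‖·‖_β` of the sons: the
supremum of `|(⨂_β φ_β)(v)|` over linear forms `φ_β` on `V_β` of dual norm at most `1`. -/
def injNorm {α : Finset ι} (hα : α ∈ T.inner) (v : TS V α) : ℝ :=
  sSup {t | ∃ φ : ∀ β : T.sons α, Module.Dual ℝ (TS V β),
    (∀ β x, |φ β x| ≤ N.nrm β x) ∧
      t = |PiTensorProduct.dualDistrib (PiTensorProduct.tprod ℝ φ) (sonsEquiv hα v)|}

/-- For every non-leaf `α`, `‖·‖_α` is not weaker than the injective norm from the sons. -/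
def DominatesInjective : Prop :=
  ∀ α, ∀ hα : α ∈ T.inner, ∃ C : ℝ, ∀ v : TS V α, N.injNorm hα v ≤ C * N.nrm α v

end TreeNorms

/-! ### The manifold structure of `FT_{≤ r}(V_D)` -/

section Parametrization

variable (T : PartitionTree ι) (s : Finset ι → ℕ)

/-- The space `ℝ^s` of transfer tensors `C^(μ) ∈ ℝ^{s_μ × (×_{β ∈ S(μ)} s_β)}`, one for each
non-leaf vertex `μ` (for the root, `s_D = 1`). -/
abbrev Coeffs : Type u :=
  ∀ μ : T.inner, Fin (s μ) → (∀ β : T.sons μ, Fin (s β)) → ℝ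

/-- The subset `ℝ^s_*`: all the matricisations `M_μ(C^(μ))` and `M_β(C^(μ))`, `β ∈ S(μ)`, have
linearly independent rows. (The row of index `a` of `M_β(C)` is the family of the entries of `C`
whose `β`-index is `a`.) -/
def Coeffs.IsRegular {T : PartitionTree ι} {s : Finset ι → ℕ} (C : Coeffs T s) : Prop :=
  ∀ μ : T.inner, LinearIndependent ℝ (C μ) ∧
    ∀ β : T.sons μ, LinearIndependent ℝ (fun a : Fin (s β) =>
      fun q : Fin (s μ) × (∀ δ : T.sons μ, Fin (s δ)) => C μ q.1 (Function.update q.2 β a))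

variable {T s} {U W : ∀ k, Submodule ℝ (V k)}

/-- The tensor with parameters `L_k ∈ 𝓛(U_k, W_k)` and `C ∈ ℝ^s`, given bases `u^(k)` of `U_k`:
`∑_i (∏_μ C^(μ)_{i_μ, (i_β)_{β ∈ S(μ)}}) ⨂_k (u^(k)_{i_k} + L_k u^(k)_{i_k})`,
summed over all families `(i_α)_{α ∈ T}` of indices `1 ≤ i_α ≤ s_α`. -/
def treeParam (b : ∀ k, Module.Basis (Fin (s {k})) ℝ (U k))
    (p : (∀ k, U k →L[ℝ] W k) × Coeffs T s) : TS V Finset.univ :=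
  ∑ i : (∀ α : T.verts, Fin (s α)),
    (∏ μ : T.inner, p.2 μ (i ⟨μ, T.mem_verts_of_inner μ.2⟩)
        (fun β => i ⟨β, T.sons_subset μ (T.mem_verts_of_inner μ.2) β.2⟩)) •
      PiTensorProduct.tprod ℝ (fun k : (Finset.univ : Finset ι) =>
        (b k (i ⟨{(k : ι)}, T.singleton_mem k⟩) : V k) +
          (p.1 k (b k (i ⟨{(k : ι)}, T.singleton_mem k⟩)) : V k))

end Parametrization

/-- The domain `𝓤(v)`: tensors `w` with the tree-based rank of `v` such that `W_k` is a complement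
of `U_k^min(w)` for every `k`. -/
def chartDomain (T : PartitionTree ι) (v : TS V Finset.univ) (W : ∀ k, Submodule ℝ (V k)) :
    Set (TS V Finset.univ) :=
  {w | (∀ α ∈ T.verts, tbRank w α = tbRank v α) ∧ ∀ k, IsCompl (leafMinSubspace k w) (W k)}

/-- `A` defines the tree-based manifold structure on `FT_{≤ r}(V_D)`: the point `0` is isolated, and
for every `v ≠ 0` in `FT_{≤ r}(V_D)`, every choice of closed complements `W_k` of `U_k^min(v)` and
every choice of bases of the `U_k^min(v)`, with `s` the tree-based rank of `v`, the set `𝓤(v)` is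
open and `(L, C) ↦ treeParam b (L, C)` is an analytic submersion of `×_k 𝓛(U_k^min(v), W_k) × ℝ^s_*`
onto `𝓤(v)`. -/
def IsTreeAtlas (T : PartitionTree ι) (r : Finset ι → ℕ) (A : BanachAtlas (boundedRank V T r)) :
    Prop :=
  A.IsOpenSet {0} ∧
  ∀ v ∈ boundedRank V T r, v ≠ 0 → ∀ W : ∀ k, Submodule ℝ (V k),
    (∀ k, IsClosed (W k : Set (V k))) → (∀ k, IsCompl (leafMinSubspace k v) (W k)) →
    ∀ b : ∀ k, Module.Basis (Fin (tbRank v {k})) ℝ (leafMinSubspace k v),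
      A.IsOpenSet (chartDomain T v W) ∧
      treeParam (T := T) (s := tbRank v) (W := W) b '' {p | p.2.IsRegular} = chartDomain T v W ∧
      A.IsSubmersionOn (treeParam (T := T) (s := tbRank v) (W := W) b) {p | p.2.IsRegular}

end TreeTensor

namespace TreeTensor

/-! ### Combinatorics of partition trees -/

namespace PartitionTree

variable {ι : Type*} [Fintype ι] [DecidableEq ι] {T : PartitionTree ι}

/-! A tensor `w` of rank `s` is described by a basis (frame) of each minimal subspace: a father's
frame expands in products of its sons' frames, and the coefficients are the transfer tensors.
Regularity of `C` is exactly what makes the recursively built frames bases of the minimal subspaces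
(`IsFrame.linearIndependent`, `IsFrame.minSubspace_eq`); conversely, any frames of the minimal
subspaces have regular transfer tensors (`isFrame_dualCoeffs`, `isRegular_dualCoeffs`). Together
with `IsFrame.treeParam_eq`, which identifies the global sum with the frame at the root, this gives
the image of the parametrization (`treeParam_image`).

The parametrization is redundant: frames at non-leaf vertices other than the root can be changed by
invertible matrices. At the leaves the complements `W_k` already fix the frame. At the other
vertices the freedom is removed near a parameter `p₀` by choosing right inverses `R` of the
matricisations of its transfer tensors and admitting only `C` with the same right inverses, an
affine slice. From `R` and the leaf coordinates one builds linear forms `A` on the `V_α`, and the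
frames of every normalized parameter are dual to `A` (`IsDualForms.isDualOn`). A frame of a given
subspace dual to given forms is unique, so on the slice the parameters are determined by the tensor.

Recovering the parameters is moreover analytic in the norm of the completion. Minimal subspaces are
spanned by contractions of `w` with elementary bounded forms (`minSubspace_eq_span`), and domination
of the injective norms makes these contractions bounded (`DominatesInjective.contract_le`).
Contractions that give a frame at `w₀` remain a frame nearby after multiplication by an inverse
matrix analytic in `w` (`exists_analytic_frames`). Evaluating bounded forms on this frame yields the
coefficients, hence a map `G`, analytic on an open set of the completion, that inverts the
parametrization (`exists_localModel`). The parametrization itself is analytic because the tensor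
product maps are continuous (`analyticAt_treeParam`).

An analytic parametrization with an analytic retraction gives everything else: transition maps are
compositions of the two, the chain rule splits the derivative so that its range is complemented
(`exists_immersion_normal_form`), and the slice is a local section of the full parametrization,
which is therefore a submersion (`LocalModels.isSubmersionOn`). Each stratum of constant rank
carries the subspace topology, and distinct strata are declared open and disjoint; `0` is a stratum
by itself. -/

lemma mem_inner_of_two_le {α : Finset ι} (hα : α ∈ T.verts) (h : 2 ≤ α.card) : α ∈ T.inner := by
  refine Finset.mem_filter.2 ⟨hα, Finset.card_pos.1 ?_⟩
  have := T.two_le_card_sons α hα h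
  omega

lemma inner_or_leaf {α : Finset ι} (hα : α ∈ T.verts) : α ∈ T.inner ∨ ∃ k, α = {k} := by
  by_cases h : 2 ≤ α.card
  · exact Or.inl (mem_inner_of_two_le hα h)
  · have := (T.nonempty α hα).card_pos
    exact Or.inr (Finset.card_eq_one.1 (by omega))

lemma singleton_notMem_inner (k : ι) : ({k} : Finset ι) ∉ T.inner := fun h => by
  have := two_le_card_of_inner h
  simp at this

lemma son_mem_verts {α β : Finset ι} (h : α ∈ T.inner) (hβ : β ∈ T.sons α) : β ∈ T.verts :=
  T.sons_subset α (mem_verts_of_inner h) hβ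

lemma son_ssubset {α β : Finset ι} (h : α ∈ T.inner) (hβ : β ∈ T.sons α) : β ⊂ α := by
  refine (subset_of_son h hβ).ssubset_of_ne ?_
  rintro rfl
  obtain ⟨γ, hγ, hγne⟩ := Finset.exists_mem_ne
    (lt_of_lt_of_le one_lt_two (T.two_le_card_sons β (mem_verts_of_inner h)
      (two_le_card_of_inner h))) β
  obtain ⟨x, hx⟩ := T.nonempty γ (son_mem_verts h hγ)
  exact hγne (son_unique h hγ hβ hx (subset_of_son h hγ hx))

lemma son_ne_univ {α β : Finset ι} (h : α ∈ T.inner) (hβ : β ∈ T.sons α) : β ≠ Finset.univ := by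
  rintro rfl
  exact (son_ssubset h hβ).2 (Finset.subset_univ _)

lemma univ_mem_inner [Nontrivial ι] : Finset.univ ∈ T.inner :=
  mem_inner_of_two_le T.root_mem (by
    rw [Finset.card_univ]
    exact Fintype.one_lt_card)

/-- Induction from the leaves to the root. -/
lemma leaf_induction {P : Finset ι → Prop} (leaf : ∀ k, P {k})
    (step : ∀ μ ∈ T.inner, (∀ β ∈ T.sons μ, P β) → P μ) : ∀ α ∈ T.verts, P α := by
  intro α
  induction α using Finset.strongInduction with
  | H α ih =>
    intro hα
    rcases inner_or_leaf hα with h | ⟨k, rfl⟩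
    · exact step α h fun β hβ => ih β (son_ssubset h hβ) (son_mem_verts h hβ)
    · exact leaf k

lemma exists_father' {β : Finset ι} (hβ : β ∈ T.verts) (hne : β ≠ Finset.univ) :
    ∃ α ∈ T.inner, β ∈ T.sons α := by
  obtain ⟨α, hα, hβα⟩ := T.exists_father β hβ hne
  exact ⟨α, Finset.mem_filter.2 ⟨hα, ⟨β, hβα⟩⟩, hβα⟩

/-- Induction from the root to the leaves. -/
lemma root_induction {P : Finset ι → Prop} (root : P Finset.univ)
    (step : ∀ μ ∈ T.inner, P μ → ∀ β ∈ T.sons μ, P β) : ∀ α ∈ T.verts, P α := by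
  have key : ∀ n : ℕ, ∀ α ∈ T.verts, Fintype.card ι - α.card = n → P α := by
    intro n
    induction n using Nat.strong_induction_on with
    | _ n ih =>
      intro α hα hn
      by_cases hne : α = Finset.univ
      · exact hne ▸ root
      · obtain ⟨μ, hμ, hαμ⟩ := exists_father' hα hne
        refine step μ hμ (ih _ ?_ μ (mem_verts_of_inner hμ) rfl) α hαμ
        have h1 := Finset.card_lt_card (son_ssubset hμ hαμ)
        have h2 : μ.card ≤ Fintype.card ι := Finset.card_le_univ μ
        omega
  exact fun α hα => key _ α hα rfl

/-- Two vertices that meet are equal, or one of them lies in a son of the other one. -/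
lemma laminar {γ μ : Finset ι} (hγ : γ ∈ T.verts) (hμ : μ ∈ T.verts) (h : ∃ x, x ∈ γ ∧ x ∈ μ) :
    γ = μ ∨ (μ ∈ T.inner ∧ ∃ β ∈ T.sons μ, γ ⊆ β) ∨ (γ ∈ T.inner ∧ ∃ β ∈ T.sons γ, μ ⊆ β) := by
  revert μ
  -- Nested inductions from the root, first on `γ` and then on `μ`; the common point identifies the
  -- son through which the comparison descends.
  refine root_induction (T := T) (P := fun γ => ∀ {μ}, μ ∈ T.verts → (∃ x, x ∈ γ ∧ x ∈ μ) →
    γ = μ ∨ (μ ∈ T.inner ∧ ∃ β ∈ T.sons μ, γ ⊆ β) ∨ (γ ∈ T.inner ∧ ∃ β ∈ T.sons γ, μ ⊆ β))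
    ?_ ?_ γ hγ
  · intro μ hμ _
    refine root_induction (T := T) (P := fun μ => Finset.univ = μ ∨
      (μ ∈ T.inner ∧ ∃ β ∈ T.sons μ, Finset.univ ⊆ β) ∨
      (Finset.univ ∈ T.inner ∧ ∃ β ∈ T.sons Finset.univ, μ ⊆ β)) (Or.inl rfl) ?_ μ hμ
    rintro μ hμ (rfl | ⟨_, β, hβ, h⟩ | ⟨hu, β, hβ, h⟩) δ hδ
    · exact Or.inr (Or.inr ⟨hμ, δ, hδ, Finset.Subset.refl _⟩)
    · exact absurd (Finset.univ_subset_iff.1 h) (son_ne_univ hμ hβ)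
    · exact Or.inr (Or.inr ⟨hu, β, hβ, (subset_of_son hμ hδ).trans h⟩)
  · intro α hα ih γ hγ μ hμ
    refine root_induction (T := T) (P := fun μ => (∃ x, x ∈ γ ∧ x ∈ μ) →
      γ = μ ∨ (μ ∈ T.inner ∧ ∃ β ∈ T.sons μ, γ ⊆ β) ∨ (γ ∈ T.inner ∧ ∃ β ∈ T.sons γ, μ ⊆ β))
      ?_ ?_ μ hμ
    · rintro ⟨x, hx, -⟩
      rcases ih T.root_mem ⟨x, subset_of_son hα hγ hx, Finset.mem_univ x⟩ with
        rfl | ⟨hu, β, hβ, h⟩ | ⟨_, β, hβ, h⟩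
      · exact Or.inr (Or.inl ⟨hα, γ, hγ, Finset.Subset.refl _⟩)
      · exact Or.inr (Or.inl ⟨hu, β, hβ, (subset_of_son hα hγ).trans h⟩)
      · exact absurd (Finset.univ_subset_iff.1 h) (son_ne_univ hα hβ)
    · rintro ν hν ihν δ hδ ⟨x, hxγ, hxδ⟩
      have hδv := son_mem_verts hν hδ
      rcases ih hδv ⟨x, subset_of_son hα hγ hxγ, hxδ⟩ with
        rfl | ⟨hu, β, hβ, h⟩ | ⟨_, β, hβ, h⟩
      · exact Or.inr (Or.inl ⟨hα, γ, hγ, Finset.Subset.refl _⟩)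
      · exact Or.inr (Or.inl ⟨hu, β, hβ, (subset_of_son hα hγ).trans h⟩)
      · obtain rfl := son_unique hα hβ hγ (h hxδ) hxγ
        rcases ihν ⟨x, hxγ, subset_of_son hν hδ hxδ⟩ with rfl | ⟨hu, ε, hε, h'⟩ | ⟨hu, ε, hε, h'⟩
        · exact Or.inr (Or.inr ⟨hν, δ, hδ, Finset.Subset.refl _⟩)
        · obtain rfl := son_unique hν hε hδ (h' hxγ) hxδ
          exact Or.inl (h'.antisymm h)
        · exact Or.inr (Or.inr ⟨hu, ε, hε, (subset_of_son hν hδ).trans h'⟩)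

lemma subset_son_of_ssubset {γ μ : Finset ι} (hγ : γ ∈ T.verts) (hμ : μ ∈ T.verts) (h : γ ⊂ μ) :
    μ ∈ T.inner ∧ ∃ β ∈ T.sons μ, γ ⊆ β := by
  obtain ⟨x, hx⟩ := T.nonempty γ hγ
  rcases laminar hγ hμ ⟨x, hx, h.1 hx⟩ with rfl | h' | ⟨hu, β, hβ, h'⟩
  · exact absurd rfl h.ne
  · exact h'
  · exact absurd ((h.1.trans h').antisymm (subset_of_son hu hβ)) (son_ssubset hu hβ).ne'

/-- Definition of a family on the vertices by recursion from the leaves to the root. -/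
lemma exists_rec (T : PartitionTree ι) {X : Finset ι → Type*} [∀ α, Inhabited (X α)]
    (leaf : ∀ k, X {k})
    (step : ∀ μ ∈ T.inner, (∀ α, X α) → X μ)
    (hstep : ∀ μ (hμ : μ ∈ T.inner) (x y : ∀ α, X α), (∀ β ∈ T.sons μ, x β = y β) →
      step μ hμ x = step μ hμ y) :
    ∃ x : ∀ α, X α, (∀ k, x {k} = leaf k) ∧ ∀ μ (hμ : μ ∈ T.inner), x μ = step μ hμ x := by
  classical
  -- Outside the strict subsets of `α` the step is fed default values. Sons are strict subsets, so
  -- `hstep` makes the choice harmless.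
  let F : ∀ α : Finset ι, (∀ β, β ⊂ α → X β) → X α := fun α y =>
    if hα : α ∈ T.inner then step α hα fun β => if h : β ⊂ α then y β h else default
    else if h : ∃ k, α = {k} then h.choose_spec ▸ leaf h.choose else default
  let x : ∀ α, X α := Finset.isWellFounded_ssubset.wf.fix F
  have hx : ∀ α, x α = F α fun β _ => x β := fun α =>
    Finset.isWellFounded_ssubset.wf.fix_eq F α
  refine ⟨x, fun k => ?_, fun μ hμ => ?_⟩
  · rw [hx]
    have h : ∃ k', ({k} : Finset ι) = {k'} := ⟨k, rfl⟩
    simp only [F, dif_neg (singleton_notMem_inner (T := T) k), dif_pos h]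
    have : ∀ k' (hk : ({k} : Finset ι) = {k'}), (hk ▸ leaf k' : X {k}) = leaf k := by
      intro k' hk
      obtain rfl := Finset.singleton_injective hk
      rfl
    exact this _ h.choose_spec
  · rw [hx]
    simp only [F, dif_pos hμ]
    exact hstep μ hμ _ _ fun β hβ => dif_pos (son_ssubset hμ hβ)

lemma prod_sons {M : Type*} [CommMonoid M] {μ : Finset ι} (hμ : μ ∈ T.inner) (F : μ → M) :
    ∏ β : T.sons μ, ∏ j : (β : Finset ι), F ⟨j, subset_of_son hμ β.2 j.2⟩ = ∏ j : μ, F j := by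
  rw [← Fintype.prod_sigma' (fun (β : T.sons μ) (j : (β : Finset ι)) =>
    F ⟨j, subset_of_son hμ β.2 j.2⟩)]
  refine Fintype.prod_bijective (fun p : Σ β : T.sons μ, (β : Finset ι) =>
    (⟨p.2, subset_of_son hμ p.1.2 p.2.2⟩ : μ)) ⟨?_, ?_⟩ _ _ fun _ => rfl
  · rintro ⟨⟨β, hβ⟩, ⟨j, hj⟩⟩ ⟨⟨β', hβ'⟩, ⟨j', hj'⟩⟩ h
    obtain rfl : j = j' := congrArg Subtype.val h
    obtain rfl := son_unique hμ hβ hβ' hj hj'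
    rfl
  · rintro ⟨j, hj⟩
    obtain ⟨β, hβ, hjβ⟩ := exists_son hμ hj
    exact ⟨⟨⟨β, hβ⟩, ⟨j, hjβ⟩⟩, rfl⟩

/-- The vertices of the subtree below `α`. -/
def below (T : PartitionTree ι) (α : Finset ι) : Finset T.verts :=
  Finset.univ.filter fun γ => (γ : Finset ι) ⊆ α

lemma mem_below {α : Finset ι} {γ : T.verts} : γ ∈ T.below α ↔ (γ : Finset ι) ⊆ α := by
  simp [below]

lemma below_disjoint {μ β β' : Finset ι} (hμ : μ ∈ T.inner) (hβ : β ∈ T.sons μ)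
    (hβ' : β' ∈ T.sons μ) (hne : β ≠ β') : Disjoint (T.below β) (T.below β') := by
  refine Finset.disjoint_left.2 fun γ h h' => hne ?_
  obtain ⟨x, hx⟩ := T.nonempty γ γ.2
  exact son_unique hμ hβ hβ' (mem_below.1 h hx) (mem_below.1 h' hx)

lemma below_erase {μ : Finset ι} (hμ : μ ∈ T.inner) :
    (T.below μ).erase ⟨μ, mem_verts_of_inner hμ⟩ =
      Finset.univ.biUnion fun β : T.sons μ => T.below β := by
  ext γ
  simp only [Finset.mem_erase, mem_below, Finset.mem_biUnion, Finset.mem_univ, true_and]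
  constructor
  · rintro ⟨hne, hsub⟩
    obtain ⟨-, β, hβ, h⟩ := subset_son_of_ssubset γ.2 (mem_verts_of_inner hμ)
      (hsub.ssubset_of_ne fun h => hne (Subtype.ext h))
    exact ⟨⟨β, hβ⟩, h⟩
  · rintro ⟨β, h⟩
    refine ⟨?_, h.trans (subset_of_son hμ β.2)⟩
    rintro rfl
    exact (son_ssubset hμ β.2).2 h

end PartitionTree

/-! ### Partial sums over some of the indices -/

section PartialSum

variable {K : Type*} [Fintype K] [DecidableEq K] {κ : K → Type*} [∀ a, Fintype (κ a)]
  [∀ a, DecidableEq (κ a)]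

/-- The sum of `g` over the coordinates in `A`, the other coordinates being those of `i`. -/
def msum (A : Finset K) (g : (∀ a, κ a) → ℝ) (i : ∀ a, κ a) : ℝ :=
  ∑ j with ∀ a ∉ A, j a = i a, g j

lemma msum_univ (g : (∀ a, κ a) → ℝ) (i : ∀ a, κ a) : msum Finset.univ g i = ∑ j, g j := by
  simp [msum]

lemma msum_empty (g : (∀ a, κ a) → ℝ) (i : ∀ a, κ a) : msum ∅ g i = g i := by
  have : (Finset.univ.filter fun j : ∀ a, κ a => ∀ a ∉ (∅ : Finset K), j a = i a) = {i} := by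
    ext j
    simp [funext_iff]
  rw [msum, this, Finset.sum_singleton]

lemma msum_msum {A B : Finset K} (h : Disjoint A B) (g : (∀ a, κ a) → ℝ) (i : ∀ a, κ a) :
    msum A (msum B g) i = msum (A ∪ B) g i := by
  unfold msum
  rw [Finset.sum_sigma']
  refine Finset.sum_bij (fun p _ => p.2) ?_ ?_ ?_ ?_
  · rintro ⟨j, l⟩ hp
    simp only [Finset.mem_sigma, Finset.mem_filter, Finset.mem_univ, true_and, Finset.mem_union,
      not_or] at hp ⊢
    exact fun a ha => (hp.2 a ha.2).trans (hp.1 a ha.1)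
  · rintro ⟨j, l⟩ hp ⟨j', l'⟩ hp' heq
    simp only [Finset.mem_sigma, Finset.mem_filter, Finset.mem_univ, true_and] at hp hp' heq
    subst heq
    congr 1
    funext a
    by_cases ha : a ∈ A
    · have hb := Finset.disjoint_left.1 h ha
      rw [← hp.2 a hb, ← hp'.2 a hb]
    · rw [hp.1 a ha, hp'.1 a ha]
  · intro l hl
    simp only [Finset.mem_filter, Finset.mem_univ, true_and, Finset.mem_union, not_or] at hl
    refine ⟨⟨fun a => if a ∈ A then l a else i a, l⟩, ?_, rfl⟩
    simp only [Finset.mem_sigma, Finset.mem_filter, Finset.mem_univ, true_and]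
    refine ⟨fun a ha => by simp [ha], fun a ha => ?_⟩
    by_cases ha' : a ∈ A
    · simp [ha']
    · simp [ha', hl a ⟨ha', ha⟩]
  · intro p _
    rfl

/-- `g` does not depend on the coordinates in `A`. -/
def IndepOf (A : Finset K) (g : (∀ a, κ a) → ℝ) : Prop :=
  ∀ i j : ∀ a, κ a, (∀ a ∉ A, i a = j a) → g i = g j

lemma msum_mul_left {A : Finset K} {g : (∀ a, κ a) → ℝ} (hg : IndepOf A g)
    (h : (∀ a, κ a) → ℝ) (i : ∀ a, κ a) :
    msum A (fun j => g j * h j) i = g i * msum A h i := by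
  unfold msum
  rw [Finset.mul_sum]
  refine Finset.sum_congr rfl fun j hj => ?_
  simp only [hg j i (Finset.mem_filter.1 hj).2]

lemma IndepOf.msum {A B : Finset K} {g : (∀ a, κ a) → ℝ} (hg : IndepOf A g) :
    IndepOf A (msum B g) := by
  intro i j hij
  have key : ∀ i j : ∀ a, κ a, (∀ a ∉ A, i a = j a) → ∀ l : ∀ a, κ a, (∀ a ∉ B, l a = i a) →
      ∃ m : ∀ a, κ a, (m = fun a => if a ∈ B then l a else j a) ∧ (∀ a ∉ A, l a = m a) := by
    refine fun i j hij l hl => ⟨_, rfl, fun a ha => ?_⟩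
    by_cases hb : a ∈ B
    · simp [hb]
    · simp [hb, hl a hb, hij a ha]
  unfold TreeTensor.msum
  refine Finset.sum_bij' (fun l _ a => if a ∈ B then l a else j a)
    (fun l _ a => if a ∈ B then l a else i a) ?_ ?_ ?_ ?_ ?_
  · intro l hl
    simp only [Finset.mem_filter, Finset.mem_univ, true_and] at hl ⊢
    exact fun a ha => by simp [ha]
  · intro l hl
    simp only [Finset.mem_filter, Finset.mem_univ, true_and] at hl ⊢
    exact fun a ha => by simp [ha]
  · intro l hl
    simp only [Finset.mem_filter, Finset.mem_univ, true_and] at hl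
    funext a
    by_cases hb : a ∈ B <;> simp [hb, hl]
  · intro l hl
    simp only [Finset.mem_filter, Finset.mem_univ, true_and] at hl
    funext a
    by_cases hb : a ∈ B <;> simp [hb, hl]
  · intro l hl
    simp only [Finset.mem_filter, Finset.mem_univ, true_and] at hl
    obtain ⟨m, rfl, hm⟩ := key i j hij l hl
    exact hg _ _ hm

omit [∀ a, Fintype (κ a)] [∀ a, DecidableEq (κ a)] [Fintype K] [DecidableEq K] in
lemma indepOf_prod {L : Type*} {A : Finset K} (S : Finset L) {g : L → (∀ a, κ a) → ℝ}
    (hg : ∀ l ∈ S, IndepOf A (g l)) : IndepOf A (fun i => ∏ l ∈ S, g l i) :=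
  fun i j hij => Finset.prod_congr rfl fun l hl => hg l hl i j hij

omit [∀ a, Fintype (κ a)] [∀ a, DecidableEq (κ a)] [Fintype K] in
lemma indepOf_biUnion {L : Type*} [DecidableEq L] (S : Finset L) {A : L → Finset K}
    {g : (∀ a, κ a) → ℝ} (hg : ∀ l ∈ S, IndepOf (A l) g) : IndepOf (S.biUnion A) g := by
  induction S using Finset.induction_on with
  | empty => exact fun i j hij => congrArg _ (funext fun a => hij a (by simp))
  | insert m S hm ih =>
    intro i j hij
    have h2 := ih fun l hl => hg l (Finset.mem_insert_of_mem hl)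
    let q : ∀ a, κ a := fun a => if a ∈ A m then j a else i a
    rw [hg m (Finset.mem_insert_self _ _) i q fun a ha => by simp [q, ha]]
    refine h2 q j fun a ha => ?_
    by_cases ham : a ∈ A m
    · simp [q, ham]
    · simp only [q, ham, if_false]
      exact hij a (by simp only [Finset.biUnion_insert, Finset.mem_union]; tauto)

/-- Distributive law for sums over disjoint blocks of coordinates. By induction on `S`, the block of
`l` is summed first, the factors that do not depend on it being pulled out as constants. This is
what factors the sum over a subtree into sums over the subtrees of the sons. -/
lemma msum_prod {L : Type*} [DecidableEq L] (S : Finset L) (A : L → Finset K)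
    (g : L → (∀ a, κ a) → ℝ)
    (hA : ∀ l ∈ S, ∀ m ∈ S, l ≠ m → Disjoint (A l) (A m))
    (hg : ∀ l ∈ S, ∀ m ∈ S, l ≠ m → IndepOf (A l) (g m)) (i : ∀ a, κ a) :
    msum (S.biUnion A) (fun j => ∏ l ∈ S, g l j) i = ∏ l ∈ S, msum (A l) (g l) i := by
  induction S using Finset.induction_on generalizing i with
  | empty => simp [msum_empty]
  | insert l S hl ih =>
    have hne : ∀ m ∈ S, l ≠ m := fun m hm h => hl (h ▸ hm)
    have hdisj : Disjoint (S.biUnion A) (A l) := by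
      refine (Finset.disjoint_biUnion_left _ _ _).2 fun m hm => ?_
      exact hA m (Finset.mem_insert_of_mem hm) l (Finset.mem_insert_self _ _) (hne m hm).symm
    rw [Finset.biUnion_insert, Finset.union_comm, ← msum_msum hdisj, Finset.prod_insert hl]
    have h1 : msum (A l) (fun j => ∏ m ∈ insert l S, g m j) =
        fun j => msum (A l) (g l) j * ∏ m ∈ S, g m j := by
      funext j
      have h2 : IndepOf (A l) fun j => ∏ m ∈ S, g m j := indepOf_prod S fun m hm =>
        hg l (Finset.mem_insert_self _ _) m (Finset.mem_insert_of_mem hm) (hne m hm)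
      rw [mul_comm, ← msum_mul_left h2]
      congr 1
      funext j
      rw [Finset.prod_insert hl, mul_comm]
    rw [h1, msum_mul_left, ih]
    · exact fun m hm n hn => hA m (Finset.mem_insert_of_mem hm) n (Finset.mem_insert_of_mem hn)
    · exact fun m hm n hn => hg m (Finset.mem_insert_of_mem hm) n (Finset.mem_insert_of_mem hn)
    · exact (indepOf_biUnion S fun m hm =>
        hg m (Finset.mem_insert_of_mem hm) l (Finset.mem_insert_self _ _) (hne m hm).symm).msum

end PartialSum

end TreeTensor

namespace TreeTensor

/-! ### Minimal subspaces and contractions -/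

section Generic

variable {M N : Type*} [AddCommGroup M] [Module ℝ M] [AddCommGroup N] [Module ℝ N]

/-- By right exactness it suffices that `t` vanishes in `(M ⧸ U) ⊗ N`. In a basis of `M ⧸ U` its
coordinates are vectors of `N`, and every `ψ ∈ Ψ` kills them because the contraction of `t` by `ψ`
lies in `U`; a separating `Ψ` then forces them to be zero. -/
lemma mem_range_rTensor_span (t : M ⊗[ℝ] N) (Ψ : Set (N →ₗ[ℝ] ℝ))
    (hΨ : ∀ n, (∀ ψ ∈ Ψ, ψ n = 0) → n = 0) :
    t ∈ LinearMap.range (LinearMap.rTensor N (Submodule.span ℝ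
      ((fun ψ => TensorProduct.rid ℝ M (LinearMap.lTensor M ψ t)) '' Ψ)).subtype) := by
  set U := Submodule.span ℝ ((fun ψ => TensorProduct.rid ℝ M (LinearMap.lTensor M ψ t)) '' Ψ)
  have hex : Function.Exact (LinearMap.rTensor N U.subtype) (LinearMap.rTensor N U.mkQ) :=
    rTensor_exact N (LinearMap.exact_subtype_mkQ U) (Submodule.mkQ_surjective U)
  rw [LinearMap.mem_range]
  refine (hex t).1 ?_
  let B := Module.Basis.ofVectorSpace ℝ (M ⧸ U)
  classical
  have key : ∀ (ψ : N →ₗ[ℝ] ℝ) (z : (M ⧸ U) ⊗[ℝ] N) i,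
      ψ (TensorProduct.equivFinsuppOfBasisLeft B z i) =
        B.coord i (TensorProduct.rid ℝ _ (LinearMap.lTensor (M ⧸ U) ψ z)) := by
    intro ψ z i
    induction z with
    | zero => simp
    | add x y hx hy => simp only [map_add, Finsupp.add_apply, hx, hy]
    | tmul x y => simp [mul_comm]
  have key2 : ∀ (ψ : N →ₗ[ℝ] ℝ) (z : M ⊗[ℝ] N),
      TensorProduct.rid ℝ _ (LinearMap.lTensor (M ⧸ U) ψ (LinearMap.rTensor N U.mkQ z)) =
        U.mkQ (TensorProduct.rid ℝ _ (LinearMap.lTensor M ψ z)) := by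
    intro ψ z
    induction z with
    | zero => simp
    | add x y hx hy => simp only [map_add, hx, hy]
    | tmul x y => simp
  refine (TensorProduct.equivFinsuppOfBasisLeft B).injective ?_
  rw [map_zero]
  ext i
  refine hΨ _ fun ψ hψ => ?_
  rw [key, key2, Submodule.mkQ_apply, (Submodule.Quotient.mk_eq_zero U).2, map_zero]
  exact Submodule.subset_span ⟨ψ, hψ, rfl⟩

lemma rid_lTensor_mem {t : M ⊗[ℝ] N} {U : Submodule ℝ M}
    (h : t ∈ LinearMap.range (LinearMap.rTensor N U.subtype)) (ψ : N →ₗ[ℝ] ℝ) :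
    TensorProduct.rid ℝ M (LinearMap.lTensor M ψ t) ∈ U := by
  obtain ⟨z, rfl⟩ := h
  induction z with
  | zero => simp
  | add x y hx hy => simpa only [map_add] using U.add_mem hx hy
  | tmul x y => simpa using U.smul_mem _ x.2

/-- Any separating set of forms computes the smallest subspace. The freedom in `Ψ` allows elementary
tensors of bounded forms to be used instead of all linear forms. -/
lemma sInf_range_rTensor (t : M ⊗[ℝ] N) (Ψ : Set (N →ₗ[ℝ] ℝ))
    (hΨ : ∀ n, (∀ ψ ∈ Ψ, ψ n = 0) → n = 0) :
    sInf {U : Submodule ℝ M | t ∈ LinearMap.range (LinearMap.rTensor N U.subtype)} =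
      Submodule.span ℝ ((fun ψ => TensorProduct.rid ℝ M (LinearMap.lTensor M ψ t)) '' Ψ) := by
  refine le_antisymm (sInf_le (mem_range_rTensor_span t Ψ hΨ)) (le_sInf fun U hU => ?_)
  rw [Submodule.span_le]
  rintro _ ⟨ψ, -, rfl⟩
  exact rid_lTensor_mem hU ψ

lemma exists_finite_range_rTensor (t : M ⊗[ℝ] N) : ∃ U : Submodule ℝ M, Module.Finite ℝ U ∧
    t ∈ LinearMap.range (LinearMap.rTensor N U.subtype) := by
  obtain ⟨U, hU, h⟩ := TensorProduct.exists_finite_submodule_left_of_setFinite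
    ({t} : Set (M ⊗[ℝ] N)) (Set.finite_singleton t)
  exact ⟨U, hU, h rfl⟩

end Generic

variable {ι : Type*} [Fintype ι] [DecidableEq ι]
  {V : ι → Type*} [∀ j, NormedAddCommGroup (V j)] [∀ j, NormedSpace ℝ (V j)]

/-- The linear form `⨂_{k ∈ α} φ_k` on `V_α`. -/
def dualEval (α : Finset ι) (φ : ∀ k, V k →L[ℝ] ℝ) : TS V α →ₗ[ℝ] ℝ :=
  PiTensorProduct.dualDistrib
    (PiTensorProduct.tprod ℝ fun k : α => ((φ k : V k →ₗ[ℝ] ℝ) : Module.Dual ℝ (V k)))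

omit [DecidableEq ι] in
lemma dualEval_tprod (α : Finset ι) (φ : ∀ k, V k →L[ℝ] ℝ) (f : ∀ k : α, V k) :
    dualEval α φ (PiTensorProduct.tprod ℝ f) = ∏ k : α, φ k (f k) := by
  simp [dualEval]

omit [Fintype ι] [DecidableEq ι] in
-- Reduction to finite-dimensional factors, where coordinate forms are continuous and extend by
-- Hahn–Banach.
lemma exists_finite_subtensor (α : Finset ι) (z : TS V α) :
    ∃ U : ∀ k : α, Submodule ℝ (V k), (∀ k, FiniteDimensional ℝ (U k)) ∧
      ∃ z' : ⨂[ℝ] k : α, U k, PiTensorProduct.map (fun k => (U k).subtype) z' = z := by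
  induction z using PiTensorProduct.induction_on with
  | smul_tprod r f =>
    refine ⟨fun k => Submodule.span ℝ {f k}, fun k => inferInstance,
      r • PiTensorProduct.tprod ℝ fun k => ⟨f k, Submodule.mem_span_singleton_self _⟩, ?_⟩
    simp [PiTensorProduct.map_tprod]
  | add x y hx hy =>
    obtain ⟨U, hU, x', rfl⟩ := hx
    obtain ⟨U', hU', y', rfl⟩ := hy
    refine ⟨fun k => U k ⊔ U' k, fun k => inferInstance,
      PiTensorProduct.map (fun k => Submodule.inclusion le_sup_left) x' +
      PiTensorProduct.map (fun k => Submodule.inclusion le_sup_right) y', ?_⟩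
    rw [map_add, ← LinearMap.comp_apply, ← PiTensorProduct.map_comp,
      ← LinearMap.comp_apply, ← PiTensorProduct.map_comp]
    rfl

/-- Elementary tensors of continuous linear forms separate the points of `V_α`. -/
lemma eq_zero_of_dualEval {α : Finset ι} {z : TS V α}
    (h : ∀ φ : ∀ k, V k →L[ℝ] ℝ, dualEval α φ z = 0) : z = 0 := by
  obtain ⟨U, hU, z', rfl⟩ := exists_finite_subtensor α z
  suffices z' = 0 by rw [this, map_zero]
  classical
  let b := fun k => Module.finBasis ℝ (U k)
  refine (Basis.piTensorProduct b).ext_elem fun p => ?_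
  have hext : ∀ k : α, ∃ g : V k →L[ℝ] ℝ, ∀ x : U k, g x = (b k).coord (p k) x := fun k => by
    obtain ⟨g, hg, -⟩ := exists_extension_norm_eq (U k)
      (LinearMap.toContinuousLinearMap ((b k).coord (p k)))
    exact ⟨g, hg⟩
  choose g hg using hext
  let φ : ∀ k, V k →L[ℝ] ℝ := fun k => if hk : k ∈ α then g ⟨k, hk⟩ else 0
  have key : ∀ x : ⨂[ℝ] k : α, U k, (Basis.piTensorProduct b).repr x p =
      dualEval α φ (PiTensorProduct.map (fun k => (U k).subtype) x) := by
    intro x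
    induction x using PiTensorProduct.induction_on with
    | smul_tprod r f =>
      rw [map_smul, map_smul, map_smul, PiTensorProduct.map_tprod, dualEval_tprod,
        Finsupp.smul_apply, Basis.piTensorProduct_repr_tprod_apply]
      congr 1
      refine Finset.prod_congr rfl fun k _ => ?_
      have : φ k = g k := dif_pos k.2
      rw [this, Submodule.subtype_apply, hg]
      rfl
    | add x y hx hy => rw [map_add, map_add, map_add, Finsupp.add_apply, hx, hy]
  rw [key, h, map_zero, Finsupp.zero_apply]

/-- The contraction `V_D → V_α` with the linear form `⨂_{k ∉ α} φ_k`. -/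
def contract (α : Finset ι) (φ : ∀ k, V k →L[ℝ] ℝ) : TS V Finset.univ →ₗ[ℝ] TS V α :=
  (TensorProduct.rid ℝ (TS V α)).toLinearMap ∘ₗ
    LinearMap.lTensor (TS V α) (dualEval αᶜ φ) ∘ₗ (split V α).toLinearMap

lemma contract_apply (α : Finset ι) (φ : ∀ k, V k →L[ℝ] ℝ) (w : TS V Finset.univ) :
    contract α φ w =
      TensorProduct.rid ℝ _ (LinearMap.lTensor (TS V α) (dualEval αᶜ φ) (split V α w)) := rfl

lemma contract_tprod (α : Finset ι) (φ : ∀ k, V k →L[ℝ] ℝ)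
    (f : ∀ j : (Finset.univ : Finset ι), V j) :
    contract α φ (PiTensorProduct.tprod ℝ f) =
      (∏ k : (αᶜ : Finset ι), φ k (f ⟨k, Finset.mem_univ _⟩)) •
        PiTensorProduct.tprod ℝ (fun j : α => f ⟨j, Finset.mem_univ _⟩) := by
  rw [contract_apply, split_tprod, LinearMap.lTensor_tmul, TensorProduct.rid_tmul, dualEval_tprod]

/-- All analytic control of minimal subspaces rests on this description: the spanning vectors are
linear functions of `w` which will be shown to be bounded. -/
lemma minSubspace_eq_span (α : Finset ι) (w : TS V Finset.univ) :
    minSubspace α w = Submodule.span ℝ (Set.range fun φ => contract α φ w) := by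
  unfold minSubspace
  rw [sInf_range_rTensor (split V α w) (Set.range fun φ => dualEval αᶜ φ)
    fun n hn => eq_zero_of_dualEval fun φ => hn _ ⟨φ, rfl⟩, ← Set.range_comp]
  rfl

lemma contract_mem_minSubspace (α : Finset ι) (φ : ∀ k, V k →L[ℝ] ℝ) (w : TS V Finset.univ) :
    contract α φ w ∈ minSubspace α w := by
  rw [minSubspace_eq_span]
  exact Submodule.subset_span ⟨φ, rfl⟩

lemma split_mem_range (α : Finset ι) (w : TS V Finset.univ) :
    split V α w ∈ LinearMap.range (LinearMap.rTensor (TS V αᶜ) (minSubspace α w).subtype) := by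
  have h := mem_range_rTensor_span (split V α w) (Set.range fun φ => dualEval αᶜ φ)
    fun n hn => eq_zero_of_dualEval fun φ => hn _ ⟨φ, rfl⟩
  rwa [← sInf_range_rTensor (split V α w) (Set.range fun φ => dualEval αᶜ φ)
    fun n hn => eq_zero_of_dualEval fun φ => hn _ ⟨φ, rfl⟩] at h

instance (α : Finset ι) (w : TS V Finset.univ) : FiniteDimensional ℝ (minSubspace α w) := by
  obtain ⟨U, hU, h⟩ := exists_finite_range_rTensor (split V α w)
  exact Submodule.finiteDimensional_of_le (sInf_le (a := U) h)

instance (k : ι) (w : TS V Finset.univ) : FiniteDimensional ℝ (leafMinSubspace k w) := by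
  unfold leafMinSubspace
  infer_instance

lemma eq_zero_of_minSubspace_eq_bot {α : Finset ι} {w : TS V Finset.univ}
    (h : minSubspace α w = ⊥) : w = 0 := by
  obtain ⟨z, hz⟩ := split_mem_range α w
  have : LinearMap.rTensor (TS V αᶜ) (minSubspace α w).subtype = 0 := by
    have h0 : (minSubspace α w).subtype = 0 := by
      refine LinearMap.ext fun x => ?_
      exact (Submodule.mem_bot ℝ).1 (h.le x.2)
    rw [h0, LinearMap.rTensor_zero]
  rw [this, LinearMap.zero_apply] at hz
  exact (split V α).injective (by rw [← hz, map_zero])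

lemma minSubspace_zero (α : Finset ι) : minSubspace α (0 : TS V Finset.univ) = ⊥ := by
  rw [minSubspace_eq_span, Submodule.span_eq_bot]
  rintro _ ⟨φ, rfl⟩
  exact map_zero _

lemma tbRank_zero (α : Finset ι) : tbRank (0 : TS V Finset.univ) α = 0 := by
  rw [tbRank, minSubspace_zero, finrank_bot]

lemma tbRank_pos {w : TS V Finset.univ} (hw : w ≠ 0) (α : Finset ι) : 0 < tbRank w α := by
  refine Nat.pos_of_ne_zero fun h => hw (eq_zero_of_minSubspace_eq_bot (α := α) ?_)
  exact Submodule.finrank_eq_zero.1 h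

lemma contract_univ (φ : ∀ k, V k →L[ℝ] ℝ) (w : TS V Finset.univ) :
    contract Finset.univ φ w = w := by
  have : contract Finset.univ φ = LinearMap.id := by
    refine PiTensorProduct.ext (MultilinearMap.ext fun f => ?_)
    rw [LinearMap.compMultilinearMap_apply, contract_tprod, LinearMap.compMultilinearMap_apply]
    have : IsEmpty ((Finset.univ : Finset ι)ᶜ : Finset ι) :=
      ⟨fun k => Finset.mem_compl.1 k.2 (Finset.mem_univ _)⟩
    rw [Fintype.prod_empty, one_smul]
    rfl
  rw [this, LinearMap.id_apply]

lemma minSubspace_univ (w : TS V Finset.univ) : minSubspace Finset.univ w = Submodule.span ℝ {w} := by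
  rw [minSubspace_eq_span]
  simp only [contract_univ, Set.range_const]

lemma tbRank_univ {w : TS V Finset.univ} (hw : w ≠ 0) : tbRank w Finset.univ = 1 := by
  rw [tbRank, minSubspace_univ, finrank_span_singleton hw]

omit [DecidableEq ι] in
lemma dualEval_singleton (k : ι) (φ : ∀ k, V k →L[ℝ] ℝ) (z : TS V {k}) :
    dualEval {k} φ z = φ k (leafEquiv k z) := by
  induction z using PiTensorProduct.induction_on with
  | smul_tprod r f =>
    rw [map_smul, map_smul, map_smul, dualEval_tprod]
    congr 1
    rw [leafEquiv, PiTensorProduct.subsingletonEquiv_apply_tprod]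
    exact Fintype.prod_subsingleton (fun j : ({k} : Finset ι) => φ j (f j))
      ⟨k, Finset.mem_singleton_self k⟩
  | add x y hx hy => rw [map_add, map_add, map_add, hx, hy]

/-! ### Linear forms on the tensor product over the sons -/

section Sons

variable {T : PartitionTree ι} {μ : Finset ι} (hμ : μ ∈ T.inner)

/-- The linear form `⨂_{β ∈ S(μ)} θ_β` on `V_μ = ⨂_{β ∈ S(μ)} V_β`. -/
def sonsEval (θ : ∀ β : T.sons μ, Module.Dual ℝ (TS V β)) : TS V μ →ₗ[ℝ] ℝ :=
  PiTensorProduct.dualDistrib (PiTensorProduct.tprod ℝ θ) ∘ₗ (sonsEquiv hμ).toLinearMap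

lemma sonsEval_apply (θ : ∀ β : T.sons μ, Module.Dual ℝ (TS V β)) (z : TS V μ) :
    sonsEval hμ θ z = PiTensorProduct.dualDistrib (PiTensorProduct.tprod ℝ θ) (sonsEquiv hμ z) :=
  rfl

lemma sonsEquiv_tprod (f : ∀ j : μ, V j) :
    sonsEquiv hμ (PiTensorProduct.tprod ℝ f) = PiTensorProduct.tprod ℝ
      (fun β : T.sons μ => PiTensorProduct.tprod ℝ (restrictSon hμ f β)) :=
  sonsMap_tprod hμ f

lemma sonsEval_tprod (θ : ∀ β : T.sons μ, Module.Dual ℝ (TS V β)) (f : ∀ j : μ, V j) :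
    sonsEval hμ θ (PiTensorProduct.tprod ℝ f) =
      ∏ β, θ β (PiTensorProduct.tprod ℝ (restrictSon hμ f β)) := by
  rw [sonsEval_apply, sonsEquiv_tprod, PiTensorProduct.dualDistrib_apply]

lemma sonsEval_symm_tprod (θ : ∀ β : T.sons μ, Module.Dual ℝ (TS V β))
    (x : ∀ β : T.sons μ, TS V β) :
    sonsEval hμ θ ((sonsEquiv hμ).symm (PiTensorProduct.tprod ℝ x)) = ∏ β, θ β (x β) := by
  rw [sonsEval_apply, LinearEquiv.apply_symm_apply, PiTensorProduct.dualDistrib_apply]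

/-- `sonsEval` as a multilinear map. -/
def sonsEvalMulti (z : TS V μ) :
    MultilinearMap ℝ (fun β : T.sons μ => Module.Dual ℝ (TS V β)) ℝ :=
  ((LinearMap.applyₗ (sonsEquiv hμ z)).comp PiTensorProduct.dualDistrib).compMultilinearMap
    (PiTensorProduct.tprod ℝ)

lemma sonsEvalMulti_apply (z : TS V μ) (θ : ∀ β : T.sons μ, Module.Dual ℝ (TS V β)) :
    sonsEvalMulti hμ z θ = sonsEval hμ θ z := rfl

lemma dualEval_eq_sonsEval (φ : ∀ k, V k →L[ℝ] ℝ) :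
    dualEval μ φ = sonsEval hμ (fun β => dualEval β φ) := by
  refine PiTensorProduct.ext (MultilinearMap.ext fun f => ?_)
  simp only [LinearMap.compMultilinearMap_apply, dualEval_tprod, sonsEval_tprod]
  exact (PartitionTree.prod_sons hμ fun j => φ j (f j)).symm

lemma eq_zero_of_sonsEval {z : TS V μ}
    (h : ∀ θ : ∀ β : T.sons μ, Module.Dual ℝ (TS V β), sonsEval hμ θ z = 0) : z = 0 :=
  eq_zero_of_dualEval fun φ => by rw [dualEval_eq_sonsEval hμ, h]

end Sons

end TreeTensor

namespace TreeTensor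

variable {ι : Type*} [Fintype ι] [DecidableEq ι]
  {V : ι → Type*} [∀ j, NormedAddCommGroup (V j)] [∀ j, NormedSpace ℝ (V j)]

/-! ### Minimal subspaces of a vertex and of its sons -/

section Hierarchy

variable {T : PartitionTree ι} {μ : Finset ι} (hμ : μ ∈ T.inner)

include hμ in
lemma prod_compl_son (β : T.sons μ) (F : ι → ℝ) :
    ∏ k ∈ (β : Finset ι)ᶜ, F k =
      (∏ k ∈ μᶜ, F k) * ∏ γ ∈ Finset.univ.erase β, ∏ k ∈ (γ : Finset ι), F k := by
  rw [← Finset.prod_biUnion, ← Finset.prod_union]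
  · refine Finset.prod_congr ?_ fun _ _ => rfl
    ext k
    simp only [Finset.mem_compl, Finset.mem_union, Finset.mem_biUnion, Finset.mem_erase,
      Finset.mem_univ, and_true]
    constructor
    · intro hk
      by_cases hkμ : k ∈ μ
      · obtain ⟨γ, hγ, hkγ⟩ := T.exists_son hμ hkμ
        exact Or.inr ⟨⟨γ, hγ⟩, fun h => hk (h ▸ hkγ), hkγ⟩
      · exact Or.inl hkμ
    · rintro (hk | ⟨γ, hne, hk⟩) hkβ
      · exact hk (T.subset_of_son hμ β.2 hkβ)
      · exact hne (Subtype.ext (T.son_unique hμ γ.2 β.2 hk hkβ))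
  · refine Finset.disjoint_left.2 fun k hk hk' => ?_
    obtain ⟨γ, -, hkγ⟩ := Finset.mem_biUnion.1 hk'
    exact Finset.mem_compl.1 hk (T.subset_of_son hμ γ.2 hkγ)
  · intro γ _ δ _ hne
    exact T.disjoint_sons μ (T.mem_verts_of_inner hμ) (T.two_le_card_of_inner hμ) γ γ.2 δ δ.2
      fun h => hne (Subtype.ext h)

/-- Contracting down to a son is contracting to the father and then evaluating the other sons at
`ψ`. It relates minimal subspaces of father and son and carries norm bounds from the root downwards.
-/
lemma apply_contract_son (β : T.sons μ) (ψ : ∀ k, V k →L[ℝ] ℝ) (τ : Module.Dual ℝ (TS V β))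
    (w : TS V Finset.univ) :
    τ (contract β ψ w) =
      sonsEval hμ (Function.update (fun γ : T.sons μ => dualEval (γ : Finset ι) ψ) β τ)
        (contract μ ψ w) := by
  suffices τ ∘ₗ contract β ψ =
      sonsEval hμ (Function.update (fun γ : T.sons μ => dualEval (γ : Finset ι) ψ) β τ) ∘ₗ
        contract μ ψ from LinearMap.congr_fun this w
  refine PiTensorProduct.ext (MultilinearMap.ext fun f => ?_)
  simp only [LinearMap.compMultilinearMap_apply, LinearMap.comp_apply, contract_tprod, map_smul,
    sonsEval_tprod, smul_eq_mul]
  let F : ι → ℝ := fun k => ψ k (f ⟨k, Finset.mem_univ _⟩)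
  have h1 : ∀ α : Finset ι, ∏ k : α, ψ k (f ⟨k, Finset.mem_univ _⟩) = ∏ k ∈ α, F k := fun α =>
    Finset.prod_coe_sort α F
  rw [h1, h1, prod_compl_son hμ β F, ← Finset.mul_prod_erase Finset.univ _ (Finset.mem_univ β),
    Function.update_self, mul_assoc, mul_comm (∏ γ ∈ Finset.univ.erase β, _)]
  congr 2
  refine Finset.prod_congr rfl fun γ hγ => ?_
  rw [Function.update_of_ne (Finset.ne_of_mem_erase hγ), dualEval_tprod]
  exact (h1 γ).symm

lemma split_symm_tprod (α : Finset ι) (h : ∀ j : α, V j) (g : ∀ j : (αᶜ : Finset ι), V j) :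
    (split V α).symm (PiTensorProduct.tprod ℝ h ⊗ₜ[ℝ] PiTensorProduct.tprod ℝ g) =
      PiTensorProduct.tprod ℝ (fun j : (Finset.univ : Finset ι) =>
        if hj : (j : ι) ∈ α then h ⟨j, hj⟩ else g ⟨j, Finset.mem_compl.2 hj⟩) := by
  rw [LinearEquiv.symm_apply_eq, split_tprod]
  congr 2
  · funext j
    simp
  · funext j
    simp [Finset.mem_compl.1 j.2]

/-- With the factor `y` outside `β` fixed, every slot except `β` contributes only a number, so the
form in `x` is a multiple of `τ`. -/
lemma exists_sonsEval_contract_split (β : T.sons μ)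
    (θ : ∀ γ : T.sons μ, Module.Dual ℝ (TS V γ)) (φ : ∀ k, V k →L[ℝ] ℝ)
    (τ : Module.Dual ℝ (TS V β)) (y : TS V (β : Finset ι)ᶜ) :
    ∃ c : ℝ, ∀ x : TS V β, sonsEval hμ (Function.update θ β τ)
      (contract μ φ ((split V β).symm (x ⊗ₜ[ℝ] y))) = c * τ x := by
  induction y using PiTensorProduct.induction_on with
  | add y y' hy hy' =>
    obtain ⟨c, hc⟩ := hy
    obtain ⟨c', hc'⟩ := hy'
    exact ⟨c + c', fun x => by rw [TensorProduct.tmul_add, map_add, map_add, map_add, hc, hc',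
      add_mul]⟩
  | smul_tprod r g =>
    -- The value `0` on `β` is never read: the constant below involves only indices outside `β`.
    let f : ∀ j : ι, V j := fun j =>
      if hj : j ∈ (β : Finset ι) then 0 else g ⟨j, Finset.mem_compl.2 hj⟩
    refine ⟨r * ((∏ k : (μᶜ : Finset ι), φ k (f k)) * ∏ γ ∈ Finset.univ.erase β,
      θ γ (PiTensorProduct.tprod ℝ fun j : (γ : Finset ι) => f j)), fun x => ?_⟩
    induction x using PiTensorProduct.induction_on with
    | add x x' hx hx' => rw [TensorProduct.add_tmul, map_add, map_add, map_add, map_add, hx, hx',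
        mul_add]
    | smul_tprod r' h =>
      rw [TensorProduct.smul_tmul_smul, map_smul, map_smul, map_smul, map_smul, split_symm_tprod,
        contract_tprod, map_smul, sonsEval_tprod,
        ← Finset.mul_prod_erase Finset.univ _ (Finset.mem_univ β), Function.update_self]
      have h1 : ∀ k, k ∉ (β : Finset ι) → (if hj : k ∈ (β : Finset ι) then h ⟨k, hj⟩
          else g ⟨k, Finset.mem_compl.2 hj⟩) = f k := fun k hk => by
        simp [f, hk]
      have h2 : ∏ k : (μᶜ : Finset ι), φ k (if hj : (k : ι) ∈ (β : Finset ι) then h ⟨k, hj⟩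
          else g ⟨k, Finset.mem_compl.2 hj⟩) = ∏ k : (μᶜ : Finset ι), φ k (f k) := by
        refine Finset.prod_congr rfl fun k _ => ?_
        rw [h1 k fun hk => Finset.mem_compl.1 k.2 (T.subset_of_son hμ β.2 hk)]
      have h3 : restrictSon hμ (fun j : μ => if hj : (j : ι) ∈ (β : Finset ι) then h ⟨j, hj⟩
          else g ⟨j, Finset.mem_compl.2 hj⟩) β = h := by
        funext j
        exact dif_pos j.2
      have h4 : ∀ γ ∈ Finset.univ.erase β, Function.update θ β τ γ (PiTensorProduct.tprod ℝ
          (restrictSon hμ (fun j : μ => if hj : (j : ι) ∈ (β : Finset ι) then h ⟨j, hj⟩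
          else g ⟨j, Finset.mem_compl.2 hj⟩) γ)) =
          θ γ (PiTensorProduct.tprod ℝ fun j : (γ : Finset ι) => f j) := by
        intro γ hγ
        have hne := Finset.ne_of_mem_erase hγ
        rw [Function.update_of_ne hne]
        congr 2
        funext j
        exact h1 j fun hj => hne (Subtype.ext (T.son_unique hμ γ.2 β.2 j.2 hj))
      rw [h3, Finset.prod_congr rfl h4]
      simp only [smul_eq_mul]
      rw [h2]
      ring

/-- Dual form of the inclusion of `U_μ^min(w)` in the tensor product of the `U_β^min(w)`: since `w`
lies in `U_β^min(w) ⊗ V_{D \ β}`, a form vanishing on `U_β^min(w)` in slot `β` kills all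
contractions of `w` to `μ`. -/
lemma sonsEval_update_eq_zero {w : TS V Finset.univ} (β : T.sons μ)
    (θ : ∀ γ : T.sons μ, Module.Dual ℝ (TS V γ)) {τ : Module.Dual ℝ (TS V β)}
    (hτ : ∀ x ∈ minSubspace (β : Finset ι) w, τ x = 0) {z : TS V μ} (hz : z ∈ minSubspace μ w) :
    sonsEval hμ (Function.update θ β τ) z = 0 := by
  rw [minSubspace_eq_span] at hz
  suffices Submodule.span ℝ (Set.range fun φ => contract μ φ w) ≤
    LinearMap.ker (sonsEval hμ (Function.update θ β τ)) from LinearMap.mem_ker.1 (this hz)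
  rw [Submodule.span_le]
  rintro _ ⟨φ, rfl⟩
  rw [SetLike.mem_coe, LinearMap.mem_ker]
  obtain ⟨t, ht⟩ := split_mem_range (β : Finset ι) w
  have key : ∀ t : minSubspace (β : Finset ι) w ⊗[ℝ] TS V (β : Finset ι)ᶜ,
      sonsEval hμ (Function.update θ β τ) (contract μ φ ((split V β).symm
        (LinearMap.rTensor _ (minSubspace (β : Finset ι) w).subtype t))) = 0 := by
    intro t
    induction t with
    | zero => simp only [map_zero]
    | add x y hx hy => simp only [map_add, hx, hy, add_zero]
    | tmul x y =>
      obtain ⟨c, hc⟩ := exists_sonsEval_contract_split hμ β θ φ τ y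
      rw [LinearMap.rTensor_tmul, hc, Submodule.subtype_apply, hτ x x.2, mul_zero]
  have := key t
  rwa [ht, LinearEquiv.symm_apply_apply] at this

/-- Linear forms that agree on `U_β^min(w)` can be exchanged on `U_μ^min(w)`. -/
lemma sonsEval_update_congr {w : TS V Finset.univ} (β : T.sons μ)
    (θ : ∀ γ : T.sons μ, Module.Dual ℝ (TS V γ)) {τ τ' : Module.Dual ℝ (TS V β)}
    (hτ : ∀ x ∈ minSubspace (β : Finset ι) w, τ x = τ' x) {z : TS V μ} (hz : z ∈ minSubspace μ w) :
    sonsEval hμ (Function.update θ β τ) z = sonsEval hμ (Function.update θ β τ') z := by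
  have h := sonsEval_update_eq_zero hμ β θ (τ := τ - τ')
    (fun x hx => by rw [LinearMap.sub_apply, hτ x hx, sub_self]) hz
  rw [← sonsEvalMulti_apply, MultilinearMap.map_update_sub, sub_eq_zero] at h
  exact h

lemma sonsEval_congr {w : TS V Finset.univ} {θ θ' : ∀ γ : T.sons μ, Module.Dual ℝ (TS V γ)}
    (h : ∀ γ : T.sons μ, ∀ x ∈ minSubspace (γ : Finset ι) w, θ γ x = θ' γ x) {z : TS V μ}
    (hz : z ∈ minSubspace μ w) : sonsEval hμ θ z = sonsEval hμ θ' z := by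
  -- The forms are exchanged one slot at a time; `S` is the set of slots already exchanged.
  have key : ∀ S : Finset (T.sons μ), sonsEval hμ (S.piecewise θ' θ) z = sonsEval hμ θ z := by
    intro S
    induction S using Finset.induction_on with
    | empty => rw [Finset.piecewise_empty]
    | insert β S hβ ih =>
      rw [Finset.piecewise_insert, ← ih]
      conv_rhs => rw [← Function.update_eq_self β (S.piecewise θ' θ)]
      refine sonsEval_update_congr hμ β _ (fun x hx => ?_) hz
      rw [Finset.piecewise_eq_of_notMem _ _ _ hβ, h β x hx]
  rw [← key Finset.univ, Finset.piecewise_univ]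

end Hierarchy

/-! ### Frames -/

section Frames

variable {T : PartitionTree ι} {s : Finset ι → ℕ}

/-- The vectors `x^μ_a = ∑_q C^μ_{a,q} ⨂_β x^β_{q_β}` form a family of frames with transfer
tensors `C`. -/
def IsFrame (C : Coeffs T s) (x : ∀ α : Finset ι, Fin (s α) → TS V α) : Prop :=
  ∀ μ (hμ : μ ∈ T.inner) a, x μ a = (sonsEquiv hμ).symm
    (∑ q, C ⟨μ, hμ⟩ a q • PiTensorProduct.tprod ℝ fun β : T.sons μ => x β (q β))

lemma exists_isFrame (C : Coeffs T s) (leaf : ∀ k, Fin (s {k}) → V k) :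
    ∃ x : ∀ α : Finset ι, Fin (s α) → TS V α, IsFrame C x ∧
      ∀ k a, x {k} a = (leafEquiv k).symm (leaf k a) := by
  obtain ⟨x, hx, hx'⟩ := PartitionTree.exists_rec T (X := fun α => Fin (s α) → TS V α)
    (fun k a => (leafEquiv k).symm (leaf k a))
    (fun μ hμ x a => (sonsEquiv hμ).symm
      (∑ q, C ⟨μ, hμ⟩ a q • PiTensorProduct.tprod ℝ fun β : T.sons μ => x β (q β)))
    (fun μ hμ x y hxy => by
      funext a
      have : ∀ β : T.sons μ, x β = y β := fun β => hxy β β.2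
      simp only [this])
  exact ⟨x, fun μ hμ a => congrFun (hx' μ hμ) a, fun k a => congrFun (hx k) a⟩

lemma IsFrame.sonsEval {C : Coeffs T s} {x : ∀ α : Finset ι, Fin (s α) → TS V α}
    (hx : IsFrame C x) {μ : Finset ι} (hμ : μ ∈ T.inner)
    (θ : ∀ β : T.sons μ, Module.Dual ℝ (TS V β)) (a : Fin (s μ)) :
    TreeTensor.sonsEval hμ θ (x μ a) = ∑ q, C ⟨μ, hμ⟩ a q * ∏ β, θ β (x β (q β)) := by
  rw [hx μ hμ a, sonsEval_apply, LinearEquiv.apply_symm_apply, map_sum]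
  refine Finset.sum_congr rfl fun q _ => ?_
  rw [map_smul, PiTensorProduct.dualDistrib_apply, smul_eq_mul]

/-- The factor of the vertex `γ` in the expansion of a tensor in tree-based format. -/
def vertexFactor (C : Coeffs T s) (c : ∀ γ : T.verts, Fin (s γ) → ℝ) (γ : T.verts)
    (i : ∀ α : T.verts, Fin (s α)) : ℝ :=
  if hγ : (γ : Finset ι) ∈ T.inner then
    C ⟨γ, hγ⟩ (i γ) (fun β => i ⟨β, T.sons_subset γ γ.2 β.2⟩)
  else c γ (i γ)

lemma vertexFactor_of_mem (C : Coeffs T s) (c : ∀ γ : T.verts, Fin (s γ) → ℝ) {γ : T.verts}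
    (hγ : (γ : Finset ι) ∈ T.inner) (i : ∀ α : T.verts, Fin (s α)) :
    vertexFactor C c γ i = C ⟨γ, hγ⟩ (i γ) (fun β => i ⟨β, T.sons_subset γ γ.2 β.2⟩) :=
  dif_pos hγ

lemma indepOf_vertexFactor (C : Coeffs T s) (c : ∀ γ : T.verts, Fin (s γ) → ℝ) {γ : T.verts}
    {A : Finset T.verts} (h1 : γ ∉ A) (h2 : ∀ β : T.verts, (β : Finset ι) ∈ T.sons γ → β ∉ A) :
    IndepOf A (vertexFactor C c γ) := by
  intro i j hij
  unfold vertexFactor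
  rw [hij γ h1]
  split_ifs with hγ
  · exact congrArg _ (funext fun β => hij _ (h2 _ β.2))
  · rfl

/-- Induction from the leaves. The indices strictly below `μ` are those of its sons together with
those strictly below each son. For fixed indices of the sons, the remaining sum factors over the
subtrees, each factor being known by induction; the sum over the indices of the sons is the frame
equation at `μ`. -/
lemma IsFrame.dualEval_eq_msum {C : Coeffs T s} {x : ∀ α : Finset ι, Fin (s α) → TS V α}
    (hx : IsFrame C x) (φ : ∀ k, V k →L[ℝ] ℝ) : ∀ α, ∀ hα : α ∈ T.verts,
    ∀ i : (∀ γ : T.verts, Fin (s γ)), dualEval α φ (x α (i ⟨α, hα⟩)) =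
      msum ((T.below α).erase ⟨α, hα⟩) (fun j => ∏ γ ∈ T.below α,
        vertexFactor C (fun γ a => dualEval γ φ (x γ a)) γ j) i := by
  intro α hα
  refine PartitionTree.leaf_induction (T := T) (P := fun α => ∀ hα : α ∈ T.verts,
    ∀ i : (∀ γ : T.verts, Fin (s γ)), dualEval α φ (x α (i ⟨α, hα⟩)) =
      msum ((T.below α).erase ⟨α, hα⟩) (fun j => ∏ γ ∈ T.below α,
        vertexFactor C (fun γ a => dualEval γ φ (x γ a)) γ j) i) ?_ ?_ α hα hα
  · intro k hk i
    have hb : T.below {k} = {⟨{k}, hk⟩} := by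
      ext γ
      rw [PartitionTree.mem_below, Finset.mem_singleton, Finset.subset_singleton_iff,
        Subtype.ext_iff]
      exact or_iff_right (T.nonempty γ γ.2).ne_empty
    rw [hb, Finset.erase_singleton, msum_empty, Finset.prod_singleton, vertexFactor,
      dif_neg (PartitionTree.singleton_notMem_inner k)]
  · intro μ hμ ih hα i
    let F := vertexFactor C (fun (γ : T.verts) a => dualEval (γ : Finset ι) φ (x γ a))
    let v : T.sons μ → T.verts := fun β => ⟨β, T.sons_subset μ hα β.2⟩
    have hvinj : Function.Injective v := fun β β' h =>
      Subtype.ext (congrArg (fun γ : T.verts => (γ : Finset ι)) h)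
    -- `A β` collects the vertices strictly below the son `β`, and `S` the sons themselves.
    let A : T.sons μ → Finset T.verts := fun β => (T.below β).erase (v β)
    let S : Finset T.verts := Finset.univ.image v
    have hbel : ∀ β β' : T.sons μ, β ≠ β' → Disjoint (T.below β) (T.below β') :=
      fun β β' hne => PartitionTree.below_disjoint hμ β.2 β'.2 fun h => hne (Subtype.ext h)
    have hvmem : ∀ β : T.sons μ, v β ∈ T.below β := fun β =>
      PartitionTree.mem_below.2 (Finset.Subset.refl _)
    have hSA : Disjoint S (Finset.univ.biUnion A) := by
      refine Finset.disjoint_left.2 fun γ hγ hγ' => ?_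
      obtain ⟨β, -, rfl⟩ := Finset.mem_image.1 hγ
      obtain ⟨β', -, h⟩ := Finset.mem_biUnion.1 hγ'
      obtain ⟨hne, h⟩ := Finset.mem_erase.1 h
      by_cases hb : β = β'
      · exact hne (by rw [hb])
      · exact Finset.disjoint_left.1 (hbel β β' hb) (hvmem β) h
    have hunion : (T.below μ).erase ⟨μ, hα⟩ = S ∪ Finset.univ.biUnion A := by
      rw [PartitionTree.below_erase hμ]
      ext γ
      simp only [Finset.mem_biUnion, Finset.mem_univ, true_and, Finset.mem_union, S,
        Finset.mem_image, A, Finset.mem_erase]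
      constructor
      · rintro ⟨β, h⟩
        by_cases hγ : γ = v β
        · exact Or.inl ⟨β, hγ.symm⟩
        · exact Or.inr ⟨β, hγ, h⟩
      · rintro (⟨β, rfl⟩ | ⟨β, -, h⟩)
        · exact ⟨β, hvmem β⟩
        · exact ⟨β, h⟩
    have hprod : ∀ j, ∏ γ ∈ T.below μ, F γ j =
        F ⟨μ, hα⟩ j * ∏ β : T.sons μ, ∏ γ ∈ T.below β, F γ j := by
      intro j
      rw [← Finset.mul_prod_erase (T.below μ) _
        (PartitionTree.mem_below.2 (Finset.Subset.refl μ) : (⟨μ, hα⟩ : T.verts) ∈ T.below μ),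
        PartitionTree.below_erase hμ, Finset.prod_biUnion]
      exact fun β _ β' _ hne => hbel β β' hne
    have hμA : ∀ β : T.sons μ, (⟨μ, hα⟩ : T.verts) ∉ T.below β := fun β h =>
      (PartitionTree.son_ssubset hμ β.2).2 (PartitionTree.mem_below.1 h)
    have hinner : msum (Finset.univ.biUnion A) (fun j => ∏ γ ∈ T.below μ, F γ j) =
        fun j => F ⟨μ, hα⟩ j * ∏ β : T.sons μ, dualEval (β : Finset ι) φ (x β (j (v β))) := by
      funext j
      have h0 : IndepOf (Finset.univ.biUnion A) (F ⟨μ, hα⟩) := by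
        refine indepOf_vertexFactor _ _ (fun h => ?_) fun β hβ h => ?_
        · obtain ⟨β', -, h⟩ := Finset.mem_biUnion.1 h
          exact hμA β' (Finset.mem_of_mem_erase h)
        · exact Finset.disjoint_left.1 hSA
            (Finset.mem_image.2 ⟨⟨β, hβ⟩, Finset.mem_univ _, rfl⟩) h
      simp only [hprod]
      rw [msum_mul_left h0, msum_prod Finset.univ A]
      · congr 1
        exact Finset.prod_congr rfl fun β _ => (ih β β.2 (v β).2 j).symm
      · exact fun β _ β' _ hne => (hbel β β' hne).mono (Finset.erase_subset _ _)
          (Finset.erase_subset _ _)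
      · intro β _ β' _ hne
        refine indepOf_prod _ fun γ hγ => indepOf_vertexFactor _ _ (fun h => ?_) fun δ hδ h => ?_
        · exact Finset.disjoint_left.1 (hbel β β' hne) (Finset.mem_of_mem_erase h) hγ
        · refine Finset.disjoint_left.1 (hbel β β' hne) (Finset.mem_of_mem_erase h) ?_
          have hγi : (γ : Finset ι) ∈ T.inner := Finset.mem_filter.2 ⟨γ.2, ⟨δ, hδ⟩⟩
          exact PartitionTree.mem_below.2
            ((T.subset_of_son hγi hδ).trans (PartitionTree.mem_below.1 hγ))
    change _ = msum _ (fun j => ∏ γ ∈ T.below μ, F γ j) i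
    rw [hunion, ← msum_msum hSA, hinner, dualEval_eq_sonsEval hμ, hx.sonsEval hμ]
    unfold msum
    have hμS : (⟨μ, hα⟩ : T.verts) ∉ S := fun h => by
      obtain ⟨β, -, h⟩ := Finset.mem_image.1 h
      exact hμA β (h ▸ hvmem β)
    have hFμ : ∀ j, F ⟨μ, hα⟩ j = C ⟨μ, hμ⟩ (j ⟨μ, hα⟩) fun β => j (v β) := fun j => dif_pos hμ
    symm
    -- A full index family that agrees with `i` off the sons amounts to a choice `q` of indices at
    -- the sons.
    refine Finset.sum_bij' (fun j _ β => j (v β))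
      (fun q _ γ => if h : (γ : Finset ι) ∈ T.sons μ then q ⟨γ, h⟩ else i γ) ?_ ?_ ?_ ?_ ?_
    · exact fun _ _ => Finset.mem_univ _
    · intro q _
      refine Finset.mem_filter.2 ⟨Finset.mem_univ _, fun γ hγ => dif_neg fun h => hγ ?_⟩
      exact Finset.mem_image.2 ⟨⟨γ, h⟩, Finset.mem_univ _, rfl⟩
    · intro j hj
      funext γ
      by_cases h : (γ : Finset ι) ∈ T.sons μ
      · exact dif_pos h
      · refine (dif_neg h).trans ((Finset.mem_filter.1 hj).2 γ fun hγ => h ?_).symm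
        obtain ⟨β, -, rfl⟩ := Finset.mem_image.1 hγ
        exact β.2
    · intro q _
      funext β
      exact dif_pos β.2
    · intro j hj
      rw [hFμ, (Finset.mem_filter.1 hj).2 _ hμS]

/-- Elementary bounded forms separate points, so both sides may be compared after evaluation.
Because `s_D = 1`, holding the root index fixed costs nothing, and the partial sum at the root is
the sum over all index families. -/
lemma IsFrame.treeParam_eq {U W : ∀ k, Submodule ℝ (V k)} (hs : ∀ α, 0 < s α)
    (hs1 : s Finset.univ = 1) (b : ∀ k, Module.Basis (Fin (s {k})) ℝ (U k))
    (p : (∀ k, U k →L[ℝ] W k) × Coeffs T s) {x : ∀ α : Finset ι, Fin (s α) → TS V α}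
    (hx : IsFrame p.2 x)
    (hleaf : ∀ k a, leafEquiv k (x {k} a) = (b k a : V k) + (p.1 k (b k a) : V k))
    (a : Fin (s Finset.univ)) : treeParam b p = x Finset.univ a := by
  refine sub_eq_zero.1 (eq_zero_of_dualEval fun φ => ?_)
  rw [map_sub, sub_eq_zero]
  let i : ∀ γ : T.verts, Fin (s γ) := fun γ => ⟨0, hs γ⟩
  have : Subsingleton (Fin (s Finset.univ)) := by rw [hs1]; infer_instance
  rw [Subsingleton.elim a (i ⟨Finset.univ, T.root_mem⟩), hx.dualEval_eq_msum φ _ T.root_mem i]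
  have hbelow : T.below Finset.univ = Finset.univ := by
    ext γ
    simp [PartitionTree.mem_below]
  have hfil : (Finset.univ.filter fun j : ∀ γ : T.verts, Fin (s γ) =>
      ∀ γ ∉ (Finset.univ : Finset T.verts).erase ⟨Finset.univ, T.root_mem⟩, j γ = i γ) =
      Finset.univ := by
    refine Finset.filter_true_of_mem fun j _ γ hγ => ?_
    obtain rfl : γ = ⟨Finset.univ, T.root_mem⟩ := by
      by_contra h
      exact hγ (Finset.mem_erase.2 ⟨h, Finset.mem_univ _⟩)
    exact Subsingleton.elim (α := Fin (s Finset.univ)) _ _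
  unfold msum treeParam
  rw [hbelow, hfil, map_sum]
  refine Finset.sum_congr rfl fun j _ => ?_
  rw [map_smul, dualEval_tprod, smul_eq_mul]
  -- Every vertex is either a non-leaf or a singleton, so the product of vertex factors splits into
  -- transfer entries and leaf values.
  let e : T.inner ⊕ (Finset.univ : Finset ι) → T.verts :=
    Sum.elim (fun μ => ⟨μ, T.mem_verts_of_inner μ.2⟩) (fun k => ⟨{(k : ι)}, T.singleton_mem k⟩)
  have he : Function.Bijective e := by
    constructor
    · rintro (μ | k) (ν | l) h
      · exact congrArg Sum.inl (Subtype.ext (congrArg (fun γ : T.verts => (γ : Finset ι)) h))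
      · have h' : (μ : Finset ι) = {(l : ι)} := congrArg (fun γ : T.verts => (γ : Finset ι)) h
        exact absurd (h' ▸ μ.2) (PartitionTree.singleton_notMem_inner _)
      · have h' : {(k : ι)} = (ν : Finset ι) := congrArg (fun γ : T.verts => (γ : Finset ι)) h
        exact absurd (h' ▸ ν.2) (PartitionTree.singleton_notMem_inner _)
      · exact congrArg Sum.inr (Subtype.ext (Finset.singleton_injective (congrArg (fun γ : T.verts => (γ : Finset ι)) h)))
    · intro γ
      rcases PartitionTree.inner_or_leaf γ.2 with h | ⟨k, h⟩
      · exact ⟨Sum.inl ⟨γ, h⟩, rfl⟩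
      · exact ⟨Sum.inr ⟨k, Finset.mem_univ _⟩, Subtype.ext h.symm⟩
  change _ = ∏ γ, vertexFactor p.2 (fun (γ : T.verts) a => dualEval (γ : Finset ι) φ (x γ a)) γ j
  rw [← Fintype.prod_bijective e he _ _ fun _ => rfl, Fintype.prod_sum_type]
  congr 1
  · exact Finset.prod_congr rfl fun μ _ =>
      (vertexFactor_of_mem _ _ (γ := ⟨μ, T.mem_verts_of_inner μ.2⟩) μ.2 j).symm
  · refine Finset.prod_congr rfl fun k _ => ?_
    refine Eq.trans ?_ (dif_neg (PartitionTree.singleton_notMem_inner (k : ι))).symm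
    change _ = dualEval {(k : ι)} φ (x {(k : ι)} (j ⟨{(k : ι)}, T.singleton_mem k⟩))
    rw [dualEval_singleton, hleaf]

end Frames

end TreeTensor

/-! ### Frames, dual forms and transfer tensors -/

namespace TreeTensor

lemma msum_singleton {K : Type*} [Fintype K] [DecidableEq K] {κ : K → Type*}
    [∀ a, Fintype (κ a)] [∀ a, DecidableEq (κ a)] (b : K) (g : (∀ a, κ a) → ℝ) (i : ∀ a, κ a) :
    msum {b} g i = ∑ c, g (Function.update i b c) := by
  unfold msum
  refine Finset.sum_bij' (fun j _ => j b) (fun c _ => Function.update i b c) ?_ ?_ ?_ ?_ ?_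
  · exact fun _ _ => Finset.mem_univ _
  · refine fun c _ => Finset.mem_filter.2 ⟨Finset.mem_univ _, fun a ha => ?_⟩
    exact Function.update_of_ne (by simpa using ha) _ _
  · intro j hj
    funext a
    by_cases h : a = b
    · subst h
      simp
    · rw [Function.update_of_ne h, (Finset.mem_filter.1 hj).2 a (by simpa using h)]
  · exact fun c _ => Function.update_self _ _ _
  · intro j hj
    congr 1
    funext a
    by_cases h : a = b
    · subst h
      simp
    · rw [Function.update_of_ne h, (Finset.mem_filter.1 hj).2 a (by simpa using h)]

lemma exists_dual_family {M : Type*} [AddCommGroup M] [Module ℝ M] {n : ℕ} {x : Fin n → M}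
    (hx : LinearIndependent ℝ x) :
    ∃ A : Fin n → Module.Dual ℝ M, ∀ a b, A b (x a) = if a = b then 1 else 0 := by
  obtain ⟨g, hg⟩ := LinearMap.exists_leftInverse_of_injective (Fintype.linearCombination ℝ x)
    (LinearMap.ker_eq_bot.2 hx.fintypeLinearCombination_injective)
  refine ⟨fun b => LinearMap.proj b ∘ₗ g, fun a b => ?_⟩
  have h := LinearMap.congr_fun hg (Pi.single a 1)
  rw [LinearMap.comp_apply, Fintype.linearCombination_apply_single, one_smul,
    LinearMap.id_apply] at h
  rw [LinearMap.comp_apply, h, LinearMap.proj_apply, Pi.single_apply]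
  simp only [eq_comm]

lemma linearIndependent_of_dual_family {M : Type*} [AddCommGroup M] [Module ℝ M] {n : ℕ}
    {x : Fin n → M} {A : Fin n → Module.Dual ℝ M}
    (hA : ∀ a b, A b (x a) = if a = b then 1 else 0) : LinearIndependent ℝ x := by
  refine Fintype.linearIndependent_iff.2 fun g hg b => ?_
  have := congrArg (A b) hg
  simpa [hA] using this

/-- A vector of the span of `x` is determined by its values under a dual family. -/
lemma eq_sum_of_dual_family {M : Type*} [AddCommGroup M] [Module ℝ M] {n : ℕ}
    {x : Fin n → M} {A : Fin n → Module.Dual ℝ M}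
    (hA : ∀ a b, A b (x a) = if a = b then 1 else 0) {z : M}
    (hz : z ∈ Submodule.span ℝ (Set.range x)) : z = ∑ b, A b z • x b := by
  obtain ⟨c, rfl⟩ := (Submodule.mem_span_range_iff_exists_fun ℝ).1 hz
  simp [hA]

lemma mem_of_forall_dual {M : Type*} [AddCommGroup M] [Module ℝ M] {p : Submodule ℝ M} {z : M}
    (h : ∀ τ : Module.Dual ℝ M, (∀ x ∈ p, τ x = 0) → τ z = 0) : z ∈ p := by
  refine (Subspace.forall_mem_dualAnnihilator_apply_eq_zero_iff p z).1 fun τ hτ => ?_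
  exact h τ ((Submodule.mem_dualAnnihilator τ).1 hτ)

variable {ι : Type*} [Fintype ι] [DecidableEq ι]
  {V : ι → Type*} [∀ j, NormedAddCommGroup (V j)] [∀ j, NormedSpace ℝ (V j)]
  {T : PartitionTree ι} {s : Finset ι → ℕ} {C : Coeffs T s}
  {x : ∀ α : Finset ι, Fin (s α) → TS V α}

/-- The linear forms `A^α_b` are dual to the vectors `x^α_a`. -/
def IsDualOn (α : Finset ι) (x : ∀ α : Finset ι, Fin (s α) → TS V α)
    (A : ∀ α : Finset ι, Fin (s α) → Module.Dual ℝ (TS V α)) : Prop :=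
  ∀ a b, A α b (x α a) = if a = b then 1 else 0

section Dual

variable {A : ∀ α : Finset ι, Fin (s α) → Module.Dual ℝ (TS V α)} {μ : Finset ι}
  (hμ : μ ∈ T.inner)

lemma prod_dual (hA : ∀ β ∈ T.sons μ, IsDualOn β x A) (q p : ∀ β : T.sons μ, Fin (s β)) :
    ∏ β : T.sons μ, A β (p β) (x β (q β)) = if q = p then 1 else 0 := by
  simp only [fun β : T.sons μ => hA β β.2 (q β) (p β), Fintype.prod_ite_zero,
    Finset.prod_const_one, ← funext_iff]

/-- Dual forms at the sons read off the transfer tensor from the frame at `μ`; this is how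
coefficients are recovered throughout. -/
lemma IsFrame.sonsEval_dual (hx : IsFrame C x) (hA : ∀ β ∈ T.sons μ, IsDualOn β x A)
    (a : Fin (s μ)) (q : ∀ β : T.sons μ, Fin (s β)) :
    TreeTensor.sonsEval hμ (fun β => A β (q β)) (x μ a) = C ⟨μ, hμ⟩ a q := by
  rw [hx.sonsEval hμ]
  simp only [prod_dual hA]
  simp

lemma IsFrame.sonsEval_update_dual (hx : IsFrame C x) (hA : ∀ β ∈ T.sons μ, IsDualOn β x A)
    (a : Fin (s μ)) (q : ∀ β : T.sons μ, Fin (s β)) (β : T.sons μ)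
    (τ : Module.Dual ℝ (TS V β)) :
    TreeTensor.sonsEval hμ (Function.update (fun γ : T.sons μ => A γ (q γ)) β τ) (x μ a) =
      ∑ b, τ (x β b) * C ⟨μ, hμ⟩ a (Function.update q β b) := by
  -- On the frame vectors at `β`, `τ` agrees with the combination of dual forms having the same
  -- values; multilinearity then reduces to `IsFrame.sonsEval_dual`.
  have h1 : TreeTensor.sonsEval hμ (Function.update (fun γ : T.sons μ => A γ (q γ)) β τ) (x μ a) =
      TreeTensor.sonsEval hμ (Function.update (fun γ : T.sons μ => A γ (q γ)) β
        (∑ b, τ (x β b) • A β b)) (x μ a) := by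
    rw [hx.sonsEval hμ, hx.sonsEval hμ]
    refine Finset.sum_congr rfl fun p _ => ?_
    congr 1
    refine Finset.prod_congr rfl fun γ _ => ?_
    by_cases hγ : γ = β
    · subst hγ
      rw [Function.update_self, Function.update_self]
      simp [LinearMap.sum_apply, fun b => hA γ γ.2 (p γ) b]
    · rw [Function.update_of_ne hγ, Function.update_of_ne hγ]
  rw [h1, ← sonsEvalMulti_apply, MultilinearMap.map_update_sum]
  refine Finset.sum_congr rfl fun b _ => ?_
  rw [MultilinearMap.map_update_smul, smul_eq_mul, sonsEvalMulti_apply]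
  congr 1
  rw [← hx.sonsEval_dual hμ hA]
  congr 2
  funext γ
  by_cases hγ : γ = β
  · subst hγ
    simp
  · simp [Function.update_of_ne hγ]

end Dual

/-- The frames of a regular family of transfer tensors are linearly independent. -/
lemma IsFrame.linearIndependent (hx : IsFrame C x) (hC : C.IsRegular)
    (hleaf : ∀ k, LinearIndependent ℝ (x {k})) :
    ∀ α ∈ T.verts, LinearIndependent ℝ (x α) := by
  refine PartitionTree.leaf_induction hleaf fun μ hμ ih => ?_
  have : ∀ β : Finset ι, ∃ A : Fin (s β) → Module.Dual ℝ (TS V β),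
      β ∈ T.sons μ → ∀ a b, A b (x β a) = if a = b then 1 else 0 := fun β => by
    by_cases hβ : β ∈ T.sons μ
    · obtain ⟨A, hA⟩ := exists_dual_family (ih β hβ)
      exact ⟨A, fun _ => hA⟩
    · exact ⟨0, fun h => absurd h hβ⟩
  choose A hA using this
  refine Fintype.linearIndependent_iff.2 fun g hg => ?_
  refine Fintype.linearIndependent_iff.1 (hC ⟨μ, hμ⟩).1 g (funext fun q => ?_)
  have h := congrArg (TreeTensor.sonsEval hμ fun β => A β (q β)) hg
  rw [map_sum, map_zero] at h
  rw [Finset.sum_apply, Pi.zero_apply, ← h]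
  refine Finset.sum_congr rfl fun a _ => ?_
  rw [map_smul, hx.sonsEval_dual hμ fun β hβ => hA β hβ]
  rfl

lemma exists_dual_on_verts (hx : ∀ α ∈ T.verts, LinearIndependent ℝ (x α)) :
    ∃ A : ∀ α : Finset ι, Fin (s α) → Module.Dual ℝ (TS V α), ∀ α ∈ T.verts, IsDualOn α x A := by
  have : ∀ β : Finset ι, ∃ A : Fin (s β) → Module.Dual ℝ (TS V β),
      β ∈ T.verts → ∀ a b, A b (x β a) = if a = b then 1 else 0 := fun β => by
    by_cases hβ : β ∈ T.verts
    · obtain ⟨A, hA⟩ := exists_dual_family (hx β hβ)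
      exact ⟨A, fun _ => hA⟩
    · exact ⟨0, fun h => absurd h hβ⟩
  choose A hA using this
  exact ⟨A, hA⟩

/-- The frames of a regular family of transfer tensors span the minimal subspaces of the tensor
they define. -/
lemma IsFrame.minSubspace_eq (hx : IsFrame C x) (hC : C.IsRegular) (hs1 : s Finset.univ = 1)
    (hleaf : ∀ k, LinearIndependent ℝ (x {k})) (a₀ : Fin (s Finset.univ)) :
    ∀ α ∈ T.verts, minSubspace α (x Finset.univ a₀) = Submodule.span ℝ (Set.range (x α)) := by
  obtain ⟨A, hA⟩ := exists_dual_on_verts (hx.linearIndependent hC hleaf)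
  set w := x Finset.univ a₀
  refine PartitionTree.root_induction ?_ fun μ hμ ih β hβ => ?_
  · rw [minSubspace_univ]
    have : Subsingleton (Fin (s Finset.univ)) := by rw [hs1]; infer_instance
    congr 1
    ext z
    simp only [Set.mem_singleton_iff, Set.mem_range]
    constructor
    · rintro rfl
      exact ⟨a₀, rfl⟩
    · rintro ⟨a, rfl⟩
      rw [Subsingleton.elim a a₀]
  · have hAs : ∀ β ∈ T.sons μ, IsDualOn β x A := fun β hβ => hA β (PartitionTree.son_mem_verts hμ hβ)
    refine le_antisymm ?_ (Submodule.span_le.2 ?_)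
    · rw [minSubspace_eq_span, Submodule.span_le]
      rintro _ ⟨ψ, rfl⟩
      -- A form vanishing on the span of the `x^β` kills each contraction to `β`: the contraction to
      -- `μ` lies in the span of the `x^μ`, and their expansions contain only vectors `x^β` in slot
      -- `β`.
      refine mem_of_forall_dual fun τ hτ => ?_
      rw [apply_contract_son hμ ⟨β, hβ⟩ ψ τ]
      have hmem := contract_mem_minSubspace μ ψ w
      rw [ih] at hmem
      suffices Submodule.span ℝ (Set.range (x μ)) ≤ LinearMap.ker (TreeTensor.sonsEval hμ
        (Function.update (fun γ : T.sons μ => dualEval (γ : Finset ι) ψ) ⟨β, hβ⟩ τ)) from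
        LinearMap.mem_ker.1 (this hmem)
      rw [Submodule.span_le]
      rintro _ ⟨a, rfl⟩
      rw [SetLike.mem_coe, LinearMap.mem_ker, hx.sonsEval hμ]
      refine Finset.sum_eq_zero fun q _ => mul_eq_zero_of_right _ ?_
      refine Finset.prod_eq_zero (Finset.mem_univ (⟨β, hβ⟩ : T.sons μ)) ?_
      rw [Function.update_self]
      exact hτ _ (Submodule.subset_span ⟨_, rfl⟩)
    · rintro _ ⟨b, rfl⟩
      refine mem_of_forall_dual fun τ hτ => ?_
      -- If `τ` vanishes on `U_β^min(w)`, the numbers `τ (x β b)` are coefficients of a linear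
      -- relation between the rows of the `β`-matricisation, hence all zero.
      refine Fintype.linearIndependent_iff.1 ((hC ⟨μ, hμ⟩).2 ⟨β, hβ⟩) (fun b => τ (x β b))
        (funext fun q => ?_) b
      have hmem : x μ q.1 ∈ minSubspace μ w := by
        rw [ih]
        exact Submodule.subset_span ⟨_, rfl⟩
      have h := sonsEval_update_eq_zero hμ ⟨β, hβ⟩ (fun γ : T.sons μ => A γ (q.2 γ)) hτ hmem
      rw [hx.sonsEval_update_dual hμ hAs] at h
      rw [Finset.sum_apply]
      exact h

/-- The transfer tensors of a family of frames with dual linear forms `A`. -/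
def dualCoeffs (T : PartitionTree ι) (x : ∀ α : Finset ι, Fin (s α) → TS V α)
    (A : ∀ α : Finset ι, Fin (s α) → Module.Dual ℝ (TS V α)) : Coeffs T s :=
  fun μ a q => sonsEval μ.2 (fun β => A β (q β)) (x μ a)

section Reconstruct

variable {A : ∀ α : Finset ι, Fin (s α) → Module.Dual ℝ (TS V α)} {w : TS V Finset.univ}

/-- On `U_β^min(w)` every form `θ_β` equals `∑ θ_β(x^β_b) A^β_b`. Such replacements do not change
values on `U_μ^min(w)`, and the multilinear expansion after replacement is the frame equation tested
against `θ`. -/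
lemma isFrame_dualCoeffs
    (hspan : ∀ α ∈ T.verts, minSubspace α w = Submodule.span ℝ (Set.range (x α)))
    (hA : ∀ μ ∈ T.inner, ∀ β ∈ T.sons μ, IsDualOn β x A) : IsFrame (dualCoeffs T x A) x := by
  intro μ hμ a
  refine sub_eq_zero.1 (eq_zero_of_sonsEval hμ fun θ => ?_)
  have hmem : x μ a ∈ minSubspace μ w := by
    rw [hspan μ (T.mem_verts_of_inner hμ)]
    exact Submodule.subset_span ⟨a, rfl⟩
  rw [map_sub, sub_eq_zero, sonsEval_congr hμ (w := w) (θ' := fun β : T.sons μ =>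
    ∑ b, θ β (x β b) • A β b) (fun β z hz => ?_) hmem]
  · rw [← sonsEvalMulti_apply, MultilinearMap.map_sum, map_sum, map_sum]
    refine Finset.sum_congr rfl fun q _ => ?_
    rw [MultilinearMap.map_smul_univ, map_smul, map_smul, sonsEval_symm_tprod, sonsEvalMulti_apply,
      smul_eq_mul, smul_eq_mul, mul_comm]
    rfl
  · rw [hspan β (PartitionTree.son_mem_verts hμ β.2)] at hz
    conv_lhs => rw [eq_sum_of_dual_family (hA μ hμ β β.2) hz, map_sum]
    rw [LinearMap.sum_apply]
    refine Finset.sum_congr rfl fun b _ => ?_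
    rw [map_smul, LinearMap.smul_apply, smul_eq_mul, smul_eq_mul, mul_comm]

/-- A relation between rows for `i_μ` is a relation between the vectors `x^μ_a`. A relation `g`
between rows for `i_β` makes `τ = ∑ g_b A^β_b` vanish on all contractions of `w` to `β`, so on
`U_β^min(w)`, although `τ (x^β_b) = g_b`. -/
lemma isRegular_dualCoeffs (hx : ∀ α ∈ T.verts, LinearIndependent ℝ (x α))
    (hspan : ∀ α ∈ T.verts, minSubspace α w = Submodule.span ℝ (Set.range (x α)))
    (hA : ∀ μ ∈ T.inner, ∀ β ∈ T.sons μ, IsDualOn β x A) : (dualCoeffs T x A).IsRegular := by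
  have hF := isFrame_dualCoeffs hspan hA
  set C := dualCoeffs T x A
  rintro ⟨μ, hμ⟩
  have hμv := T.mem_verts_of_inner hμ
  refine ⟨?_, fun β => ?_⟩
  · refine Fintype.linearIndependent_iff.2 fun g hg => ?_
    refine Fintype.linearIndependent_iff.1 (hx μ hμv) g ?_
    refine eq_zero_of_sonsEval hμ fun θ => ?_
    rw [map_sum]
    simp only [map_smul, hF.sonsEval hμ, smul_eq_mul, Finset.mul_sum]
    rw [Finset.sum_comm]
    refine Finset.sum_eq_zero fun q _ => ?_
    have h := congrFun hg q
    rw [Finset.sum_apply, Pi.zero_apply] at h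
    simp only [← mul_assoc]
    rw [← Finset.sum_mul]
    exact mul_eq_zero_of_left h _
  · refine Fintype.linearIndependent_iff.2 fun g hg => ?_
    let τ : Module.Dual ℝ (TS V β) := ∑ b, g b • A β b
    have hτ : ∀ b, τ (x β b) = g b := fun b => by
      have := hA μ hμ β β.2
      simp [τ, LinearMap.sum_apply, fun c => this b c]
    have hzero : ∀ (θ : ∀ γ : T.sons μ, Module.Dual ℝ (TS V γ)) a,
        sonsEval hμ (Function.update θ β τ) (x μ a) = 0 := by
      intro θ a
      rw [hF.sonsEval hμ]
      let R : (∀ γ : T.sons μ, Fin (s γ)) → ℝ := fun q =>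
        ∏ γ ∈ Finset.univ.erase β, θ γ (x γ (q γ))
      have hR : IndepOf {β} R := fun i j hij => Finset.prod_congr rfl fun γ hγ => by
        rw [hij γ (by simpa using Finset.ne_of_mem_erase hγ)]
      have h1 : ∀ q : (∀ γ : T.sons μ, Fin (s γ)), C ⟨μ, hμ⟩ a q *
          ∏ γ, Function.update θ β τ γ (x γ (q γ)) = R q * (g (q β) * C ⟨μ, hμ⟩ a q) := by
        intro q
        rw [← Finset.mul_prod_erase Finset.univ _ (Finset.mem_univ β), Function.update_self, hτ]
        have : ∏ γ ∈ Finset.univ.erase β, Function.update θ β τ γ (x γ (q γ)) = R q :=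
          Finset.prod_congr rfl fun γ hγ => by
            rw [Function.update_of_ne (Finset.ne_of_mem_erase hγ)]
        rw [this]
        ring
      simp only [h1]
      -- `msum` needs a base point, hence the case distinction. The `β`-index is summed first, where
      -- the row relation gives zero.
      rcases isEmpty_or_nonempty (∀ γ : T.sons μ, Fin (s γ)) with h | ⟨⟨i⟩⟩
      · exact Finset.sum_of_isEmpty _
      · rw [← msum_univ _ i, ← Finset.sdiff_union_of_subset (Finset.subset_univ {β}),
          ← msum_msum Finset.sdiff_disjoint]
        refine Finset.sum_eq_zero fun q _ => ?_
        rw [msum_mul_left hR, msum_singleton]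
        refine mul_eq_zero_of_right _ ?_
        have h := congrFun hg (a, q)
        rw [Finset.sum_apply, Pi.zero_apply] at h
        rw [← h]
        refine Finset.sum_congr rfl fun b _ => ?_
        rw [Function.update_self]
        rfl
    intro b
    rw [← hτ b]
    suffices minSubspace (β : Finset ι) w ≤ LinearMap.ker τ by
      refine LinearMap.mem_ker.1 (this ?_)
      rw [hspan β (PartitionTree.son_mem_verts hμ β.2)]
      exact Submodule.subset_span ⟨b, rfl⟩
    rw [minSubspace_eq_span, Submodule.span_le]
    rintro _ ⟨ψ, rfl⟩
    rw [SetLike.mem_coe, LinearMap.mem_ker, apply_contract_son hμ β ψ τ]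
    have hmem := contract_mem_minSubspace μ ψ w
    rw [hspan μ hμv] at hmem
    suffices Submodule.span ℝ (Set.range (x μ)) ≤ LinearMap.ker (sonsEval hμ
      (Function.update (fun γ : T.sons μ => dualEval (γ : Finset ι) ψ) β τ)) from
      LinearMap.mem_ker.1 (this hmem)
    rw [Submodule.span_le]
    rintro _ ⟨a, rfl⟩
    exact LinearMap.mem_ker.2 (hzero _ a)

end Reconstruct

end TreeTensor

namespace TreeTensor

/-! ### Manifolds given by local parametrizations with analytic retractions -/

/-- Normal form of a map with an analytic left inverse. -/
lemma exists_immersion_normal_form {E Y : Type*} [NormedAddCommGroup E] [NormedSpace ℝ E]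
    [NormedAddCommGroup Y] [NormedSpace ℝ Y] [CompleteSpace Y]
    {h : E → Y} {G : Y → E} {Ω : Set E} (hΩ : IsOpen Ω) {e₀ : E} (he₀ : e₀ ∈ Ω)
    (hh : AnalyticAt ℝ h e₀) (hG : DifferentiableAt ℝ G (h e₀)) (hGh : ∀ e ∈ Ω, G (h e) = e) :
    ∃ (ψ : OpenPartialHomeomorph Y Y) (E₁ : Submodule ℝ Y) (g : OpenPartialHomeomorph E₁ E),
      e₀ ∈ g.target ∧ g.target ⊆ Ω ∧ E₁.ClosedComplemented ∧
      AnalyticOnNhd ℝ ψ ψ.source ∧ AnalyticOnNhd ℝ ψ.symm ψ.target ∧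
      AnalyticOnNhd ℝ g g.source ∧ AnalyticOnNhd ℝ g.symm g.target ∧
      g.source = {e : E₁ | (e : Y) ∈ ψ.target} ∧ ∀ e ∈ g.source, h (g e) = ψ.symm (e : Y) := by
  set D := fderiv ℝ h e₀ with hD
  set R := fderiv ℝ G (h e₀) with hR
  have hRD : ∀ x, R (D x) = x := by
    have h1 : HasFDerivAt (G ∘ h) (R.comp D) e₀ :=
      hG.hasFDerivAt.comp e₀ hh.differentiableAt.hasFDerivAt
    have h2 : HasFDerivAt (G ∘ h) (ContinuousLinearMap.id ℝ E) e₀ :=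
      (hasFDerivAt_id e₀).congr_of_eventuallyEq
        (Filter.eventuallyEq_of_mem (hΩ.mem_nhds he₀) fun e he => hGh e he)
    intro x
    exact congrArg (fun L : E →L[ℝ] E => L x) (h1.unique h2)
  -- Since `R ∘ D = id`, `D ∘ R` projects onto the range of `D`. The derivative of `Ψ` at `0` is `DR
  -- + (id - DR) = id`, and on the range of `D` the correction term vanishes, so there `Ψ` is `h` in
  -- the coordinate `e₀ + R y`.
  let Ψ : Y → Y := fun y => h (e₀ + R y) + (y - D (R y))
  have hΨa : AnalyticAt ℝ Ψ 0 := by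
    have h1 : AnalyticAt ℝ (fun y : Y => e₀ + R y) 0 := analyticAt_const.add (R.analyticAt 0)
    have h2 : AnalyticAt ℝ (fun y : Y => h (e₀ + R y)) 0 :=
      AnalyticAt.fun_comp (by simpa using hh) h1
    exact h2.add (analyticAt_id.sub ((D.comp R).analyticAt 0))
  have hΨd : HasFDerivAt Ψ ((ContinuousLinearEquiv.refl ℝ Y : Y ≃L[ℝ] Y) : Y →L[ℝ] Y) 0 := by
    have h1 : HasFDerivAt (fun y : Y => e₀ + R y) R 0 := R.hasFDerivAt.const_add e₀
    have h2 : HasFDerivAt (fun y : Y => h (e₀ + R y)) (D.comp R) 0 := by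
      refine HasFDerivAt.comp (g := h) (0 : Y) ?_ h1
      rw [map_zero, add_zero]
      exact hh.differentiableAt.hasFDerivAt
    refine (h2.add ((hasFDerivAt_id (0 : Y)).sub (D.comp R).hasFDerivAt)).congr_fderiv ?_
    ext y
    simp
  have hΨs : HasStrictFDerivAt Ψ ((ContinuousLinearEquiv.refl ℝ Y : Y ≃L[ℝ] Y) : Y →L[ℝ] Y) 0 := by
    have := hΨa.hasStrictFDerivAt
    rwa [hΨd.fderiv] at this
  let φ : OpenPartialHomeomorph Y Y := hΨs.toOpenPartialHomeomorph Ψ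
  have hφ : ∀ y, φ y = Ψ y := fun y => rfl
  have hφ0 : (0 : Y) ∈ φ.source := hΨs.mem_toOpenPartialHomeomorph_source
  have hsymm : AnalyticAt ℝ φ.symm (φ 0) :=
    φ.analyticAt_symm' (i := ContinuousLinearEquiv.refl ℝ Y) hφ0 hΨa hΨd.fderiv
  -- Shrinking makes `Ψ` and its inverse analytic everywhere on the domain and keeps `e₀ + R y` in
  -- `Ω`.
  let B : Set Y := {y | AnalyticAt ℝ Ψ y} ∩ ((φ.source ∩ φ ⁻¹' {z | AnalyticAt ℝ φ.symm z}) ∩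
    {y | e₀ + R y ∈ Ω})
  have hB : IsOpen B := (isOpen_analyticAt ℝ Ψ).inter
    ((φ.isOpen_inter_preimage (isOpen_analyticAt ℝ φ.symm)).inter
      (hΩ.preimage (continuous_const.add R.continuous)))
  have h0B : (0 : Y) ∈ B := ⟨hΨa, ⟨hφ0, hsymm⟩, by simpa using he₀⟩
  let φ' := φ.restrOpen B hB
  have hφ's : φ'.source = φ.source ∩ B := φ.restrOpen_source B hB
  let E₁ : Submodule ℝ Y := LinearMap.range (D : E →ₗ[ℝ] Y)
  have hmem : ∀ x, D x ∈ E₁ := fun x => ⟨x, rfl⟩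
  have hDR : ∀ y : E₁, D (R (y : Y)) = y := by
    rintro ⟨_, x, rfl⟩
    exact congrArg D (hRD x)
  let D₁ : E →L[ℝ] E₁ := D.codRestrict E₁ hmem
  let g : OpenPartialHomeomorph E₁ E :=
    { toFun := fun y => e₀ + R y
      invFun := fun e => D₁ (e - e₀)
      source := {y | (y : Y) ∈ φ'.source}
      target := {e | D (e - e₀) ∈ φ'.source}
      map_source' := fun y hy => by
        simpa [hDR y] using hy
      map_target' := fun e he => he
      left_inv' := fun y _ => Subtype.ext (by
        change D (e₀ + R y - e₀) = y
        rw [add_sub_cancel_left, hDR])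
      right_inv' := fun e _ => by
        change e₀ + R (D (e - e₀)) = e
        rw [hRD, add_sub_cancel]
      open_source := φ'.open_source.preimage continuous_subtype_val
      open_target := φ'.open_source.preimage (D.continuous.comp (continuous_id.sub continuous_const))
      continuousOn_toFun := (continuous_const.add
        (R.continuous.comp continuous_subtype_val)).continuousOn
      continuousOn_invFun :=
        (D₁.continuous.comp (continuous_id.sub continuous_const)).continuousOn }
  refine ⟨φ'.symm, E₁, g, ?_, ?_, ?_, ?_, ?_, ?_, ?_, rfl, ?_⟩
  · change D (e₀ - e₀) ∈ φ'.source
    rw [sub_self, map_zero, hφ's]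
    exact ⟨hφ0, h0B⟩
  · intro e he
    change D (e - e₀) ∈ φ'.source at he
    rw [hφ's] at he
    have := he.2.2.2
    simpa [hRD] using this
  · refine ⟨D₁.comp R, fun y => Subtype.ext (hDR y)⟩
  · intro z hz
    have h1 : φ'.symm z ∈ φ'.source := φ'.map_target hz
    have h2 : φ' (φ'.symm z) = z := φ'.right_inv hz
    rw [hφ's] at h1
    have h3 := h1.2.2.1.2
    change AnalyticAt ℝ φ.symm (φ' (φ'.symm z)) at h3
    rwa [h2] at h3
  · intro y hy
    change y ∈ φ'.source at hy
    rw [hφ's] at hy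
    exact hy.2.1
  · exact fun y _ => analyticAt_const.add ((R.comp E₁.subtypeL).analyticAt y)
  · exact fun e _ => (D₁.analyticAt _).comp (analyticAt_id.sub analyticAt_const)
  · intro y _
    change h (e₀ + R y) = Ψ y
    simp only [Ψ]
    rw [hDR, sub_self, add_zero]

universe w

/-- A local parametrization `Φ` of a subset `Str` of `X`, which is mapped to a Banach space `Y` by
`J`, with an analytic retraction `G` of an open subset `O` of `Y`. -/
structure LocalModel {X : Type w} {Y : Type*} [NormedAddCommGroup Y] [NormedSpace ℝ Y]
    (J : X → Y) (Str : Set X) where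
  E : Type w
  [instGroup : NormedAddCommGroup E]
  [instSpace : NormedSpace ℝ E]
  [instComplete : CompleteSpace E]
  Φ : E → X
  Ω : Set E
  O : Set Y
  G : Y → E
  isOpen_Ω : IsOpen Ω
  isOpen_O : IsOpen O
  analytic_Φ : AnalyticOnNhd ℝ (J ∘ Φ) Ω
  analytic_G : AnalyticOnNhd ℝ G O
  mem_str : ∀ e ∈ Ω, Φ e ∈ Str
  mem_O : ∀ e ∈ Ω, J (Φ e) ∈ O
  left_inv : ∀ e ∈ Ω, G (J (Φ e)) = e
  mem_Ω : ∀ x ∈ Str, J x ∈ O → G (J x) ∈ Ω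
  right_inv : ∀ x ∈ Str, J x ∈ O → Φ (G (J x)) = x

attribute [instance] LocalModel.instGroup LocalModel.instSpace LocalModel.instComplete

/-- A family of local models covering `S`, the strata of which are equal or disjoint. The strata
carry the subspace topology of `Y`. -/
structure LocalModels {X : Type w} (S : Set X) {Y : Type*} [NormedAddCommGroup Y] [NormedSpace ℝ Y]
    (J : X → Y) where
  Idx : Type w
  Str : Idx → Set X
  model : ∀ i, LocalModel J (Str i)
  str_subset : ∀ i, Str i ⊆ S
  str_eq : ∀ i j, (Str i ∩ Str j).Nonempty → Str i = Str j
  covers : ∀ x ∈ S, ∃ i, x ∈ Str i ∧ J x ∈ (model i).O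

namespace LocalModels

variable {X : Type w} {S : Set X} {Y : Type*} [NormedAddCommGroup Y] [NormedSpace ℝ Y] {J : X → Y}
  (M : LocalModels S J)

/-- The chart of a local model. -/
def chart (i : M.Idx) : PartialEquiv X ((M.model i).E) where
  toFun x := (M.model i).G (J x)
  invFun := (M.model i).Φ
  source := {x | x ∈ M.Str i ∧ J x ∈ (M.model i).O}
  target := (M.model i).Ω
  map_source' x hx := (M.model i).mem_Ω x hx.1 hx.2
  map_target' e he := ⟨(M.model i).mem_str e he, (M.model i).mem_O e he⟩
  left_inv' x hx := (M.model i).right_inv x hx.1 hx.2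
  right_inv' e he := (M.model i).left_inv e he

lemma chart_image (i : M.Idx) (A : Set X) :
    M.chart i '' (A ∩ (M.chart i).source) = (M.model i).Ω ∩ (M.model i).Φ ⁻¹' A := by
  ext e
  constructor
  · rintro ⟨x, ⟨hxA, hx⟩, rfl⟩
    refine ⟨(M.chart i).map_source hx, ?_⟩
    change (M.model i).Φ ((M.model i).G (J x)) ∈ A
    rwa [(M.model i).right_inv x hx.1 hx.2]
  · rintro ⟨he, heA⟩
    exact ⟨(M.model i).Φ e, ⟨heA, (M.chart i).map_target he⟩, (M.model i).left_inv e he⟩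

lemma isOpen_Ω_inter (i : M.Idx) {O : Set Y} (hO : IsOpen O) :
    IsOpen ((M.model i).Ω ∩ (J ∘ (M.model i).Φ) ⁻¹' O) :=
  ((M.model i).analytic_Φ).continuousOn.isOpen_inter_preimage ((M.model i).isOpen_Ω) hO

/-- Within one stratum the source of a chart is cut out by `O` alone, so the overlap is a preimage
of an open set under the continuous map `J ∘ Φ`. -/
lemma chart_overlap {i j : M.Idx} (h : M.Str i = M.Str j) :
    M.chart i '' ((M.chart i).source ∩ (M.chart j).source) =
      (M.model i).Ω ∩ (J ∘ (M.model i).Φ) ⁻¹' (M.model j).O := by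
  rw [Set.inter_comm, chart_image]
  ext e
  refine and_congr_right fun he => ?_
  change (M.model i).Φ e ∈ M.Str j ∧ _ ↔ _
  exact and_iff_right (h ▸ (M.model i).mem_str e he)

lemma chart_overlap_eq_empty {i j : M.Idx} (h : M.Str i ≠ M.Str j) :
    (M.chart i).source ∩ (M.chart j).source = ∅ :=
  Set.eq_empty_of_forall_notMem fun x hx => h (M.str_eq i j ⟨x, hx.1.1, hx.2.1⟩)

/-- The atlas of a family of local models. -/
def toAtlas : BanachAtlas S where
  Idx := M.Idx
  E i := (M.model i).E
  chart := M.chart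
  source_subset i _ hx := M.str_subset i hx.1
  covers := M.covers
  isOpen_target i := (M.model i).isOpen_Ω
  isOpen_overlap i j := by
    by_cases h : M.Str i = M.Str j
    · rw [M.chart_overlap h]
      exact M.isOpen_Ω_inter i ((M.model j).isOpen_O)
    · rw [M.chart_overlap_eq_empty h, Set.image_empty]
      exact isOpen_empty
  analytic_transition i j := by
    by_cases h : M.Str i = M.Str j
    · rw [M.chart_overlap h]
      exact fun e he => AnalyticAt.comp (g := (M.model j).G) ((M.model j).analytic_G _ he.2)
        ((M.model i).analytic_Φ e he.1)
    · rw [M.chart_overlap_eq_empty h, Set.image_empty]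
      exact fun e he => absurd he (Set.notMem_empty e)

lemma isOpenSet_chart_source (i : M.Idx) : M.toAtlas.IsOpenSet (M.chart i).source := by
  refine ⟨M.toAtlas.source_subset i, fun j => ?_⟩
  rw [Set.inter_comm]
  exact M.toAtlas.isOpen_overlap j i

lemma isOpenSet_of_forall_mem {A : Set X}
    (h : ∀ x ∈ A, ∃ i, x ∈ (M.chart i).source ∧ (M.chart i).source ⊆ A) :
    M.toAtlas.IsOpenSet A := by
  have hA : A = ⋃ i : {i // (M.chart i).source ⊆ A}, (M.chart i).source := by
    ext x
    simp only [Set.mem_iUnion]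
    refine ⟨fun hx => ?_, fun ⟨i, hx⟩ => i.2 hx⟩
    obtain ⟨i, hi, hiA⟩ := h x hx
    exact ⟨⟨i, hiA⟩, hi⟩
  refine ⟨fun x hx => ?_, fun j => ?_⟩
  · obtain ⟨i, hi, -⟩ := h x hx
    exact (M.isOpenSet_chart_source _).1 hi
  · rw [hA, Set.iUnion_inter, Set.image_iUnion]
    exact isOpen_iUnion fun i => (M.isOpenSet_chart_source i).2 j

lemma isImmersedSubmanifold [CompleteSpace Y] (hJ : Set.InjOn J S) :
    M.toAtlas.IsImmersedSubmanifold J := by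
  refine ⟨hJ, fun x hx => ?_⟩
  obtain ⟨i, hi⟩ := M.covers x hx
  have he : (M.model i).G (J x) ∈ (M.model i).Ω := (M.model i).mem_Ω x hi.1 hi.2
  have hΦ : (M.model i).Φ ((M.model i).G (J x)) = x := (M.model i).right_inv x hi.1 hi.2
  obtain ⟨ψ, E₁, g, h1, h2, h3, h4, h5, h6, h7, h8, h9⟩ := exists_immersion_normal_form
    (h := J ∘ (M.model i).Φ) (G := (M.model i).G) ((M.model i).isOpen_Ω) he ((M.model i).analytic_Φ _ he)
    ((M.model i).analytic_G _ ((M.model i).mem_O _ he)).differentiableAt ((M.model i).left_inv)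
  exact ⟨i, ψ, E₁, g, hi, h1, h2, h3, h4, h5, h6, h7, h8, h9⟩

/-- The map `σ` is a local section: in the chart, `f ∘ σ` is the identity near `e₀`. By the chain
rule the derivative of `f` has a continuous right inverse, so it is onto with complemented kernel.
-/
lemma isSubmersionOn {P : Type*} [NormedAddCommGroup P] [NormedSpace ℝ P] {f : P → X} {Q : Set P}
    (h : ∀ p ∈ Q, ∃ (i : M.Idx) (σ : (M.model i).E → P) (e₀ : (M.model i).E), e₀ ∈ (M.model i).Ω ∧ σ e₀ = p ∧
      DifferentiableAt ℝ σ e₀ ∧ (∀ e ∈ (M.model i).Ω, f (σ e) = (M.model i).Φ e) ∧ AnalyticAt ℝ (J ∘ f) p ∧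
      ∀ᶠ q in 𝓝 p, f q ∈ M.Str i) :
    M.toAtlas.IsSubmersionOn f Q := by
  intro p hp
  obtain ⟨i, σ, e₀, he₀, rfl, hσ, hfσ, hJf, hstr⟩ := h p hp
  have hO : J (f (σ e₀)) ∈ (M.model i).O := by
    rw [hfσ e₀ he₀]
    exact (M.model i).mem_O e₀ he₀
  have hev : ∀ᶠ q in 𝓝 (σ e₀), f q ∈ (M.chart i).source := by
    filter_upwards [hstr, hJf.continuousAt.eventually (((M.model i).isOpen_O).mem_nhds hO)] with q h1 h2
    exact ⟨h1, h2⟩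
  have han : AnalyticAt ℝ (M.chart i ∘ f) (σ e₀) :=
    AnalyticAt.comp (g := (M.model i).G) ((M.model i).analytic_G _ hO) hJf
  have hder : (fderiv ℝ (M.chart i ∘ f) (σ e₀)).comp (fderiv ℝ σ e₀) =
      ContinuousLinearMap.id ℝ ((M.model i).E) := by
    have h1 : HasFDerivAt ((M.chart i ∘ f) ∘ σ) _ e₀ :=
      han.differentiableAt.hasFDerivAt.comp e₀ hσ.hasFDerivAt
    refine h1.unique ((hasFDerivAt_id e₀).congr_of_eventuallyEq ?_)
    refine Filter.eventuallyEq_of_mem (((M.model i).isOpen_Ω).mem_nhds he₀) fun e he => ?_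
    change (M.model i).G (J (f (σ e))) = e
    rw [hfσ e he, (M.model i).left_inv e he]
  have hright : Function.RightInverse (fderiv ℝ σ e₀) (fderiv ℝ (M.chart i ∘ f) (σ e₀)) :=
    fun e => congrArg (fun L : (M.model i).E →L[ℝ] (M.model i).E => L e) hder
  have hker : (LinearMap.ker (fderiv ℝ (M.chart i ∘ f) (σ e₀) : P →ₗ[ℝ] (M.model i).E)).ClosedComplemented :=
    ContinuousLinearMap.closedComplemented_ker_of_rightInverse _ _ hright
  exact ⟨i, hev.self_of_nhds, hev, han, hright.surjective, hker⟩

end LocalModels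

end TreeTensor

namespace TreeTensor

/-! ### Norm estimates along the tree -/

/-- Hahn–Banach: a norming form at `z`. It converts bounds on forms into bounds on the norms
`‖·‖_α`. -/
lemma exists_dual_le_seminorm {M : Type*} [AddCommGroup M] [Module ℝ M] (p : Seminorm ℝ M)
    (z : M) : ∃ τ : Module.Dual ℝ M, (∀ x, |τ x| ≤ p x) ∧ τ z = p z := by
  by_cases hz : z = 0
  · exact ⟨0, fun x => by simp, by simp [hz]⟩
  let f : M →ₗ.[ℝ] ℝ := LinearPMap.mkSpanSingleton z (p z) hz
  obtain ⟨τ, hτ, hle⟩ := exists_extension_of_le_sublinear f p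
    (fun c hc x => by rw [map_smul_eq_mul, Real.norm_of_nonneg hc.le]) (map_add_le_add p) (by
      rintro ⟨x, hx⟩
      obtain ⟨c, rfl⟩ := Submodule.mem_span_singleton.1 hx
      rw [LinearPMap.mkSpanSingleton'_apply, map_smul_eq_mul, smul_eq_mul]
      exact mul_le_mul_of_nonneg_right (Real.le_norm_self c) (apply_nonneg p z))
  refine ⟨τ, fun x => abs_le.2 ⟨?_, hle x⟩, ?_⟩
  · have := hle (-x)
    rw [map_neg, map_neg_eq_map] at this
    linarith
  · have h := hτ ⟨z, Submodule.mem_span_singleton_self z⟩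
    exact h.trans (LinearPMap.mkSpanSingleton_apply ℝ ℝ hz (p z))

variable {ι : Type*} [Fintype ι] [DecidableEq ι]
  {V : ι → Type*} [∀ j, NormedAddCommGroup (V j)] [∀ j, NormedSpace ℝ (V j)]
  {T : PartitionTree ι}

namespace TreeNorms

variable (N : TreeNorms T V)

/-- A linear form on `V_α` that is bounded with respect to `‖·‖_α`. -/
def IsBdd (α : Finset ι) (θ : Module.Dual ℝ (TS V α)) : Prop :=
  ∃ c : ℝ, 0 < c ∧ ∀ x, |θ x| ≤ c * N.nrm α x

variable {N}

/-- Ensures that the supremum in `injNorm` is a genuine upper bound and not the default value of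
`sSup` on an unbounded set. -/
lemma bddAbove_injNorm {μ : Finset ι} (hμ : μ ∈ T.inner) (v : TS V μ) :
    BddAbove {t | ∃ φ : ∀ β : T.sons μ, Module.Dual ℝ (TS V β),
      (∀ β x, |φ β x| ≤ N.nrm β x) ∧
        t = |PiTensorProduct.dualDistrib (PiTensorProduct.tprod ℝ φ) (sonsEquiv hμ v)|} := by
  suffices ∀ z : ⨂[ℝ] β : T.sons μ, TS V β, ∃ K : ℝ,
      ∀ φ : ∀ β : T.sons μ, Module.Dual ℝ (TS V β), (∀ β x, |φ β x| ≤ N.nrm β x) →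
        |PiTensorProduct.dualDistrib (PiTensorProduct.tprod ℝ φ) z| ≤ K by
    obtain ⟨K, hK⟩ := this (sonsEquiv hμ v)
    refine ⟨K, ?_⟩
    rintro _ ⟨φ, hφ, rfl⟩
    exact hK φ hφ
  intro z
  induction z using PiTensorProduct.induction_on with
  | smul_tprod r x =>
    refine ⟨|r| * ∏ β : T.sons μ, N.nrm β (x β), fun φ hφ => ?_⟩
    rw [map_smul, PiTensorProduct.dualDistrib_apply, smul_eq_mul, abs_mul, Finset.abs_prod]
    refine mul_le_mul_of_nonneg_left ?_ (abs_nonneg r)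
    exact Finset.prod_le_prod (fun _ _ => abs_nonneg _) fun β _ => hφ β (x β)
  | add x y hx hy =>
    obtain ⟨K, hK⟩ := hx
    obtain ⟨K', hK'⟩ := hy
    refine ⟨K + K', fun φ hφ => ?_⟩
    rw [map_add]
    exact (abs_add_le _ _).trans (add_le_add (hK φ hφ) (hK' φ hφ))

/-- Each form is rescaled to dual norm at most one, and homogeneity restores the factors `c β`. The
constant `|C| + 1` is used to have it strictly positive. -/
lemma DominatesInjective.sonsEval_le (hinj : N.DominatesInjective) {μ : Finset ι}
    (hμ : μ ∈ T.inner) : ∃ K : ℝ, 0 < K ∧ ∀ (θ : ∀ β : T.sons μ, Module.Dual ℝ (TS V β))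
      (c : T.sons μ → ℝ), (∀ β, 0 < c β) → (∀ β x, |θ β x| ≤ c β * N.nrm β x) →
      ∀ z, |sonsEval hμ θ z| ≤ K * (∏ β, c β) * N.nrm μ z := by
  obtain ⟨C, hC⟩ := hinj μ hμ
  refine ⟨|C| + 1, by positivity, fun θ c hc hθ z => ?_⟩
  have hpos : 0 < ∏ β, c β := Finset.prod_pos fun β _ => hc β
  have h1 : |sonsEval hμ (fun β => (c β)⁻¹ • θ β) z| ≤ N.injNorm hμ z := by
    refine le_csSup (bddAbove_injNorm hμ z) ⟨fun β => (c β)⁻¹ • θ β, fun β x => ?_, rfl⟩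
    rw [LinearMap.smul_apply, smul_eq_mul, abs_mul, abs_of_pos (inv_pos.2 (hc β)),
      inv_mul_le_iff₀ (hc β)]
    exact hθ β x
  rw [← sonsEvalMulti_apply, MultilinearMap.map_smul_univ, smul_eq_mul, abs_mul,
    Finset.prod_inv_distrib, abs_of_pos (inv_pos.2 hpos), inv_mul_le_iff₀ hpos,
    sonsEvalMulti_apply] at h1
  have h2 : C * N.nrm μ z ≤ (|C| + 1) * N.nrm μ z :=
    mul_le_mul_of_nonneg_right (by linarith [le_abs_self C]) (apply_nonneg _ _)
  calc |sonsEval hμ θ z| ≤ (∏ β, c β) * N.injNorm hμ z := h1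
    _ ≤ (∏ β, c β) * ((|C| + 1) * N.nrm μ z) :=
      mul_le_mul_of_nonneg_left ((hC z).trans h2) hpos.le
    _ = _ := by ring

lemma DominatesInjective.isBdd_sonsEval (hinj : N.DominatesInjective) {μ : Finset ι}
    (hμ : μ ∈ T.inner) {θ : ∀ β : T.sons μ, Module.Dual ℝ (TS V β)}
    (hθ : ∀ β : T.sons μ, N.IsBdd β (θ β)) : N.IsBdd μ (sonsEval hμ θ) := by
  choose c hc hle using hθ
  obtain ⟨K, hK, h⟩ := hinj.sonsEval_le hμ
  exact ⟨K * ∏ β, c β, mul_pos hK (Finset.prod_pos fun β _ => hc β), h θ c hc hle⟩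

lemma isBdd_leaf {k : ι} (φ : V k →L[ℝ] ℝ) :
    N.IsBdd {k} ((φ : V k →ₗ[ℝ] ℝ) ∘ₗ (leafEquiv k).toLinearMap) := by
  refine ⟨‖φ‖ + 1, by positivity, fun x => ?_⟩
  rw [N.leaf]
  exact (φ.le_opNorm _).trans (mul_le_mul_of_nonneg_right (by linarith) (norm_nonneg _))

lemma IsBdd.zero {α : Finset ι} : N.IsBdd α 0 :=
  ⟨1, one_pos, fun x => by simp⟩

lemma IsBdd.add {α : Finset ι} {θ θ' : Module.Dual ℝ (TS V α)} (h : N.IsBdd α θ)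
    (h' : N.IsBdd α θ') : N.IsBdd α (θ + θ') := by
  obtain ⟨c, hc, hle⟩ := h
  obtain ⟨c', hc', hle'⟩ := h'
  refine ⟨c + c', add_pos hc hc', fun x => ?_⟩
  rw [add_mul]
  exact (abs_add_le _ _).trans (add_le_add (hle x) (hle' x))

lemma IsBdd.smul {α : Finset ι} {θ : Module.Dual ℝ (TS V α)} (h : N.IsBdd α θ) (r : ℝ) :
    N.IsBdd α (r • θ) := by
  obtain ⟨c, hc, hle⟩ := h
  refine ⟨(|r| + 1) * c, by positivity, fun x => ?_⟩
  rw [LinearMap.smul_apply, smul_eq_mul, abs_mul, mul_assoc]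
  exact mul_le_mul (by linarith) (hle x) (abs_nonneg _) (by positivity)

lemma IsBdd.sum {α : Finset ι} {L : Type*} (S : Finset L) {θ : L → Module.Dual ℝ (TS V α)}
    (h : ∀ l ∈ S, N.IsBdd α (θ l)) : N.IsBdd α (∑ l ∈ S, θ l) :=
  Finset.sum_induction θ (N.IsBdd α) (fun _ _ => IsBdd.add) IsBdd.zero h

lemma DominatesInjective.isBdd_dualEval (hinj : N.DominatesInjective) (φ : ∀ k, V k →L[ℝ] ℝ) :
    ∀ α ∈ T.verts, N.IsBdd α (dualEval α φ) := by
  refine PartitionTree.leaf_induction (fun k => ?_) fun μ hμ ih => ?_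
  · have : dualEval {k} φ = ((φ k : V k →ₗ[ℝ] ℝ) ∘ₗ (leafEquiv k).toLinearMap) :=
      LinearMap.ext fun z => dualEval_singleton k φ z
    rw [this]
    exact isBdd_leaf (φ k)
  · rw [dualEval_eq_sonsEval hμ]
    exact hinj.isBdd_sonsEval hμ fun β : T.sons μ => ih β β.2

/-- Induction from the root, where the contraction is the identity. At a son, the norm of the
contraction is its value under a norming form `τ`; `apply_contract_son` rewrites this value as a
product form, bounded on `V_μ`, applied to the contraction to the father. -/
lemma DominatesInjective.contract_le (hinj : N.DominatesInjective) (ψ : ∀ k, V k →L[ℝ] ℝ) :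
    ∀ α ∈ T.verts, ∃ c : ℝ, ∀ w, N.nrm α (contract α ψ w) ≤ c * N.nrm Finset.univ w := by
  refine PartitionTree.root_induction ⟨1, fun w => by rw [contract_univ, one_mul]⟩
    fun μ hμ ih β hβ => ?_
  obtain ⟨c, hc⟩ := ih
  obtain ⟨K, hK, hle⟩ := hinj.sonsEval_le hμ
  choose d hd hdle using fun γ : T.sons μ =>
    hinj.isBdd_dualEval ψ γ (PartitionTree.son_mem_verts hμ γ.2)
  -- The norming form in slot `β` has constant `1`, so the resulting bound does not depend on `w`.
  let d' : T.sons μ → ℝ := Function.update d ⟨β, hβ⟩ 1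
  have hd' : ∀ γ, 0 < d' γ := fun γ => by
    by_cases h : γ = ⟨β, hβ⟩
    · subst h
      simp [d']
    · simpa [d', Function.update_of_ne h] using hd γ
  refine ⟨K * (∏ γ, d' γ) * c, fun w => ?_⟩
  obtain ⟨τ, hτ, hτz⟩ := exists_dual_le_seminorm (N.nrm β) (contract β ψ w)
  have h := hle (Function.update (fun γ : T.sons μ => dualEval (γ : Finset ι) ψ) ⟨β, hβ⟩ τ) d' hd'
    (fun γ x => by
      by_cases h : γ = ⟨β, hβ⟩
      · subst h
        simpa [d'] using hτ x
      · simpa [d', Function.update_of_ne h] using hdle γ x) (contract μ ψ w)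
  rw [← apply_contract_son hμ ⟨β, hβ⟩ ψ τ, hτz] at h
  refine (le_abs_self _).trans (h.trans ?_)
  rw [mul_assoc _ c]
  exact mul_le_mul_of_nonneg_left (hc w)
    (mul_nonneg hK.le (Finset.prod_nonneg fun γ _ => (hd' γ).le))

/-- Every vector of `U_α^min(w₀)` is the value at `w₀` of a bounded map `Γ` with
`Γ w ∈ U_α^min(w)` for all `w`. -/
lemma DominatesInjective.exists_bounded_section (hinj : N.DominatesInjective) {α : Finset ι}
    (hα : α ∈ T.verts) {w₀ : TS V Finset.univ} {z : TS V α} (hz : z ∈ minSubspace α w₀) :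
    ∃ Γ : TS V Finset.univ →ₗ[ℝ] TS V α, Γ w₀ = z ∧ (∀ w, Γ w ∈ minSubspace α w) ∧
      ∃ c : ℝ, 0 ≤ c ∧ ∀ w, N.nrm α (Γ w) ≤ c * N.nrm Finset.univ w := by
  rw [minSubspace_eq_span] at hz
  induction hz using Submodule.span_induction with
  | mem x hx =>
    obtain ⟨φ, rfl⟩ := hx
    obtain ⟨c, hc⟩ := hinj.contract_le φ α hα
    exact ⟨contract α φ, rfl, contract_mem_minSubspace α φ, |c|, abs_nonneg c, fun w => (hc w).trans
      (mul_le_mul_of_nonneg_right (le_abs_self c) (apply_nonneg _ _))⟩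
  | zero => exact ⟨0, rfl, fun w => Submodule.zero_mem _, 0, le_rfl, fun w => by simp⟩
  | add x y _ _ hx hy =>
    obtain ⟨Γ, rfl, hm, c, hc0, hc⟩ := hx
    obtain ⟨Γ', rfl, hm', c', hc0', hc'⟩ := hy
    refine ⟨Γ + Γ', rfl, fun w => Submodule.add_mem _ (hm w) (hm' w), c + c', add_nonneg hc0 hc0',
      fun w => ?_⟩
    rw [add_mul]
    exact (map_add_le_add _ _ _).trans (add_le_add (hc w) (hc' w))
  | smul r x _ hx =>
    obtain ⟨Γ, rfl, hm, c, hc0, hc⟩ := hx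
    refine ⟨r • Γ, rfl, fun w => Submodule.smul_mem _ r (hm w), ‖r‖ * c, by positivity,
      fun w => ?_⟩
    rw [LinearMap.smul_apply, map_smul_eq_mul, mul_assoc]
    exact mul_le_mul_of_nonneg_left (hc w) (norm_nonneg r)

lemma TensorMapContinuous.tprod_le (hcont : N.TensorMapContinuous) : ∀ α ∈ T.verts,
    ∃ K : ℝ, 0 ≤ K ∧ ∀ f : ∀ j : α, V j,
      N.nrm α (PiTensorProduct.tprod ℝ f) ≤ K * ∏ j, ‖f j‖ := by
  refine PartitionTree.leaf_induction (fun k => ⟨1, zero_le_one, fun f => ?_⟩) fun μ hμ ih => ?_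
  · rw [N.leaf, leafEquiv, PiTensorProduct.subsingletonEquiv_apply_tprod, one_mul]
    exact (Fintype.prod_subsingleton (fun j : ({k} : Finset ι) => ‖f j‖)
      ⟨k, Finset.mem_singleton_self k⟩).ge
  · choose K hK hle using fun β : T.sons μ => ih β β.2
    obtain ⟨C, hC⟩ := hcont μ hμ
    refine ⟨|C| * ∏ β, K β, mul_nonneg (abs_nonneg C) (Finset.prod_nonneg fun β _ => hK β),
      fun f => ?_⟩
    have h := hC fun β => PiTensorProduct.tprod ℝ (restrictSon hμ f β)
    rw [← sonsEquiv_tprod, LinearEquiv.symm_apply_apply] at h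
    refine h.trans ?_
    have h1 : ∏ β : T.sons μ, N.nrm β (PiTensorProduct.tprod ℝ (restrictSon hμ f β)) ≤
        (∏ β, K β) * ∏ j, ‖f j‖ := by
      rw [← PartitionTree.prod_sons hμ fun j => ‖f j‖, ← Finset.prod_mul_distrib]
      exact Finset.prod_le_prod (fun _ _ => apply_nonneg _ _) fun β _ => hle β _
    have h0 : 0 ≤ ∏ β : T.sons μ, N.nrm β (PiTensorProduct.tprod ℝ (restrictSon hμ f β)) :=
      Finset.prod_nonneg fun _ _ => apply_nonneg _ _
    rw [mul_assoc]
    exact (mul_le_mul_of_nonneg_right (le_abs_self C) h0).trans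
      (mul_le_mul_of_nonneg_left h1 (abs_nonneg C))

end TreeNorms

/-! ### Maps on the completion -/

section Completion

variable {N : TreeNorms T V} {Y : Type*} [NormedAddCommGroup Y] [NormedSpace ℝ Y]
  {J : TS V Finset.univ →ₗ[ℝ] Y}

lemma exists_extension (hJ : ∀ x, ‖J x‖ = N.nrm Finset.univ x) (hJd : DenseRange J)
    {F : Type*} [NormedAddCommGroup F] [NormedSpace ℝ F] [CompleteSpace F]
    (f : TS V Finset.univ →ₗ[ℝ] F) (hf : ∃ c : ℝ, ∀ w, ‖f w‖ ≤ c * N.nrm Finset.univ w) :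
    ∃ g : Y →L[ℝ] F, ∀ w, g (J w) = f w := by
  refine ⟨f.extendOfNorm J, fun w => LinearMap.extendOfNorm_eq hJd ?_ w⟩
  obtain ⟨c, hc⟩ := hf
  exact ⟨c, fun x => by rw [hJ]; exact hc x⟩

lemma exists_continuousMultilinear (hcont : N.TensorMapContinuous)
    (hJ : ∀ x, ‖J x‖ = N.nrm Finset.univ x) :
    ∃ m : ContinuousMultilinearMap ℝ (fun j : (Finset.univ : Finset ι) => V j) Y,
      ∀ f, m f = J (PiTensorProduct.tprod ℝ f) := by
  obtain ⟨K, -, hK⟩ := hcont.tprod_le Finset.univ T.root_mem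
  refine ⟨(J.compMultilinearMap (PiTensorProduct.tprod ℝ)).mkContinuous K fun f => ?_,
    fun f => rfl⟩
  rw [LinearMap.compMultilinearMap_apply, hJ]
  exact hK f

/-- In `Y` the parametrization is a finite sum of products of entries of `C` with a continuous
multilinear map evaluated at affine functions of `L`. -/
lemma analyticAt_treeParam (hcont : N.TensorMapContinuous)
    (hJ : ∀ x, ‖J x‖ = N.nrm Finset.univ x) {s : Finset ι → ℕ} {U W : ∀ k, Submodule ℝ (V k)}
    (b : ∀ k, Module.Basis (Fin (s {k})) ℝ (U k)) (p : (∀ k, U k →L[ℝ] W k) × Coeffs T s) :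
    AnalyticAt ℝ (J ∘ treeParam (T := T) b) p := by
  obtain ⟨m, hm⟩ := exists_continuousMultilinear hcont hJ
  have : J ∘ treeParam (T := T) b = fun p : (∀ k, U k →L[ℝ] W k) × Coeffs T s =>
      ∑ i : (∀ α : T.verts, Fin (s α)),
        (∏ μ : T.inner, p.2 μ (i ⟨μ, T.mem_verts_of_inner μ.2⟩)
          (fun β => i ⟨β, T.sons_subset μ (T.mem_verts_of_inner μ.2) β.2⟩)) •
        m (fun k : (Finset.univ : Finset ι) =>
          (b k (i ⟨{(k : ι)}, T.singleton_mem k⟩) : V k) +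
            (p.1 k (b k (i ⟨{(k : ι)}, T.singleton_mem k⟩)) : V k)) := by
    funext p
    simp only [Function.comp_apply, treeParam, map_sum, map_smul, hm]
  rw [this]
  refine Finset.analyticAt_fun_sum _ fun i _ => AnalyticAt.smul ?_ ?_
  · refine Finset.analyticAt_fun_prod _ fun μ _ => ?_
    have h : AnalyticAt ℝ (fun p : (∀ k, U k →L[ℝ] W k) × Coeffs T s => p.2) p := analyticAt_snd
    exact analyticAt_pi_iff.1 (analyticAt_pi_iff.1 (analyticAt_pi_iff.1 h μ) _) _
  · refine AnalyticAt.fun_comp (g := m) m.analyticAt (AnalyticAt.pi fun k => ?_)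
    refine analyticAt_const.add ?_
    have h : AnalyticAt ℝ (fun p : (∀ k, U k →L[ℝ] W k) × Coeffs T s => p.1) p := analyticAt_fst
    exact (((W k).subtypeL.comp (ContinuousLinearMap.apply ℝ (W k)
      (b k (i ⟨{(k : ι)}, T.singleton_mem k⟩)))).analyticAt _).fun_comp (analyticAt_pi_iff.1 h (k : ι))

end Completion

end TreeTensor

namespace TreeTensor

/-! ### The image of the parametrization -/

lemma exists_projections {E : Type*} [NormedAddCommGroup E] [NormedSpace ℝ E]
    {U W : Submodule ℝ E} [FiniteDimensional ℝ U] (hW : IsClosed (W : Set E)) (h : IsCompl U W) :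
    ∃ (P : E →L[ℝ] U) (Q : E →L[ℝ] W), (∀ u : U, P u = u) ∧ (∀ w : W, P w = 0) ∧
      (∀ u : U, Q u = 0) ∧ (∀ w : W, Q w = w) ∧ ∀ z, (P z : E) + Q z = z := by
  have ht := (Submodule.IsCompl.isTopCompl_of_isClosed_of_finiteDimensional h.symm hW)
  refine ⟨U.projectionOntoL W ht.symm, W.projectionOntoL U ht,
    Submodule.projectionOntoL_apply_left _, Submodule.projectionOntoL_apply_right _,
    Submodule.projectionOntoL_apply_right _, Submodule.projectionOntoL_apply_left _, fun z => ?_⟩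
  obtain ⟨u, w, rfl⟩ : ∃ (u : U) (w : W), (u : E) + w = z := by
    have hz : z ∈ U ⊔ W := h.sup_eq_top ▸ Submodule.mem_top
    obtain ⟨u, hu, w, hw, rfl⟩ := Submodule.mem_sup.1 hz
    exact ⟨⟨u, hu⟩, ⟨w, hw⟩, rfl⟩
  simp only [map_add, Submodule.projectionOntoL_apply_left, Submodule.projectionOntoL_apply_right,
    add_zero, zero_add]

lemma span_eq_of_linearIndependent {M : Type*} [AddCommGroup M] [Module ℝ M] {p : Submodule ℝ M}
    [FiniteDimensional ℝ p] {n : ℕ} {x : Fin n → M} (hx : LinearIndependent ℝ x)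
    (hmem : ∀ a, x a ∈ p) (hn : Module.finrank ℝ p = n) : p = Submodule.span ℝ (Set.range x) := by
  symm
  refine Submodule.eq_of_le_of_finrank_eq (Submodule.span_le.2 ?_) ?_
  · rintro _ ⟨a, rfl⟩
    exact hmem a
  · rw [finrank_span_eq_card hx, Fintype.card_fin, hn]

lemma exists_linearIndependent_of_finrank_eq {M : Type*} [AddCommGroup M] [Module ℝ M]
    {p : Submodule ℝ M} [FiniteDimensional ℝ p] {n : ℕ} (hn : Module.finrank ℝ p = n) :
    ∃ z : Fin n → M, LinearIndependent ℝ z ∧ ∀ a, z a ∈ p := by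
  let B := Module.finBasisOfFinrankEq ℝ p hn
  exact ⟨fun a => (B a : M), B.linearIndependent.map' p.subtype (Submodule.ker_subtype p),
    fun a => (B a).2⟩

variable {ι : Type*} [Fintype ι] [DecidableEq ι]
  {V : ι → Type*} [∀ j, NormedAddCommGroup (V j)] [∀ j, NormedSpace ℝ (V j)]
  {T : PartitionTree ι} {s : Finset ι → ℕ} {U W : ∀ k, Submodule ℝ (V k)}

/-- Rank and minimal subspaces of a parametrized tensor are read off from the recursive frames. At a
leaf, a relation between the vectors `u + L u` puts the corresponding combination of the `u` into
`W_k`, so it is trivial. -/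
lemma exists_frame_treeParam (hs : ∀ α, 0 < s α) (hs1 : s Finset.univ = 1)
    (hUW : ∀ k, IsCompl (U k) (W k)) (b : ∀ k, Module.Basis (Fin (s {k})) ℝ (U k))
    {p : (∀ k, U k →L[ℝ] W k) × Coeffs T s} (hp : p.2.IsRegular) :
    ∃ x : ∀ α : Finset ι, Fin (s α) → TS V α, IsFrame p.2 x ∧
      (∀ k a, leafEquiv k (x {k} a) = (b k a : V k) + (p.1 k (b k a) : V k)) ∧
      (∀ a, treeParam b p = x Finset.univ a) ∧ (∀ α ∈ T.verts, LinearIndependent ℝ (x α)) ∧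
      ∀ α ∈ T.verts, minSubspace α (treeParam b p) = Submodule.span ℝ (Set.range (x α)) := by
  obtain ⟨x, hx, hleaf⟩ := exists_isFrame p.2 fun k a => (b k a : V k) + (p.1 k (b k a) : V k)
  have hleaf' : ∀ k a, leafEquiv k (x {k} a) = (b k a : V k) + (p.1 k (b k a) : V k) :=
    fun k a => by rw [hleaf, LinearEquiv.apply_symm_apply]
  have hw : ∀ a, treeParam b p = x Finset.univ a := hx.treeParam_eq hs hs1 b p hleaf'
  have hli : ∀ k, LinearIndependent ℝ (x {k}) := fun k => by
    refine Fintype.linearIndependent_iff.2 fun g hg a => ?_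
    refine Fintype.linearIndependent_iff.1 (b k).linearIndependent g ?_ a
    have h := congrArg (leafEquiv k) hg
    simp only [map_sum, map_smul, hleaf', map_zero, smul_add, Finset.sum_add_distrib] at h
    have hu : ((∑ a, g a • b k a : U k) : V k) = ∑ a, g a • (b k a : V k) := by simp
    have hv : ((∑ a, g a • p.1 k (b k a) : W k) : V k) = ∑ a, g a • (p.1 k (b k a) : V k) := by simp
    rw [← hu, ← hv] at h
    have h1 := Submodule.disjoint_def.1 (hUW k).disjoint _ (∑ a, g a • b k a : U k).2 (by
      rw [eq_neg_of_add_eq_zero_left h]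
      exact (W k).neg_mem (Subtype.mem _))
    exact Subtype.ext h1
  refine ⟨x, hx, hleaf', hw, hx.linearIndependent hp hli, ?_⟩
  let a₀ : Fin (s Finset.univ) := ⟨0, hs _⟩
  rw [hw a₀]
  exact hx.minSubspace_eq hp hs1 hli a₀

lemma tbRank_treeParam (hs : ∀ α, 0 < s α) (hs1 : s Finset.univ = 1)
    (hUW : ∀ k, IsCompl (U k) (W k)) (b : ∀ k, Module.Basis (Fin (s {k})) ℝ (U k))
    {p : (∀ k, U k →L[ℝ] W k) × Coeffs T s} (hp : p.2.IsRegular) :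
    ∀ α ∈ T.verts, tbRank (treeParam b p) α = s α := by
  obtain ⟨x, -, -, -, hli, hspan⟩ := exists_frame_treeParam hs hs1 hUW b hp
  intro α hα
  rw [tbRank, hspan α hα, finrank_span_eq_card (hli α hα), Fintype.card_fin]

/-- The leaf minimal subspace is the graph of `L_k` over `U_k`, and graphs of maps into `W_k` are
complementary to `W_k`. -/
lemma isCompl_leafMinSubspace_treeParam (hs : ∀ α, 0 < s α) (hs1 : s Finset.univ = 1)
    (hUW : ∀ k, IsCompl (U k) (W k)) (b : ∀ k, Module.Basis (Fin (s {k})) ℝ (U k))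
    {p : (∀ k, U k →L[ℝ] W k) × Coeffs T s} (hp : p.2.IsRegular) (k : ι) :
    IsCompl (leafMinSubspace k (treeParam b p)) (W k) := by
  obtain ⟨x, -, hleaf, -, hli, hspan⟩ := exists_frame_treeParam hs hs1 hUW b hp
  have heq : leafMinSubspace k (treeParam b p) =
      LinearMap.range ((U k).subtype + (W k).subtype ∘ₗ (p.1 k : U k →ₗ[ℝ] W k)) := by
    rw [leafMinSubspace, hspan _ (T.singleton_mem k), Submodule.map_span, ← Set.range_comp,
      LinearMap.range_eq_map, ← (b k).span_eq, Submodule.map_span, ← Set.range_comp]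
    congr 2
    funext a
    exact hleaf k a
  rw [heq]
  refine ⟨Submodule.disjoint_def.2 ?_, codisjoint_iff.2 (eq_top_iff.2 fun z _ => ?_)⟩
  · rintro _ ⟨u, rfl⟩ hz
    have hz' : (u : V k) + (p.1 k u : V k) ∈ W k := hz
    have hu : (u : V k) ∈ W k := by simpa using (W k).sub_mem hz' (p.1 k u).2
    have h0 : u = 0 := Subtype.ext (Submodule.disjoint_def.1 (hUW k).disjoint _ u.2 hu)
    rw [h0, map_zero]
  · have hz : z ∈ U k ⊔ W k := (hUW k).sup_eq_top ▸ Submodule.mem_top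
    obtain ⟨u, hu, w, hw, rfl⟩ := Submodule.mem_sup.1 hz
    refine Submodule.mem_sup.2 ⟨_, ⟨⟨u, hu⟩, rfl⟩, w - p.1 k ⟨u, hu⟩, (W k).sub_mem hw
      (Subtype.mem _), ?_⟩
    change u + (p.1 k ⟨u, hu⟩ : V k) + (w - (p.1 k ⟨u, hu⟩ : V k)) = u + w
    abel

/-- A tensor is in the image of the parametrization if its leaf minimal subspaces are
complementary to the `W_k`. -/
lemma exists_treeParam_eq [Nontrivial ι] (hs : ∀ α, 0 < s α) (hs1 : s Finset.univ = 1)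
    [∀ k, FiniteDimensional ℝ (U k)] (hW : ∀ k, IsClosed (W k : Set (V k)))
    (hUW : ∀ k, IsCompl (U k) (W k)) (b : ∀ k, Module.Basis (Fin (s {k})) ℝ (U k))
    {w : TS V Finset.univ} (hrank : ∀ α ∈ T.verts, tbRank w α = s α)
    (hw : ∀ k, IsCompl (leafMinSubspace k w) (W k)) :
    ∃ p : (∀ k, U k →L[ℝ] W k) × Coeffs T s, p.2.IsRegular ∧ treeParam b p = w := by
  have hw0 : w ≠ 0 := by
    rintro rfl
    have := hrank _ T.root_mem
    rw [tbRank_zero, hs1] at this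
    exact zero_ne_one this
  choose P Q hPu hPw hQu hQw hPQ using fun k => exists_projections (hW k) (hw k)
  -- Here `P` and `Q` project along `V_k = U_k^min(w) ⊕ W_k`. Since `u = P u + Q u`, the choice `L =
  -- -Q` on `U_k` gives `u + L u = P u`, a vector of `U_k^min(w)`.
  let L : ∀ k, U k →L[ℝ] W k := fun k => -(Q k).comp (U k).subtypeL
  let y : ∀ k, Fin (s {k}) → TS V {k} := fun k a =>
    (leafEquiv k).symm ((b k a : V k) + (L k (b k a) : V k))
  have hy : ∀ k a, (b k a : V k) + (L k (b k a) : V k) = P k (b k a) := fun k a => by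
    conv_lhs => rw [← hPQ k (b k a : V k)]
    simp [L]
  have hymem : ∀ k a, y k a ∈ minSubspace {k} w := fun k a => by
    obtain ⟨z, hz, hz'⟩ := (P k (b k a)).2
    have : y k a = z := by
      simp only [y]
      rw [hy, ← hz']
      exact (leafEquiv k).symm_apply_apply z
    rwa [this]
  have hyli : ∀ k, LinearIndependent ℝ (y k) := fun k => by
    refine Fintype.linearIndependent_iff.2 fun g hg a => ?_
    refine Fintype.linearIndependent_iff.1 (b k).linearIndependent g ?_ a
    have h := congrArg (leafEquiv k) hg
    simp only [y, map_sum, map_smul, hy, map_zero, LinearEquiv.apply_symm_apply] at h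
    have h2 : ((P k ((∑ a, g a • b k a : U k) : V k) : leafMinSubspace k w) : V k) = 0 := by
      rw [← h]
      simp
    have h3 := hPQ k ((∑ a, g a • b k a : U k) : V k)
    rw [h2, zero_add] at h3
    exact Subtype.ext (Submodule.disjoint_def.1 (hUW k).disjoint _ (Subtype.mem _)
      (h3 ▸ Subtype.mem _))
  have hbas : ∀ α : Finset ι, ∃ z : Fin (s α) → TS V α, α ∈ T.verts →
      LinearIndependent ℝ z ∧ ∀ a, z a ∈ minSubspace α w := fun α => by
    by_cases hα : α ∈ T.verts
    · obtain ⟨z, hz⟩ := exists_linearIndependent_of_finrank_eq (hrank α hα)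
      exact ⟨z, fun _ => hz⟩
    · exact ⟨0, fun h => absurd h hα⟩
  choose z hz using hbas
  -- The leaf frames are prescribed by `L`, the root frame is `w` itself, and at the other non-leaf
  -- vertices any basis of the minimal subspace will do.
  obtain ⟨x, hx1, hx2⟩ := PartitionTree.exists_rec T (X := fun α => Fin (s α) → TS V α) y
    (fun μ _ _ => Function.update z Finset.univ (fun _ => w) μ) (fun _ _ _ _ _ => rfl)
  have hxw : ∀ a, x Finset.univ a = w := fun a => by
    rw [hx2 _ PartitionTree.univ_mem_inner, Function.update_self]
  have hx : ∀ α ∈ T.verts, LinearIndependent ℝ (x α) ∧ ∀ a, x α a ∈ minSubspace α w := by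
    intro α hα
    rcases PartitionTree.inner_or_leaf hα with h | ⟨k, rfl⟩
    · by_cases hu : α = Finset.univ
      · subst hu
        have : Unique (Fin (s Finset.univ)) := hs1 ▸ inferInstance
        refine ⟨linearIndependent_unique_iff.2 (by rwa [hxw]), fun a => ?_⟩
        rw [hxw, minSubspace_univ]
        exact Submodule.mem_span_singleton_self w
      · rw [hx2 α h, Function.update_of_ne hu]
        exact hz α hα
    · rw [hx1]
      exact ⟨hyli k, hymem k⟩
  have hspan : ∀ α ∈ T.verts, minSubspace α w = Submodule.span ℝ (Set.range (x α)) :=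
    fun α hα => span_eq_of_linearIndependent (hx α hα).1 (hx α hα).2 (hrank α hα)
  obtain ⟨A, hA⟩ := exists_dual_on_verts fun α hα => (hx α hα).1
  have hA' : ∀ μ ∈ T.inner, ∀ β ∈ T.sons μ, IsDualOn β x A := fun μ hμ β hβ =>
    hA β (PartitionTree.son_mem_verts hμ hβ)
  refine ⟨⟨L, dualCoeffs T x A⟩, isRegular_dualCoeffs (fun α hα => (hx α hα).1) hspan hA', ?_⟩
  rw [(isFrame_dualCoeffs hspan hA').treeParam_eq hs hs1 b ⟨L, dualCoeffs T x A⟩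
    (fun k a => by rw [hx1]; exact LinearEquiv.apply_symm_apply _ _) ⟨0, hs _⟩, hxw]

lemma treeParam_image [Nontrivial ι] {v : TS V Finset.univ} (hv : v ≠ 0)
    (hW : ∀ k, IsClosed (W k : Set (V k))) (hUW : ∀ k, IsCompl (leafMinSubspace k v) (W k))
    (b : ∀ k, Module.Basis (Fin (tbRank v {k})) ℝ (leafMinSubspace k v)) :
    treeParam (T := T) (s := tbRank v) (W := W) b '' {p | p.2.IsRegular} = chartDomain T v W := by
  have hs : ∀ α, 0 < tbRank v α := tbRank_pos hv
  have hs1 := tbRank_univ hv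
  ext w
  constructor
  · rintro ⟨p, hp, rfl⟩
    exact ⟨tbRank_treeParam hs hs1 hUW b hp, isCompl_leafMinSubspace_treeParam hs hs1 hUW b hp⟩
  · rintro ⟨h1, h2⟩
    exact exists_treeParam_eq hs hs1 hW hUW b h1 h2

end TreeTensor

namespace TreeTensor

/-! ### Normalized transfer tensors -/

lemma exists_right_inverse {n : ℕ} {Q : Type*} [Fintype Q] {c : Fin n → Q → ℝ}
    (hc : LinearIndependent ℝ c) :
    ∃ R : Fin n → Q → ℝ, ∀ a b, ∑ q, c a q * R b q = if a = b then 1 else 0 := by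
  classical
  obtain ⟨D, hD⟩ := exists_dual_family hc
  refine ⟨fun b q => D b (Pi.single q 1), fun a b => ?_⟩
  rw [← hD a b, LinearMap.pi_apply_eq_sum_univ (D b) (c a)]
  refine Finset.sum_congr rfl fun q _ => ?_
  rw [smul_eq_mul]
  have : (Pi.single q 1 : Q → ℝ) = fun j => if q = j then 1 else 0 := by
    funext j
    rw [Pi.single_apply]
    simp only [eq_comm]
  rw [← this]

universe u v

variable {ι : Type u} [Fintype ι] [DecidableEq ι]
  {V : ι → Type v} [∀ j, NormedAddCommGroup (V j)] [∀ j, NormedSpace ℝ (V j)]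
  {T : PartitionTree ι} {s : Finset ι → ℕ}

/-- Away from the root, the transfer tensors `C` have the right inverses `R`. -/
def Coeffs.IsNormalized (C R : Coeffs T s) : Prop :=
  ∀ μ : T.inner, (μ : Finset ι) ≠ Finset.univ → ∀ a b,
    ∑ q, C μ a q * R μ b q = if a = b then 1 else 0

/-- The direction of the affine space of transfer tensors that are normalized by `R`. -/
def slice (R : Coeffs T s) : Submodule ℝ (Coeffs T s) where
  carrier := {e | ∀ μ : T.inner, (μ : Finset ι) ≠ Finset.univ → ∀ a b, ∑ q, e μ a q * R μ b q = 0}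
  add_mem' {e e'} he he' μ hμ a b := by
    simp only [Pi.add_apply, add_mul, Finset.sum_add_distrib, he μ hμ a b, he' μ hμ a b, add_zero]
  zero_mem' μ _ a b := by simp
  smul_mem' r e he μ hμ a b := by
    simp only [Pi.smul_apply, smul_eq_mul, mul_assoc, ← Finset.mul_sum, he μ hμ a b, mul_zero]

lemma Coeffs.IsNormalized.add {R C : Coeffs T s} (hC : C.IsNormalized R) {e : Coeffs T s}
    (he : e ∈ slice R) : (C + e).IsNormalized R := fun μ hμ a b => by
  simp only [Pi.add_apply, add_mul, Finset.sum_add_distrib, hC μ hμ a b, he μ hμ a b, add_zero]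

lemma Coeffs.IsNormalized.sub_mem {R C C' : Coeffs T s} (hC : C.IsNormalized R)
    (hC' : C'.IsNormalized R) : C - C' ∈ slice R := fun μ hμ a b => by
  simp only [Pi.sub_apply, sub_mul, Finset.sum_sub_distrib, hC μ hμ a b, hC' μ hμ a b, sub_self]

lemma Coeffs.IsRegular.exists_isNormalized {C : Coeffs T s} (hC : C.IsRegular) :
    ∃ R : Coeffs T s, C.IsNormalized R := by
  choose R hR using fun μ : T.inner => exists_right_inverse (hC μ).1
  exact ⟨R, fun μ _ => hR μ⟩

lemma isOpen_isRegular : IsOpen {C : Coeffs T s | C.IsRegular} := by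
  have h : {C : Coeffs T s | C.IsRegular} =
      ⋂ μ : T.inner, ({C | LinearIndependent ℝ (C μ)} ∩ ⋂ β : T.sons μ,
        {C | LinearIndependent ℝ (fun a : Fin (s β) =>
          fun q : Fin (s μ) × (∀ δ : T.sons μ, Fin (s δ)) =>
            C μ q.1 (Function.update q.2 β a))}) := by
    ext C
    simp only [Coeffs.IsRegular, Set.mem_ofPred_eq, Set.mem_iInter, Set.mem_inter_iff]
  rw [h]
  refine isOpen_iInter_of_finite fun μ => IsOpen.inter ?_ (isOpen_iInter_of_finite fun β => ?_)
  · exact (isOpen_setOfPred_linearIndependent (𝕜 := ℝ) (ι := Fin (s μ))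
      (E := (∀ β : T.sons μ, Fin (s β)) → ℝ)).preimage (f := fun C : Coeffs T s => C μ)
      (continuous_apply μ)
  · refine isOpen_setOfPred_linearIndependent.preimage (f := fun (C : Coeffs T s) (a : Fin (s β))
      (q : Fin (s μ) × (∀ δ : T.sons μ, Fin (s δ))) => C μ q.1 (Function.update q.2 β a)) ?_
    fun_prop

/-- The linear forms `A^α_b` on `V_α` built from linear forms on the `V_k` and the matrices `R`. -/
structure IsDualForms (R : Coeffs T s) (ℓ : ∀ k, Fin (s {k}) → V k →L[ℝ] ℝ)
    (A : ∀ α : Finset ι, Fin (s α) → Module.Dual ℝ (TS V α)) : Prop where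
  leaf : ∀ k a, A {k} a = (ℓ k a : V k →ₗ[ℝ] ℝ) ∘ₗ (leafEquiv k).toLinearMap
  step : ∀ μ (hμ : μ ∈ T.inner) b,
    A μ b = ∑ q, R ⟨μ, hμ⟩ b q • sonsEval hμ (fun β => A β (q β))

lemma exists_isDualForms (R : Coeffs T s) (ℓ : ∀ k, Fin (s {k}) → V k →L[ℝ] ℝ) :
    ∃ A, IsDualForms R ℓ A := by
  obtain ⟨A, h1, h2⟩ := PartitionTree.exists_rec T
    (X := fun α => Fin (s α) → Module.Dual ℝ (TS V α))
    (fun k a => (ℓ k a : V k →ₗ[ℝ] ℝ) ∘ₗ (leafEquiv k).toLinearMap)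
    (fun μ hμ A b => ∑ q, R ⟨μ, hμ⟩ b q • sonsEval hμ (fun β => A β (q β)))
    (fun μ hμ A A' h => by
      funext b
      have : ∀ β : T.sons μ, A β = A' β := fun β => h β β.2
      simp only [this])
  exact ⟨A, fun k a => congrFun (h1 k) a, fun μ hμ b => congrFun (h2 μ hμ) b⟩

section DualForms

variable {R : Coeffs T s} {ℓ : ∀ k, Fin (s {k}) → V k →L[ℝ] ℝ}
  {A : ∀ α : Finset ι, Fin (s α) → Module.Dual ℝ (TS V α)}

lemma IsDualForms.isBdd (hA : IsDualForms R ℓ A) {N : TreeNorms T V}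
    (hinj : N.DominatesInjective) : ∀ α ∈ T.verts, ∀ b, N.IsBdd α (A α b) := by
  refine PartitionTree.leaf_induction (fun k a => ?_) fun μ hμ ih b => ?_
  · rw [hA.leaf]
    exact TreeNorms.isBdd_leaf (ℓ k a)
  · rw [hA.step μ hμ]
    exact TreeNorms.IsBdd.sum _ fun q _ =>
      (hinj.isBdd_sonsEval hμ fun β => ih β β.2 (q β)).smul _

lemma IsDualForms.apply_inner (hA : IsDualForms R ℓ A) {μ : Finset ι} (hμ : μ ∈ T.inner)
    (b : Fin (s μ)) (z : TS V μ) :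
    A μ b z = ∑ q, sonsEval hμ (fun β => A β (q β)) z * R ⟨μ, hμ⟩ b q := by
  rw [hA.step μ hμ, LinearMap.sum_apply]
  refine Finset.sum_congr rfl fun q _ => ?_
  rw [LinearMap.smul_apply, smul_eq_mul, mul_comm]

/-- Normalization is designed for this: once the sons' forms are dual to their frames, `A μ b (x μ
a)` equals `∑ C_{a,q} R_{b,q}`, which normalization makes the identity matrix. The root is left
free, its frame being the tensor itself. -/
lemma IsDualForms.isDualOn (hA : IsDualForms R ℓ A) {C : Coeffs T s} (hC : C.IsNormalized R)
    {x : ∀ α : Finset ι, Fin (s α) → TS V α} (hx : IsFrame C x)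
    (hleaf : ∀ k a b, ℓ k b (leafEquiv k (x {k} a)) = if a = b then 1 else 0) :
    ∀ α ∈ T.verts, α ≠ Finset.univ → IsDualOn α x A := by
  refine PartitionTree.leaf_induction (fun k _ a b => ?_) fun μ hμ ih hne a b => ?_
  · rw [hA.leaf]
    exact hleaf k a b
  · rw [hA.apply_inner hμ]
    simp only [hx.sonsEval_dual hμ fun β hβ => ih β hβ (PartitionTree.son_ne_univ hμ hβ)]
    exact hC ⟨μ, hμ⟩ hne a b

lemma IsDualForms.isNormalized_dualCoeffs (hA : IsDualForms R ℓ A)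
    {x : ∀ α : Finset ι, Fin (s α) → TS V α}
    (hx : ∀ α ∈ T.verts, α ≠ Finset.univ → IsDualOn α x A) :
    (dualCoeffs T x A).IsNormalized R := fun μ hμ a b => by
  rw [← hx μ (T.mem_verts_of_inner μ.2) hμ a b, hA.apply_inner μ.2]
  rfl

end DualForms

/-! ### Analytic dependence of normalized frames -/

section Analytic

lemma analyticAt_det {Y : Type*} [NormedAddCommGroup Y] [NormedSpace ℝ Y] {n : ℕ}
    {F : Y → Matrix (Fin n) (Fin n) ℝ} {y : Y} (hF : ∀ a b, AnalyticAt ℝ (fun y => F y a b) y) :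
    AnalyticAt ℝ (fun y => (F y).det) y := by
  simp only [Matrix.det_apply']
  exact Finset.analyticAt_fun_sum _ fun σ _ => analyticAt_const.mul
    (Finset.analyticAt_fun_prod _ fun i _ => hF (σ i) i)

/-- Cramer's rule: the entries of the inverse are quotients of polynomials in the entries. -/
lemma analyticAt_matrix_inv {Y : Type*} [NormedAddCommGroup Y] [NormedSpace ℝ Y] {n : ℕ}
    {F : Y → Matrix (Fin n) (Fin n) ℝ} {y : Y} (hF : ∀ a b, AnalyticAt ℝ (fun y => F y a b) y)
    (hdet : (F y).det ≠ 0) (a b : Fin n) : AnalyticAt ℝ (fun y => (F y)⁻¹ a b) y := by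
  simp only [Matrix.inv_def, Matrix.smul_apply, smul_eq_mul, Ring.inverse_eq_inv',
    Matrix.adjugate_apply]
  refine ((analyticAt_det hF).inv hdet).mul (analyticAt_det fun c d => ?_)
  by_cases h : c = b
  · simp only [Matrix.updateRow_apply, h, if_true]
    exact analyticAt_const
  · simp only [Matrix.updateRow_apply, h, if_false]
    exact hF c d

variable {N : TreeNorms T V} {Y : Type*} [NormedAddCommGroup Y] [NormedSpace ℝ Y]
  {J : TS V Finset.univ →ₗ[ℝ] Y}

/-- The bounded entries extend to the completion, and `O` is the open set where the extended
determinant is nonzero. The last clause places the base point in `O`, where the matrix is the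
identity. -/
lemma exists_analytic_inverse (hJ : ∀ x, ‖J x‖ = N.nrm Finset.univ x) (hJd : DenseRange J)
    {n : ℕ} (f : Fin n → Fin n → TS V Finset.univ →ₗ[ℝ] ℝ)
    (hf : ∀ a b, ∃ c : ℝ, ∀ w, ‖f a b w‖ ≤ c * N.nrm Finset.univ w) :
    ∃ (O : Set Y) (m : Fin n → Fin n → Y → ℝ), IsOpen O ∧
      (∀ a b, AnalyticOnNhd ℝ (m a b) O) ∧
      (∀ w, J w ∈ O → ∀ a c, ∑ b, m a b (J w) * f b c w = if a = c then 1 else 0) ∧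
      ∀ w, (∀ a b, f a b w = if a = b then 1 else 0) → J w ∈ O := by
  choose g hg using fun a b => exists_extension hJ hJd (f a b) (hf a b)
  let F : Y → Matrix (Fin n) (Fin n) ℝ := fun y => Matrix.of fun a b => g a b y
  have hF : ∀ y a b, AnalyticAt ℝ (fun y => F y a b) y := fun y a b => (g a b).analyticAt y
  have hFc : Continuous fun y => (F y).det :=
    Continuous.matrix_det (continuous_matrix fun a b => (g a b).continuous)
  refine ⟨{y | (F y).det ≠ 0}, fun a b y => (F y)⁻¹ a b, isOpen_ne_fun hFc continuous_const,
    fun a b y hy => analyticAt_matrix_inv (hF y) hy a b, fun w hw a c => ?_, fun w hw => ?_⟩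
  · have h := congrFun (congrFun (Matrix.nonsing_inv_mul (F (J w)) (isUnit_iff_ne_zero.2 hw)) a) c
    rw [Matrix.mul_apply, Matrix.one_apply] at h
    simpa only [F, Matrix.of_apply, hg] using h
  · have : F (J w) = 1 := by
      ext a b
      rw [Matrix.one_apply, ← hw a b, ← hg a b w]
      rfl
    rw [Set.mem_ofPred_eq, this, Matrix.det_one]
    exact one_ne_zero

/-- Analytic families of frames of the minimal subspaces, normalized by the linear forms `A`. -/
lemma exists_analytic_frames (hinj : N.DominatesInjective)
    (hJ : ∀ x, ‖J x‖ = N.nrm Finset.univ x) (hJd : DenseRange J) (hs1 : s Finset.univ = 1)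
    {A : ∀ α : Finset ι, Fin (s α) → Module.Dual ℝ (TS V α)}
    (hA : ∀ α ∈ T.verts, ∀ b, N.IsBdd α (A α b)) {w₀ : TS V Finset.univ}
    {x₀ : ∀ α : Finset ι, Fin (s α) → TS V α}
    (hx₀ : ∀ α ∈ T.verts, ∀ a, x₀ α a ∈ minSubspace α w₀)
    (hAx₀ : ∀ α ∈ T.verts, α ≠ Finset.univ → IsDualOn α x₀ A) :
    ∃ (O : Set Y) (Γ : ∀ α : Finset ι, Fin (s α) → TS V Finset.univ →ₗ[ℝ] TS V α)
      (m : ∀ α : Finset ι, Fin (s α) → Fin (s α) → Y → ℝ), IsOpen O ∧ J w₀ ∈ O ∧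
      (∀ α a b, AnalyticOnNhd ℝ (m α a b) O) ∧
      (∀ α ∈ T.verts, ∀ a, ∃ c : ℝ, 0 ≤ c ∧ ∀ w, N.nrm α (Γ α a w) ≤ c * N.nrm Finset.univ w) ∧
      (∀ w, ∀ α ∈ T.verts, ∀ a, Γ α a w ∈ minSubspace α w) ∧
      (∀ w, J w ∈ O → ∀ α ∈ T.verts, α ≠ Finset.univ → ∀ a c,
        A α c (∑ b, m α a b (J w) • Γ α b w) = if a = c then 1 else 0) ∧
      ∀ w a, ∑ b, m Finset.univ a b (J w) • Γ Finset.univ b w = w := by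
  have h : ∀ α : Finset ι, ∃ (O : Set Y) (Γ : Fin (s α) → TS V Finset.univ →ₗ[ℝ] TS V α)
      (m : Fin (s α) → Fin (s α) → Y → ℝ), IsOpen O ∧ J w₀ ∈ O ∧
      (∀ a b, AnalyticOnNhd ℝ (m a b) O) ∧
      (α ∈ T.verts → ∀ a, ∃ c : ℝ, 0 ≤ c ∧ ∀ w, N.nrm α (Γ a w) ≤ c * N.nrm Finset.univ w) ∧
      (∀ w, α ∈ T.verts → ∀ a, Γ a w ∈ minSubspace α w) ∧
      (∀ w, J w ∈ O → α ∈ T.verts → α ≠ Finset.univ → ∀ a c,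
        A α c (∑ b, m a b (J w) • Γ b w) = if a = c then 1 else 0) := by
    intro α
    by_cases hα : α ∈ T.verts ∧ α ≠ Finset.univ
    · obtain ⟨hα, hne⟩ := hα
      choose Γ hΓ0 hΓm hΓb using fun a => hinj.exists_bounded_section hα (hx₀ α hα a)
      obtain ⟨O, m, hO, hm, hm1, hm2⟩ := exists_analytic_inverse hJ hJd
        (fun a b => A α b ∘ₗ Γ a) fun a b => by
          obtain ⟨c, hc, hle⟩ := hA α hα b
          obtain ⟨d, hd, hdle⟩ := hΓb a
          refine ⟨c * d, fun w => (hle _).trans ?_⟩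
          rw [mul_assoc]
          exact mul_le_mul_of_nonneg_left (hdle w) hc.le
      refine ⟨O, Γ, m, hO, hm2 w₀ fun a b => ?_, hm, fun _ => hΓb, fun w _ a => hΓm a w,
        fun w hw _ _ a c => ?_⟩
      · rw [LinearMap.comp_apply, hΓ0]
        exact hAx₀ α hα hne a b
      · rw [map_sum, ← hm1 w hw a c]
        refine Finset.sum_congr rfl fun b _ => ?_
        rw [map_smul, smul_eq_mul]
        rfl
    · refine ⟨Set.univ, 0, 0, isOpen_univ, Set.mem_univ _, fun a b y _ => analyticAt_const,
        fun _ a => ⟨0, le_rfl, fun w => by simp⟩, fun w _ a => Submodule.zero_mem _,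
        fun w _ h1 h2 => absurd ⟨h1, h2⟩ hα⟩
  choose O Γ m hO hw₀ hm hb hmem hdual using h
  have hne : ∀ α : Finset ι, α ≠ Finset.univ →
      Function.update Γ Finset.univ (fun _ => LinearMap.id) α = Γ α ∧
      Function.update m Finset.univ (fun _ _ _ => 1) α = m α := fun α hα =>
    ⟨Function.update_of_ne hα _ _, Function.update_of_ne hα _ _⟩
  refine ⟨⋂ α, O α, Function.update Γ Finset.univ (fun _ => LinearMap.id),
    Function.update m Finset.univ (fun _ _ _ => 1), isOpen_iInter_of_finite hO,
    Set.mem_iInter.2 hw₀, fun α a b => ?_, fun α hα a => ?_, fun w α hα a => ?_,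
    fun w hw α hα hu a c => ?_, fun w a => ?_⟩
  · by_cases hu : α = Finset.univ
    · subst hu
      rw [Function.update_self]
      exact fun y _ => analyticAt_const
    · rw [(hne α hu).2]
      exact (hm α a b).mono (Set.iInter_subset _ α)
  · by_cases hu : α = Finset.univ
    · subst hu
      rw [Function.update_self]
      exact ⟨1, zero_le_one, fun w => by rw [one_mul]; rfl⟩
    · rw [(hne α hu).1]
      exact hb α hα a
  · by_cases hu : α = Finset.univ
    · subst hu
      rw [Function.update_self, minSubspace_univ]
      exact Submodule.mem_span_singleton_self w
    · rw [(hne α hu).1]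
      exact hmem α w hα a
  · rw [(hne α hu).1, (hne α hu).2]
    exact hdual α w (Set.mem_iInter.1 hw α) hα hu a c
  · rw [Function.update_self, Function.update_self]
    have : Unique (Fin (s Finset.univ)) := hs1 ▸ inferInstance
    rw [Fintype.sum_unique, one_smul]
    rfl

lemma exists_analytic_apply_frame (hJ : ∀ x, ‖J x‖ = N.nrm Finset.univ x) (hJd : DenseRange J)
    {F : Type*} [NormedAddCommGroup F] [NormedSpace ℝ F] [CompleteSpace F] {O : Set Y} {n : ℕ}
    {α : Finset ι} {Γ : Fin n → TS V Finset.univ →ₗ[ℝ] TS V α} {m : Fin n → Y → ℝ}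
    (hm : ∀ b, AnalyticOnNhd ℝ (m b) O)
    (hΓ : ∀ b, ∃ c : ℝ, 0 ≤ c ∧ ∀ w, N.nrm α (Γ b w) ≤ c * N.nrm Finset.univ w)
    (f : TS V α →ₗ[ℝ] F) {c : ℝ} (hc : 0 ≤ c) (hf : ∀ z, ‖f z‖ ≤ c * N.nrm α z) :
    ∃ h : Y → F, AnalyticOnNhd ℝ h O ∧ ∀ w, h (J w) = f (∑ b, m b (J w) • Γ b w) := by
  choose g hg using fun b => exists_extension hJ hJd (f ∘ₗ Γ b) (by
    obtain ⟨d, hd, hle⟩ := hΓ b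
    refine ⟨c * d, fun w => (hf _).trans ?_⟩
    rw [mul_assoc]
    exact mul_le_mul_of_nonneg_left (hle w) hc)
  refine ⟨fun y => ∑ b, m b y • g b y, fun y hy => ?_, fun w => ?_⟩
  · exact Finset.analyticAt_fun_sum _ fun b _ => (hm b y hy).smul ((g b).analyticAt y)
  · rw [map_sum]
    refine Finset.sum_congr rfl fun b _ => ?_
    rw [map_smul, hg]
    rfl

end Analytic

end TreeTensor

/-! ### Local models on a stratum of constant rank -/

namespace TreeTensor

universe u v

variable {ι : Type u} [Fintype ι] [DecidableEq ι]
  {V : ι → Type v} [∀ j, NormedAddCommGroup (V j)] [∀ j, NormedSpace ℝ (V j)]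
  {T : PartitionTree ι} {s : Finset ι → ℕ} {U W : ∀ k, Submodule ℝ (V k)}

lemma ne_zero_of_tbRank (hs1 : s Finset.univ = 1) {w : TS V Finset.univ}
    (hw : ∀ α ∈ T.verts, tbRank w α = s α) : w ≠ 0 := by
  rintro rfl
  have := hw _ T.root_mem
  rw [tbRank_zero, hs1] at this
  exact zero_ne_one this

lemma linearIndependent_and_span (hs1 : s Finset.univ = 1) {w : TS V Finset.univ}
    (hw : ∀ α ∈ T.verts, tbRank w α = s α) {x : ∀ α : Finset ι, Fin (s α) → TS V α}
    {A : ∀ α : Finset ι, Fin (s α) → Module.Dual ℝ (TS V α)}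
    (hmem : ∀ α ∈ T.verts, ∀ a, x α a ∈ minSubspace α w)
    (hA : ∀ α ∈ T.verts, α ≠ Finset.univ → IsDualOn α x A) (hroot : ∀ a, x Finset.univ a = w) :
    ∀ α ∈ T.verts, LinearIndependent ℝ (x α) ∧
      minSubspace α w = Submodule.span ℝ (Set.range (x α)) := by
  intro α hα
  have hli : LinearIndependent ℝ (x α) := by
    by_cases hu : α = Finset.univ
    · subst hu
      have : Unique (Fin (s Finset.univ)) := hs1 ▸ inferInstance
      rw [linearIndependent_unique_iff, hroot]
      exact ne_zero_of_tbRank hs1 hw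
    · exact linearIndependent_of_dual_family (hA α hα hu)
  exact ⟨hli, span_eq_of_linearIndependent hli (hmem α hα) (hw α hα)⟩

omit [Fintype ι] [DecidableEq ι] in
/-- Coordinates on the spaces of linear maps `U_k → W_k`. -/
lemma exists_leafMap [∀ k, FiniteDimensional ℝ (U k)]
    (b : ∀ k, Module.Basis (Fin (s {k})) ℝ (U k)) :
    ∃ S : ∀ k, Fin (s {k}) → W k → (U k →L[ℝ] W k), (∀ k c z, AnalyticAt ℝ (S k c) z) ∧
      (∀ k (z : Fin (s {k}) → W k) a, (∑ c, S k c (z c)) (b k a) = z a) ∧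
      ∀ k (L : U k →L[ℝ] W k), ∑ c, S k c (L (b k c)) = L := by
  have h : ∀ k (z : Fin (s {k}) → W k) a, (∑ c, ContinuousLinearMap.smulRightL ℝ (U k) (W k)
      (LinearMap.toContinuousLinearMap ((b k).coord c)) (z c)) (b k a) = z a := by
    intro k z a
    rw [sum_apply, Finset.sum_eq_single a]
    · simp
    · intro c _ hca
      simp [Finsupp.single_eq_of_ne hca]
    · simp
  refine ⟨fun k c => ContinuousLinearMap.smulRightL ℝ (U k) (W k)
    (LinearMap.toContinuousLinearMap ((b k).coord c)), fun k c z => ?_, h, fun k L => ?_⟩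
  · exact (ContinuousLinearMap.smulRightL ℝ (U k) (W k)
      (LinearMap.toContinuousLinearMap ((b k).coord c))).analyticAt z
  · exact ContinuousLinearMap.coe_injective ((b k).ext fun a => h k _ a)

variable {N : TreeNorms T V} {Y : Type*} [NormedAddCommGroup Y] [NormedSpace ℝ Y]
  {J : TS V Finset.univ →ₗ[ℝ] Y}

/-- Near each of its values, `treeParam` restricted to a slice is a local model. -/
theorem exists_localModel [Nontrivial ι] [∀ j, CompleteSpace (V j)]
    (hcont : N.TensorMapContinuous) (hinj : N.DominatesInjective)
    (hJ : ∀ x, ‖J x‖ = N.nrm Finset.univ x) (hJd : DenseRange J)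
    (hs : ∀ α, 0 < s α) (hs1 : s Finset.univ = 1) [∀ k, FiniteDimensional ℝ (U k)]
    (hW : ∀ k, IsClosed (W k : Set (V k))) (hUW : ∀ k, IsCompl (U k) (W k))
    (b : ∀ k, Module.Basis (Fin (s {k})) ℝ (U k)) {p₀ : (∀ k, U k →L[ℝ] W k) × Coeffs T s}
    (hp₀ : p₀.2.IsRegular) :
    ∃ (m : LocalModel J {w | ∀ α ∈ T.verts, tbRank w α = s α})
      (σ : m.E → (∀ k, U k →L[ℝ] W k) × Coeffs T s) (e₀ : m.E),
      e₀ ∈ m.Ω ∧ σ e₀ = p₀ ∧ DifferentiableAt ℝ σ e₀ ∧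
      ∀ e ∈ m.Ω, treeParam b (σ e) = m.Φ e ∧ (σ e).2.IsRegular := by
  have hsing : ∀ k : ι, ({k} : Finset ι) ≠ Finset.univ := fun k h => by
    obtain ⟨j, hj⟩ := exists_ne k
    exact hj (Finset.mem_singleton.1 (h ▸ Finset.mem_univ j))
  have hWc : ∀ k, CompleteSpace (W k) := fun k => (hW k).completeSpace_coe
  choose P Q hPu hPw hQu hQw hPQ using fun k => exists_projections (hW k) (hUW k)
  obtain ⟨S, hSa, hS, hSL⟩ := exists_leafMap (W := W) b
  -- Coordinates of the projection onto `U_k` along `W_k`. They do not see `L_k`, so the leaf frames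
  -- of all parameters are dual to them, and a vector dual to them is `u_a` plus its
  -- `W_k`-component.
  let ℓ : ∀ k, Fin (s {k}) → V k →L[ℝ] ℝ := fun k a =>
    (LinearMap.toContinuousLinearMap ((b k).coord a)).comp (P k)
  have hℓ : ∀ k c a (y : W k), ℓ k c ((b k a : V k) + (y : V k)) = if a = c then 1 else 0 := by
    intro k c a y
    simp only [ℓ, ContinuousLinearMap.comp_apply, hPu, hPw, map_add, map_zero, add_zero]
    rw [LinearMap.coe_toContinuousLinearMap', Module.Basis.coord_apply, Module.Basis.repr_self, Finsupp.single_apply]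
  have hℓ' : ∀ k a (z : V k), (∀ c, ℓ k c z = if a = c then 1 else 0) →
      z = (b k a : V k) + (Q k z : V k) := by
    intro k a z hz
    have : P k z = b k a := by
      refine (b k).ext_elem fun c => ?_
      rw [Module.Basis.repr_self, Finsupp.single_apply]
      exact hz c
    rw [← this, hPQ]
  obtain ⟨R, hR⟩ := hp₀.exists_isNormalized
  obtain ⟨A, hA⟩ := exists_isDualForms (T := T) R ℓ
  have hdual : ∀ {p : (∀ k, U k →L[ℝ] W k) × Coeffs T s}, p.2.IsNormalized R →
      ∀ {x : ∀ α : Finset ι, Fin (s α) → TS V α}, IsFrame p.2 x →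
      (∀ k a, leafEquiv k (x {k} a) = (b k a : V k) + (p.1 k (b k a) : V k)) →
      ∀ α ∈ T.verts, α ≠ Finset.univ → IsDualOn α x A := fun hp x hx hleaf =>
    hA.isDualOn hp hx fun k a c => by rw [hleaf, hℓ]
  obtain ⟨x₀, hx₀, hleaf₀, -, -, hspan₀⟩ := exists_frame_treeParam hs hs1 hUW b hp₀
  obtain ⟨O, Γ, m, hO, hO₀, hm, hΓ, hΓm, hmA, hmroot⟩ := exists_analytic_frames hinj hJ hJd hs1
    (hA.isBdd hinj) (w₀ := treeParam b p₀) (x₀ := x₀)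
    (fun α hα a => hspan₀ α hα ▸ Submodule.subset_span ⟨a, rfl⟩) (hdual hR hx₀ hleaf₀)
  -- The normalized frames of `w`, dual to `A` away from the root when `J w ∈ O`.
  let X : TS V Finset.univ → ∀ α : Finset ι, Fin (s α) → TS V α := fun w α a =>
    ∑ c, m α a c (J w) • Γ α c w
  have hXm : ∀ w, ∀ α ∈ T.verts, ∀ a, X w α a ∈ minSubspace α w := fun w α hα a =>
    Submodule.sum_mem _ fun c _ => Submodule.smul_mem _ _ (hΓm w α hα c)
  have hXA : ∀ w, J w ∈ O → ∀ α ∈ T.verts, α ≠ Finset.univ → IsDualOn α (X w) A := hmA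
  choose h hh hhX using fun k a => exists_analytic_apply_frame hJ hJd (hm {k} a)
    (hΓ {k} (T.singleton_mem k)) (leafEquiv k).toLinearMap zero_le_one
    (fun z => by rw [one_mul, N.leaf]; rfl)
  have hbdd : ∀ (μ : T.inner) (q : ∀ β : T.sons μ, Fin (s β)),
      N.IsBdd μ (sonsEval μ.2 fun β => A β (q β)) := fun μ q =>
    hinj.isBdd_sonsEval μ.2 fun β =>
      hA.isBdd hinj β (PartitionTree.son_mem_verts μ.2 β.2) (q β)
  choose d hd hdle using hbdd
  choose g hg hgX using fun (μ : T.inner) (a : Fin (s μ)) (q : ∀ β : T.sons μ, Fin (s β)) =>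
    exists_analytic_apply_frame hJ hJd (hm μ a) (hΓ μ (T.mem_verts_of_inner μ.2))
      (sonsEval μ.2 fun β => A β (q β)) (hd μ q).le (hdle μ q)
  have hgC : ∀ w, (fun μ a q => g μ a q (J w)) = dualCoeffs T (X w) A := fun w => by
    funext μ a q
    exact hgX μ a q w
  -- `G` is defined on all of `Y`, where the difference from `p₀.2` need not lie in the slice, so it
  -- is projected there. For `w` in the stratum with `J w ∈ O` both transfer tensors are normalized
  -- and `π` changes nothing.
  obtain ⟨π, hπ⟩ := (Submodule.ClosedComplemented.of_finiteDimensional (slice R))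
  let σ : (∀ k, U k →L[ℝ] W k) × slice R → (∀ k, U k →L[ℝ] W k) × Coeffs T s := fun e =>
    (e.1, p₀.2 + (e.2 : Coeffs T s))
  have hσ : ∀ e, AnalyticAt ℝ σ e := fun e => analyticAt_fst.prod
    (analyticAt_const.add (((slice R).subtypeL.analyticAt _).fun_comp analyticAt_snd))
  have hΦ : ∀ e, AnalyticAt ℝ (J ∘ fun e => treeParam b (σ e)) e := fun e =>
    AnalyticAt.comp (g := J ∘ treeParam b) (analyticAt_treeParam hcont hJ b (σ e)) (hσ e)
  have hOr : ∀ e : (∀ k, U k →L[ℝ] W k) × slice R, (σ e).2.IsNormalized R := fun e =>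
    hR.add e.2.2
  -- The `W_k`-components of the leaf frame vectors give `L_k`; the dual forms on the frames of the
  -- non-leaf vertices give the transfer tensors.
  let G : Y → (∀ k, U k →L[ℝ] W k) × slice R := fun y =>
    (fun k => ∑ a, S k a (Q k (h k a y)), π (fun μ a q => g μ a q y - p₀.2 μ a q))
  have hG : AnalyticOnNhd ℝ G O := fun y hy => by
    refine AnalyticAt.prod (analyticAt_pi_iff.2 fun k => ?_) ?_
    · exact Finset.analyticAt_fun_sum _ fun a _ =>
        AnalyticAt.fun_comp (g := S k a) (hSa k a _)
          (AnalyticAt.fun_comp (g := Q k) ((Q k).analyticAt _) (hh k a y hy))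
    · exact (π.analyticAt _).fun_comp (analyticAt_pi_iff.2 fun μ => analyticAt_pi_iff.2 fun a =>
        analyticAt_pi_iff.2 fun q => (hg μ a q y hy).sub analyticAt_const)
  have hσG : ∀ w, (∀ α ∈ T.verts, tbRank w α = s α) → J w ∈ O →
      (σ (G (J w))).2 = dualCoeffs T (X w) A ∧ (σ (G (J w))).2.IsRegular ∧
        treeParam b (σ (G (J w))) = w := by
    intro w hw hwO
    have hroot : ∀ a, X w Finset.univ a = w := hmroot w
    have hLS := linearIndependent_and_span hs1 hw (hXm w) (hXA w hwO) hroot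
    have hAs : ∀ μ ∈ T.inner, ∀ β ∈ T.sons μ, IsDualOn β (X w) A := fun μ hμ β hβ =>
      hXA w hwO β (PartitionTree.son_mem_verts hμ hβ) (PartitionTree.son_ne_univ hμ hβ)
    have hC : (σ (G (J w))).2 = dualCoeffs T (X w) A := by
      have hmem := (hA.isNormalized_dualCoeffs (hXA w hwO)).sub_mem hR
      have : (G (J w)).2 = ⟨_, hmem⟩ := by
        rw [← hπ ⟨_, hmem⟩]
        exact congrArg (fun C => π (C - p₀.2)) (hgC w)
      change p₀.2 + ((G (J w)).2 : Coeffs T s) = _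
      rw [this]
      exact add_sub_cancel _ _
    refine ⟨hC, hC ▸ isRegular_dualCoeffs (fun α hα => (hLS α hα).1) (fun α hα => (hLS α hα).2) hAs,
      ?_⟩
    have hF : IsFrame (σ (G (J w))).2 (X w) :=
      hC ▸ isFrame_dualCoeffs (fun α hα => (hLS α hα).2) hAs
    rw [hF.treeParam_eq hs hs1 b (σ (G (J w))) (fun k a => ?_) ⟨0, hs _⟩, hroot]
    change _ = (b k a : V k) + (((∑ c, S k c (Q k (h k c (J w)))) (b k a) : W k) : V k)
    rw [hS, hhX]
    refine hℓ' k a _ fun c => ?_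
    have := hXA w hwO {k} (T.singleton_mem k) (hsing k) a c
    rw [hA.leaf] at this
    exact this
  let M : LocalModel J {w | ∀ α ∈ T.verts, tbRank w α = s α} :=
    { E := (∀ k, U k →L[ℝ] W k) × slice R
      Φ := fun e => treeParam b (σ e)
      Ω := {e | (σ e).2.IsRegular} ∩ (J ∘ fun e => treeParam b (σ e)) ⁻¹' O
      O := O
      G := G
      isOpen_Ω := (isOpen_isRegular.preimage (continuous_snd.comp
        (continuous_iff_continuousAt.2 fun e => (hσ e).continuousAt))).inter
        (hO.preimage (continuous_iff_continuousAt.2 fun e => (hΦ e).continuousAt))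
      isOpen_O := hO
      analytic_Φ := fun e _ => hΦ e
      analytic_G := hG
      mem_str := fun e he => tbRank_treeParam hs hs1 hUW b he.1
      mem_O := fun e he => he.2
      left_inv := ?_
      mem_Ω := fun w hw hwO => ⟨(hσG w hw hwO).2.1, by
        change J (treeParam b (σ (G (J w)))) ∈ O
        rwa [(hσG w hw hwO).2.2]⟩
      right_inv := fun w hw hwO => (hσG w hw hwO).2.2 }
  · refine ⟨M, σ, (p₀.1, 0), ⟨?_, ?_⟩, ?_, (hσ _).differentiableAt, fun e he => ⟨rfl, he.1⟩⟩
    · change (p₀.2 + 0).IsRegular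
      rwa [add_zero]
    · change J (treeParam b (p₀.1, p₀.2 + 0)) ∈ O
      rwa [add_zero]
    · exact Prod.ext rfl (add_zero _)
  · rintro e ⟨he, heO⟩
    obtain ⟨x, hx, hleaf, hroot, -, hspan⟩ := exists_frame_treeParam hs hs1 hUW b he
    set w := treeParam b (σ e) with hw
    have hxA := hdual (hOr e) hx hleaf
    -- Uniqueness of dual frames: away from the root, `X w α` and `x α` lie in the same space
    -- spanned by `x α` and are both dual to `A`.
    have key : ∀ α ∈ T.verts, ∀ a, X w α a = x α a := by
      intro α hα a
      by_cases hu : α = Finset.univ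
      · subst hu
        exact (hmroot w a).trans (hroot a)
      · have hmem := hspan α hα ▸ hXm w α hα a
        rw [eq_sum_of_dual_family (hxA α hα hu) hmem]
        simp [fun c => hXA w heO α hα hu a c]
    refine Prod.ext (funext fun k => ?_) ?_
    · rw [← hSL k (e.1 k)]
      change ∑ c, S k c (Q k (h k c (J w))) = _
      refine Finset.sum_congr rfl fun c _ => congrArg (S k c) ?_
      rw [hhX]
      change Q k (leafEquiv k (X w {k} c)) = _
      rw [key {k} (T.singleton_mem k), hleaf, map_add, hQu, hQw, zero_add]
    · refine Eq.trans ?_ (hπ e.2)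
      refine congrArg π (funext fun μ => funext fun a => funext fun q => ?_)
      have h1 := hgX μ a q w
      change _ = sonsEval μ.2 (fun β => A β (q β)) (X w μ a) at h1
      rw [key μ (T.mem_verts_of_inner μ.2), hx.sonsEval_dual μ.2 fun β hβ =>
        hxA β (PartitionTree.son_mem_verts μ.2 hβ) (PartitionTree.son_ne_univ μ.2 hβ)] at h1
      exact sub_eq_of_eq_add' h1

end TreeTensor

/-! ### The atlas on the tensors of bounded rank -/

namespace TreeTensor

universe u v

variable {ι : Type u} [Fintype ι] [DecidableEq ι]
  {V : ι → Type v} [∀ j, NormedAddCommGroup (V j)] [∀ j, NormedSpace ℝ (V j)]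
  {T : PartitionTree ι} {r : Finset ι → ℕ}

/-- The data of a local parametrization of `FT_{≤ r}` near a tensor `treeParam b p`. -/
structure ParamPoint (T : PartitionTree ι) (V : ι → Type v) [∀ j, NormedAddCommGroup (V j)]
    [∀ j, NormedSpace ℝ (V j)] (r : Finset ι → ℕ) where
  v : TS V Finset.univ
  mem : v ∈ boundedRank V T r
  ne_zero : v ≠ 0
  W : ∀ k, Submodule ℝ (V k)
  isClosed : ∀ k, IsClosed (W k : Set (V k))
  isCompl : ∀ k, IsCompl (leafMinSubspace k v) (W k)
  b : ∀ k, Module.Basis (Fin (tbRank v {k})) ℝ (leafMinSubspace k v)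
  p : (∀ k, leafMinSubspace k v →L[ℝ] W k) × Coeffs T (tbRank v)
  isRegular : p.2.IsRegular

/-- The stratum of the tensors of the same tree-based rank as `v`. -/
def stratum (T : PartitionTree ι) (v : TS V Finset.univ) : Set (TS V Finset.univ) :=
  {w | ∀ α ∈ T.verts, tbRank w α = tbRank v α}

lemma mem_stratum_self (v : TS V Finset.univ) : v ∈ stratum T v := fun _ _ => rfl

lemma stratum_eq {v v' : TS V Finset.univ} (h : (stratum T v ∩ stratum T v').Nonempty) :
    stratum T v = stratum T v' := by
  obtain ⟨w, hw, hw'⟩ := h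
  have : ∀ α ∈ T.verts, tbRank v α = tbRank v' α := fun α hα => (hw α hα).symm.trans (hw' α hα)
  ext z
  exact forall₂_congr fun α hα => by rw [this α hα]

lemma stratum_subset {v : TS V Finset.univ} (hv : v ∈ boundedRank V T r) :
    stratum T v ⊆ boundedRank V T r := fun _ hw α hα => (hw α hα).trans_le (hv α hα)

lemma stratum_zero : stratum T (0 : TS V Finset.univ) = {0} := by
  ext w
  refine ⟨fun hw => ?_, fun hw => hw ▸ mem_stratum_self w⟩
  by_contra h
  have h1 := hw _ T.root_mem
  rw [tbRank_univ h, tbRank_zero] at h1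
  exact one_ne_zero h1

lemma zero_mem_boundedRank : (0 : TS V Finset.univ) ∈ boundedRank V T r := fun α _ => by
  rw [tbRank_zero]
  exact Nat.zero_le _

lemma finrank_leafMinSubspace (k : ι) (v : TS V Finset.univ) :
    Module.finrank ℝ (leafMinSubspace k v) = tbRank v {k} :=
  ((leafEquiv k).submoduleMap (minSubspace {k} v)).finrank_eq.symm

lemma exists_paramPoint [Nontrivial ι] {x : TS V Finset.univ} (hx : x ∈ boundedRank V T r)
    (hx0 : x ≠ 0) : ∃ c : ParamPoint T V r, c.v = x ∧ treeParam c.b c.p = x := by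
  choose W hW hUW using fun k =>
    (Submodule.ClosedComplemented.of_finiteDimensional
      (leafMinSubspace k x)).exists_isClosed_isCompl
  let b : ∀ k, Module.Basis (Fin (tbRank x {k})) ℝ (leafMinSubspace k x) := fun k =>
    Module.finBasisOfFinrankEq ℝ _ (finrank_leafMinSubspace k x)
  have hmem : x ∈ chartDomain T x W := ⟨fun _ _ => rfl, hUW⟩
  rw [← treeParam_image hx0 hW hUW b] at hmem
  obtain ⟨p, hp, hpx⟩ := hmem
  exact ⟨⟨x, hx, hx0, W, hW, hUW, b, p, hp⟩, rfl, hpx⟩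

variable {N : TreeNorms T V} {Y : Type*} [NormedAddCommGroup Y] [NormedSpace ℝ Y]
  {J : TS V Finset.univ →ₗ[ℝ] Y}

/-- The isolated point `0` as a local model. -/
def zeroModel (J : TS V Finset.univ →ₗ[ℝ] Y) : LocalModel J (stratum T (0 : TS V Finset.univ)) where
  E := PUnit
  Φ _ := 0
  Ω := Set.univ
  O := Set.univ
  G _ := PUnit.unit
  isOpen_Ω := isOpen_univ
  isOpen_O := isOpen_univ
  analytic_Φ _ _ := analyticAt_const
  analytic_G _ _ := analyticAt_const
  mem_str _ _ := mem_stratum_self 0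
  mem_O _ _ := Set.mem_univ _
  left_inv _ _ := rfl
  mem_Ω _ _ _ := Set.mem_univ _
  right_inv x hx _ := by
    rw [stratum_zero] at hx
    exact hx.symm

/-- The local models of `FT_{≤ r}` given by local models at all points of the strata. -/
def localModels [Nontrivial ι] (model : ∀ c : ParamPoint T V r, LocalModel J (stratum T c.v))
    (h : ∀ c, J (treeParam c.b c.p) ∈ (model c).O) : LocalModels (boundedRank V T r) J where
  Idx := Option (ParamPoint T V r)
  Str i := stratum T (i.elim 0 ParamPoint.v)
  model
    | none => zeroModel J
    | some c => model c
  str_subset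
    | none => stratum_subset zero_mem_boundedRank
    | some c => stratum_subset c.mem
  str_eq i j := stratum_eq
  covers x hx := by
    by_cases hx0 : x = 0
    · refine ⟨none, ?_, Set.mem_univ _⟩
      change x ∈ stratum T 0
      rw [stratum_zero]
      exact hx0
    · obtain ⟨c, hcx, hc⟩ := exists_paramPoint hx hx0
      refine ⟨some c, ?_, ?_⟩
      · change x ∈ stratum T c.v
        rw [hcx]
        exact mem_stratum_self x
      · have hO := h c
        rw [hc] at hO
        exact hO

/-- The charts are indexed by all choices of `v`, `W`, `b` and regular `p`. Thus, for any of the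
prescribed parametrizations and any regular parameter, the atlas contains a chart built from that
same parametrization and centred at that parameter; openness and submersivity are checked in this
chart. -/
theorem exists_isTreeAtlas [Nontrivial ι] [∀ j, CompleteSpace (V j)] [CompleteSpace Y]
    (hcont : N.TensorMapContinuous) (hinj : N.DominatesInjective)
    (hJ : ∀ x, ‖J x‖ = N.nrm Finset.univ x) (hJd : DenseRange J) :
    ∃ A : BanachAtlas (boundedRank V T r), IsTreeAtlas T r A ∧ A.IsImmersedSubmanifold J := by
  choose model σ e₀ he₀ hσe₀ hσ hσΦ using fun c : ParamPoint T V r =>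
    exists_localModel hcont hinj hJ hJd (tbRank_pos c.ne_zero) (tbRank_univ c.ne_zero)
      c.isClosed c.isCompl c.b c.isRegular
  have hΦe₀ : ∀ c, (model c).Φ (e₀ c) = treeParam c.b c.p := fun c => by
    rw [← (hσΦ c _ (he₀ c)).1, hσe₀]
  have hOe₀ : ∀ c, J (treeParam c.b c.p) ∈ (model c).O := fun c =>
    hΦe₀ c ▸ (model c).mem_O _ (he₀ c)
  let M := localModels model hOe₀
  refine ⟨M.toAtlas, ⟨?_, fun v hv hv0 W hW hUW b => ⟨?_, treeParam_image hv0 hW hUW b, ?_⟩⟩,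
    M.isImmersedSubmanifold ?_⟩
  · refine M.isOpenSet_of_forall_mem fun x hx => ⟨none, ⟨?_, Set.mem_univ _⟩, fun y hy => ?_⟩
    · change x ∈ stratum T 0
      rwa [stratum_zero]
    · rw [← stratum_zero (T := T)]
      exact hy.1
  · refine M.isOpenSet_of_forall_mem fun x hx => ?_
    rw [← treeParam_image hv0 hW hUW b] at hx
    obtain ⟨p, hp, rfl⟩ := hx
    -- All points of this chart are values at regular parameters of the parametrization with the
    -- same `v`, `W`, `b`, so its source stays inside the chart domain.
    let c : ParamPoint T V r := ⟨v, hv, hv0, W, hW, hUW, b, p, hp⟩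
    refine ⟨some c, ⟨tbRank_treeParam (tbRank_pos hv0) (tbRank_univ hv0) hUW b hp, hOe₀ c⟩,
      fun y hy => ?_⟩
    have h1 := (model c).mem_Ω y hy.1 hy.2
    rw [← treeParam_image hv0 hW hUW b, ← (model c).right_inv y hy.1 hy.2, ← (hσΦ c _ h1).1]
    exact ⟨_, (hσΦ c _ h1).2, rfl⟩
  · refine M.isSubmersionOn fun p hp => ?_
    let c : ParamPoint T V r := ⟨v, hv, hv0, W, hW, hUW, b, p, hp⟩
    refine ⟨some c, σ c, e₀ c, he₀ c, hσe₀ c, hσ c, fun e he => (hσΦ c e he).1,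
      analyticAt_treeParam hcont hJ b p, ?_⟩
    filter_upwards [(isOpen_isRegular.preimage continuous_snd).mem_nhds hp] with q hq
    exact tbRank_treeParam (tbRank_pos hv0) (tbRank_univ hv0) hUW b hq
  · intro x _ y _ hxy
    rw [← sub_eq_zero]
    refine N.definite _ T.root_mem _ ?_
    rw [← hJ, map_sub, sub_eq_zero.2 hxy, norm_zero]

end TreeTensor

theorem mainTheorem10 {ι : Type*} [Fintype ι] [DecidableEq ι] [Nontrivial ι]
    (T : TreeTensor.PartitionTree ι)
    (V : ι → Type*) [∀ j, NormedAddCommGroup (V j)] [∀ j, NormedSpace ℝ (V j)]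
    [∀ j, CompleteSpace (V j)]
    (N : TreeTensor.TreeNorms T V)
    (hcont : N.TensorMapContinuous) (hinj : N.DominatesInjective)
    {Y : Type*} [NormedAddCommGroup Y] [NormedSpace ℝ Y] [CompleteSpace Y]
    (J : TreeTensor.TS V Finset.univ →ₗ[ℝ] Y)
    (hJ : ∀ x, ‖J x‖ = N.nrm Finset.univ x) (hJd : DenseRange J)
    (r : Finset ι → ℕ) :
    ∃ A : TreeTensor.BanachAtlas (TreeTensor.boundedRank V T r),
      TreeTensor.IsTreeAtlas T r A ∧ A.IsImmersedSubmanifold J :=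
  TreeTensor.exists_isTreeAtlas hcont hinj hJ hJd
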